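/- Let $\alpha_1,\alpha_2,\alpha_3\in[0,\pi/2]$ with $\alpha_1+\alpha_2+\alpha_3<\pi$, and let $S=S_{\alpha_1,\alpha_2,\alpha_3}$ be the triangular surface obtained by gluing two copies of a hyperbolic triangle $T$ with interior angles $\alpha_1,\alpha_2,\alpha_3$ (a vertex with angle $0$ is an ideal point) along their sides by the identity. So $S$ has three singular points $A_1,A_2,A_3$: $A_i$ is a cone point of total angle $2\alpha_i$ if $\alpha_i>0$, and a cusp (not a point of $S$) if $\alpha_i=0$. For $p\in S$ let $r_p$ be the injectivity radius at $p$, the largest $r\ge 0$ such that the ball $B_r(p)$ is isometric, as a piece of surface, to an open disk of radius $r$ in $\mathbb{H}^2$ centred at the point corresponding to $p$ (so $r_p=0$ if $p$ is a cone point). For $p\in S$ that is not a cone point, define the loop $\gamma_i$ at $p$ around $A_i$ as follows. If $\alpha_i=\pi/2$, then $\gamma_i$ runs from $p$ to $A_i$ along a length-realizing geodesic and back the same way. If $\alpha_i<\pi/2$, then $\gamma_i$ is a shortest one among the simple loops in $S\setminus\{A_1,A_2,A_3\}$ that are based at $p$, go around $A_i$ (that is, are freely homotopic in $S\setminus\{A_1,A_2,A_3\}$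 to a curve that encircles $A_i$ once) and are geodesic except at $p$. Then, for every point $p\in S$, the following are equivalent: 1. $p$ is a global maximum point of the function $q\mapsto r_q$ on $S$; 2. $p$ is a local maximum point of this function; 3. $p$ is not a cone point, and there are loops $\gamma_1,\gamma_2,\gamma_3$ as above at $p$ that all have length $2r_p$. Moreover, there are exactly two global maximum points. -/

import Mathlib

open scoped unitInterval Topology

noncomputable section

namespace TriangularSurface

/-- A closed half-plane of the hyperbolic plane (upper half-plane model), given by the inequality
`0 ≤ a |z|² + b Re z + c` with coefficients normalized by `b² - 4ac = 1`. Its boundary line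
`a |z|² + b Re z + c = 0` is a complete geodesic (a vertical line if `a = 0`, a half-circle centred
on the real axis otherwise), and every closed half-plane has exactly one such description. -/
structure HalfPlane where
  a : ℝ
  b : ℝ
  c : ℝ
  normalized : b ^ 2 - 4 * a * c = 1

/-- The function whose sign tells on which side of the boundary line a point lies. -/
def HalfPlane.eval (h : HalfPlane) (z : UpperHalfPlane) : ℝ :=
  h.a * (z.re ^ 2 + z.im ^ 2) + h.b * z.re + h.c

/-- The inner product of the unit normals of two half-planes. If the intersection of two distinct
half-planes has interior points, then for `t ∈ [0, π)` this number is `-cos t` if and only if the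
boundary lines meet and the intersection has interior angle `t` where they meet (for `t = 0`: the
boundary lines bound a strip whose ends have a common ideal point). -/
def HalfPlane.form (h k : HalfPlane) : ℝ :=
  h.b * k.b - 2 * (h.a * k.c + k.a * h.c)

/-- A hyperbolic triangle with interior angles `θ 0, θ 1, θ 2` (a vertex with angle `0` is ideal):
a nonempty intersection of three closed half-planes. The side number `i` is opposite to the vertex
number `i`, so the sides `i` and `j` enclose the angle `θ k`, for `i, j, k` distinct. -/
structure HypTriangle (θ : Fin 3 → ℝ) where
  side : Fin 3 → HalfPlane
  angle : ∀ i j k : Fin 3, i ≠ j → j ≠ k → i ≠ k →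
    (side i).form (side j) = -Real.cos (θ k)
  nonempty : ∃ z : UpperHalfPlane, ∀ i, 0 ≤ (side i).eval z

variable {θ : Fin 3 → ℝ}

/-- The closed triangle, as a set of points of the hyperbolic plane. -/
def HypTriangle.region (T : HypTriangle θ) : Set UpperHalfPlane :=
  {z | ∀ i, 0 ≤ (T.side i).eval z}

/-- The boundary of the triangle: the union of its three sides. -/
def HypTriangle.boundary (T : HypTriangle θ) : Set T.region :=
  {z | ∃ i, (T.side i).eval z = 0}

theorem HalfPlane.continuous_eval (h : HalfPlane) : Continuous h.eval := by
  unfold HalfPlane.eval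
  have h1 := UpperHalfPlane.continuous_re
  have h2 := UpperHalfPlane.continuous_im
  fun_prop

theorem HalfPlane.exists_eval_neg (h : HalfPlane) : ∃ z : UpperHalfPlane, h.eval z < 0 := by
  by_contra! H
  have key : ∀ x : ℝ, 0 ≤ h.a * (x * x) + h.b * x + h.c := by
    intro x
    have hc : Filter.Tendsto (fun y : ℝ => h.a * (x ^ 2 + y ^ 2) + h.b * x + h.c) (𝓝[>] 0)
        (𝓝 (h.a * (x ^ 2 + 0 ^ 2) + h.b * x + h.c)) := by
      refine (Continuous.tendsto ?_ (0 : ℝ)).mono_left nhdsWithin_le_nhds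
      fun_prop
    have h0 : 0 ≤ h.a * (x ^ 2 + 0 ^ 2) + h.b * x + h.c := by
      refine ge_of_tendsto hc ?_
      filter_upwards [self_mem_nhdsWithin] with y hy
      exact H ⟨⟨x, y⟩, hy⟩
    nlinarith [h0]
  have h1 := discrim_le_zero key
  have h2 := h.normalized
  unfold discrim at h1
  linarith

instance (T : HypTriangle θ) : Nonempty T.boundary := by
  by_contra hne
  have hpos : ∀ z ∈ T.region, ∀ i, 0 < (T.side i).eval z := by
    intro z hz i
    refine lt_of_le_of_ne (hz i) fun h => hne ⟨⟨⟨z, hz⟩, i, h.symm⟩⟩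
  have hcl : IsClosed T.region := by
    have : T.region = ⋂ i, {z | 0 ≤ (T.side i).eval z} := by
      ext z; simp [HypTriangle.region]
    rw [this]
    exact isClosed_iInter fun i => isClosed_le continuous_const (T.side i).continuous_eval
  have hop : IsOpen T.region := by
    have : T.region = ⋂ i, {z | 0 < (T.side i).eval z} := by
      ext z
      simp only [Set.mem_iInter, Set.mem_ofPred_eq]
      exact ⟨fun hz i => hpos z hz i, fun hz i => (hz i).le⟩
    rw [this]
    exact isOpen_iInter_of_finite fun i => isOpen_lt continuous_const (T.side i).continuous_eval
  have huniv := IsClopen.eq_univ ⟨hcl, hop⟩ T.nonempty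
  obtain ⟨z, hz⟩ := (T.side 0).exists_eval_neg
  have hz' : z ∈ T.region := huniv ▸ Set.mem_univ z
  exact absurd (hz' 0) (not_le.mpr hz)

/-- The surface obtained by gluing two copies of the triangle along their sides, with the gluing
metric (which is the length metric, since the triangle is convex). If the angles of the triangle
are at most `π / 2`, this is the triangular surface `S_{θ 0, θ 1, θ 2}`; its cone points have total
angles `2 θ i`, and it has a cusp for every `i` with `θ i = 0`. -/
def Surface (T : HypTriangle θ) : Type :=
  Metric.GlueSpace (Z := T.boundary) (Φ := Subtype.val) (Ψ := Subtype.val)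
    isometry_subtype_coe isometry_subtype_coe

instance (T : HypTriangle θ) : MetricSpace (Surface T) :=
  inferInstanceAs (MetricSpace (Metric.GlueSpace _ _))

/-- The inclusion of the first copy of the triangle in the surface. -/
def front (T : HypTriangle θ) (z : T.region) : Surface T :=
  Metric.toGlueL _ _ z

/-- The inclusion of the second copy of the triangle in the surface. -/
def back (T : HypTriangle θ) (z : T.region) : Surface T :=
  Metric.toGlueR _ _ z

/-- The side number `i`, as a subset of the surface. -/
def sideSet (T : HypTriangle θ) (i : Fin 3) : Set (Surface T) :=
  front T '' {z | (T.side i).eval z = 0}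

/-- The set consisting of the cone point number `v`, which is where the two sides with numbers
different from `v` meet; it is empty if the vertex `v` is ideal. -/
def conePoint (T : HypTriangle θ) (v : Fin 3) : Set (Surface T) :=
  front T '' {z | ∀ i, i ≠ v → (T.side i).eval z = 0}

/-- The cone points of the surface. (The cusps are not points of the surface.) -/
def singularSet (T : HypTriangle θ) : Set (Surface T) :=
  ⋃ v, conePoint T v

/-- The injectivity radius at `p`: the largest `r` such that the ball `B_r(p)`, with the
metric it has as a piece of surface, is isometric to a disk of radius `r` in the hyperbolic plane.
An isometry of pieces of surfaces is a homeomorphism that preserves distances locally;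
it sends the centre of the disk to `p`. -/
def injRadius (T : HypTriangle θ) (p : Surface T) : ℝ :=
  sSup {r : ℝ | 0 ≤ r ∧
    ∃ φ : Metric.ball UpperHalfPlane.I r ≃ₜ Metric.ball p r,
      (∀ x : Metric.ball UpperHalfPlane.I r, (x : UpperHalfPlane) = UpperHalfPlane.I → (φ x : Surface T) = p) ∧
      ∀ x, ∃ U ∈ 𝓝 x, ∀ y ∈ U, ∀ z ∈ U, dist (φ y) (φ z) = dist y z}

/-- The length of a path. -/
def pathLength {X : Type*} [MetricSpace X] {p q : X} (γ : Path p q) : ENNReal :=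
  eVariationOn γ Set.univ

/-- A closed curve that runs once around the singular point number `v`: it starts on one of the two
sides at `v`, goes through the first triangle to the other side at `v`, and returns through the
second triangle. (Both choices of the first side are allowed, so both orientations are.) -/
def IsLinkingCurve (T : HypTriangle θ) (v : Fin 3) (δ : I → Surface T) : Prop :=
  Continuous δ ∧ δ 0 = δ 1 ∧ (∀ t, δ t ∉ singularSet T) ∧
  (∃ i j : Fin 3, i ≠ v ∧ j ≠ v ∧ i ≠ j ∧ δ 0 ∈ sideSet T i ∧
    ∃ m : I, (m : ℝ) = 1 / 2 ∧ δ m ∈ sideSet T j) ∧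
  (∀ t : I, (t : ℝ) ≤ 1 / 2 → δ t ∈ Set.range (front T)) ∧
  (∀ t : I, 1 / 2 ≤ (t : ℝ) → δ t ∈ Set.range (back T))

/-- The closed curves `γ` and `δ` are freely homotopic in the complement of the singular points. -/
def FreelyHomotopic (T : HypTriangle θ) (γ δ : I → Surface T) : Prop :=
  ∃ H : I × I → Surface T, Continuous H ∧ (∀ t, H (0, t) = γ t) ∧ (∀ t, H (1, t) = δ t) ∧
    (∀ s, H (s, 0) = H (s, 1)) ∧ ∀ x, H x ∉ singularSet T

/-- A simple loop at `p` in the complement of the singular points, going around the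
singular point number `v` and geodesic (locally length-realizing, with constant speed) except
at `p`. -/
def IsGeodesicLoop (T : HypTriangle θ) (v : Fin 3) {p : Surface T} (γ : Path p p) : Prop :=
  (∀ s t : I, γ s = γ t → s = t ∨ (s = 0 ∧ t = 1) ∨ (s = 1 ∧ t = 0)) ∧
  (∀ t, γ t ∉ singularSet T) ∧
  (∃ δ, IsLinkingCurve T v δ ∧ FreelyHomotopic T γ δ) ∧
  ∃ c : ℝ, 0 < c ∧ ∀ t : I, 0 < t → t < 1 →
    ∃ U ∈ 𝓝 t, ∀ s ∈ U, ∀ s' ∈ U, dist (γ s) (γ s') = c * |(s : ℝ) - s'|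

/-- The loop at `p` associated with the singular point number `v`. If the cone point `v` has order
two, the loop goes from `p` to `v` along a length-realizing geodesic and back the same way.
Otherwise it is the simple loop at `p` around `v` that is geodesic except at `p` (a shortest one,
since a longer one may exist that makes a detour around another singular point). -/
def IsAssociatedLoop (T : HypTriangle θ) (v : Fin 3) {p : Surface T} (γ : Path p p) : Prop :=
  (θ v = Real.pi / 2 ∧ ∃ a ∈ conePoint T v, ∃ η : Path p a,
    pathLength η = ENNReal.ofReal (dist p a) ∧ γ = η.trans η.symm) ∨
  (θ v ≠ Real.pi / 2 ∧ IsGeodesicLoop T v γ ∧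
    ∀ γ' : Path p p, IsGeodesicLoop T v γ' → pathLength γ ≤ pathLength γ')

end TriangularSurface

end

/-! Develop the surface around a point that lies over `P` in the triangle: the triangle stands for
the copy containing the point, and its three mirror images stand for the other copy (`fold`). A
distance between points of different copies is the least of the distances obtained by reflecting one
of them in a side (`exists_dist_R_le`, `dist_copy_not_le`). Since the angles are at most `π / 2`,
the triangle and one mirror image together form a convex set. Seen from the other copy, the point
sits at the mirror images `R 0 P`, `R 1 P`, `R 2 P`, and the loop around the vertex `i` is the
segment from `R j P` to `R k P`. If these three points are pairwise at least `2 r` apart, the disk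
of radius `r` folds onto a ball of the surface as a chart (`Separated.exists_isChart`). If two of
them are exactly `2 r` apart, no larger disk works, because two radii meet head-on at the midpoint
of the segment (`Separated.not_isChart`). With `g i = sinh² (dist (R j P) (R k P) / 2)` and `m = min
g i` this gives `sinh² r_p = m` (`injRadius_copy`), and the problem becomes one about `m` on the
triangle.

Let `x i` be the hyperbolic sine of the distance to the side `i` and `D = gramDet θ > 0`. The Gram
matrix of the side normals gives `D * cosh (dist p q)` as a bilinear form in the coordinates, and `D
* (g i + sin² θ i)` as the square of a linear form `l i`. At a proper vertex `l i` is proportional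
to the hyperbolic cosine of the distance to that vertex. Two facts decide the matter. Moving away
from a side increases the `g` of both vertices on it, so the three `g i` agree at a local maximum
(`g_eq_of_localMax`). And no move from a point of the triangle increases all `g i` weakly, because
`D * cosh (dist p q) = ∑ x i q * l i p` (`eq_of_g_le`); so a point where the three `g i` agree is
the only maximum point of `m`. Existence follows from compactness, as `m` tends to zero in the cusps
(`exists_m_max`). The maximum point is interior to the triangle, hence gives exactly two points of
the surface.

For condition 3, a geodesic leaving the centre of an embedded disk of radius `r` runs straight to
its boundary, so geodesic loops have length at least `2 r`. In case of equality the loop consists of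
two radii, and is the segment between two mirror images at distance `2 r`
(`IsGeodesicLoop.exists_bigon`). A winding number identifies the vertex it encircles
(`Crosses.ne_of_linking`), so a loop of length `2 r` around `v` forces `g v = m`. Conversely, if `g
v = m > 0` and `P` is interior, this segment is the required loop; its midpoint is the cone point
exactly if `θ v = π / 2`. Thus condition 3 says that all `g v` equal `m`. -/

noncomputable section

namespace TriangularSurface

open HypTriangle

/-! ### The hyperboloid model -/

section

/-- The ambient space of the hyperboloid model. -/
abbrev Vec := ℝ × ℝ × ℝ

/-- The Minkowski form of the hyperboloid model. -/
def mink (x y : Vec) : ℝ := x.2.1 * y.2.1 - (x.1 * y.2.2 + x.2.2 * y.1) / 2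

/-- The point of the hyperboloid that corresponds to a point of the upper half-plane. -/
def vec (z : UpperHalfPlane) : Vec := ((z.re ^ 2 + z.im ^ 2) / z.im, z.re / z.im, 1 / z.im)

/-- The unit normal of a half-plane. -/
def HalfPlane.normal (h : HalfPlane) : Vec := (-2 * h.c, h.b, -2 * h.a)

/-- The Minkowski product with the unit normal: the hyperbolic sine of the signed distance to the
boundary line. -/
def HalfPlane.coord (h : HalfPlane) (z : UpperHalfPlane) : ℝ := mink h.normal (vec z)

theorem mink_comm (x y : Vec) : mink x y = mink y x := by simp only [mink]; ring

theorem mink_add_right (x y z : Vec) : mink x (y + z) = mink x y + mink x z := by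
  simp only [mink, Prod.fst_add, Prod.snd_add]; ring

theorem mink_sub_right (x y z : Vec) : mink x (y - z) = mink x y - mink x z := by
  simp only [mink, Prod.fst_sub, Prod.snd_sub]; ring

theorem mink_smul_right (r : ℝ) (x y : Vec) : mink x (r • y) = r * mink x y := by
  simp only [mink, Prod.smul_fst, Prod.smul_snd, smul_eq_mul]; ring

theorem mink_add_left (x y z : Vec) : mink (x + y) z = mink x z + mink y z := by
  simp only [mink, Prod.fst_add, Prod.snd_add]; ring

theorem mink_sub_left (x y z : Vec) : mink (x - y) z = mink x z - mink y z := by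
  simp only [mink, Prod.fst_sub, Prod.snd_sub]; ring

theorem mink_smul_left (r : ℝ) (x y : Vec) : mink (r • x) y = r * mink x y := by
  simp only [mink, Prod.smul_fst, Prod.smul_snd, smul_eq_mul]; ring

theorem HalfPlane.eval_eq (h : HalfPlane) (z : UpperHalfPlane) : h.eval z = z.im * h.coord z := by
  have := z.im_ne_zero
  simp only [HalfPlane.eval, HalfPlane.coord, HalfPlane.normal, mink, vec]
  field_simp
  ring

theorem HalfPlane.eval_nonneg_iff (h : HalfPlane) (z : UpperHalfPlane) :
    0 ≤ h.eval z ↔ 0 ≤ h.coord z := by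
  rw [h.eval_eq, mul_nonneg_iff_of_pos_left z.im_pos]

theorem HalfPlane.eval_eq_zero_iff (h : HalfPlane) (z : UpperHalfPlane) :
    h.eval z = 0 ↔ h.coord z = 0 := by
  rw [h.eval_eq, mul_eq_zero, or_iff_right z.im_ne_zero]

theorem HalfPlane.continuous_coord (h : HalfPlane) : Continuous h.coord := by
  have : h.coord = fun z => h.eval z / z.im := by
    ext z; rw [h.eval_eq, mul_div_cancel_left₀ _ z.im_ne_zero]
  rw [this]
  exact h.continuous_eval.div UpperHalfPlane.continuous_im fun z => z.im_ne_zero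

theorem form_eq_mink (h k : HalfPlane) : h.form k = mink h.normal k.normal := by
  simp only [HalfPlane.form, HalfPlane.normal, mink]; ring

theorem mink_normal_self (h : HalfPlane) : mink h.normal h.normal = 1 := by
  rw [← h.normalized]; simp only [HalfPlane.normal, mink]; ring

theorem cosh_dist_eq (z w : UpperHalfPlane) : Real.cosh (dist z w) = -mink (vec z) (vec w) := by
  have := z.im_ne_zero
  have := w.im_ne_zero
  rw [UpperHalfPlane.cosh_dist']
  simp only [mink, vec]
  field_simp
  ring

theorem mink_vec_self (z : UpperHalfPlane) : mink (vec z) (vec z) = -1 := by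
  have := cosh_dist_eq z z
  rw [dist_self, Real.cosh_zero] at this
  linarith

theorem eq_of_mink_vec {z w : UpperHalfPlane} (h : -mink (vec z) (vec w) ≤ 1) : z = w := by
  rw [← cosh_dist_eq] at h
  have : Real.cosh (dist z w) = 1 := le_antisymm h (Real.one_le_cosh _)
  by_contra hne
  exact (Real.one_lt_cosh.mpr (dist_ne_zero.mpr hne)).ne' this

theorem vec_injective : Function.Injective vec := fun z w h =>
  eq_of_mink_vec (by rw [h, mink_vec_self]; simp)

theorem dist_le_iff_mink {z w z' w' : UpperHalfPlane} :
    dist z w ≤ dist z' w' ↔ -mink (vec z) (vec w) ≤ -mink (vec z') (vec w') := by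
  rw [← cosh_dist_eq, ← cosh_dist_eq, Real.cosh_le_cosh, abs_of_nonneg dist_nonneg,
    abs_of_nonneg dist_nonneg]

theorem dist_eq_of_mink {z w : UpperHalfPlane} {r : ℝ} (hr : 0 ≤ r)
    (h : -mink (vec z) (vec w) = Real.cosh r) : dist z w = r := by
  rw [← cosh_dist_eq] at h
  exact Real.cosh_strictMonoOn.injOn (Set.mem_Ici.2 dist_nonneg) (Set.mem_Ici.2 hr) h

theorem vec_last_pos (z : UpperHalfPlane) : 0 < (vec z).2.2 := one_div_pos.mpr z.im_pos

/-- The sign of the last coordinate selects the sheet; the vector `(u, v, w)` comes from the point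
`(v + i) / w`. -/
theorem exists_vec_eq {x : Vec} (h : mink x x = -1) (hw : 0 < x.2.2) :
    ∃ z : UpperHalfPlane, vec z = x := by
  refine ⟨⟨⟨x.2.1 / x.2.2, 1 / x.2.2⟩, by simpa using hw⟩, ?_⟩
  obtain ⟨u, v, w⟩ := x
  simp only [mink] at h hw
  have hw' := hw.ne'
  have hu : u = (v ^ 2 + 1) / w := by field_simp; linarith
  simp only [vec, UpperHalfPlane.re, UpperHalfPlane.im, hu, Prod.mk.injEq]
  refine ⟨?_, ?_, ?_⟩ <;> field_simp

theorem exists_vec_eq_smul {x : Vec} (h : mink x x < 0) (hw : 0 < x.2.2) :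
    ∃ z : UpperHalfPlane, vec z = (1 / √(-mink x x)) • x := by
  have h0 : 0 < √(-mink x x) := Real.sqrt_pos.2 (by linarith)
  apply exists_vec_eq
  · rw [mink_smul_left, mink_smul_right]
    have := Real.sq_sqrt (show 0 ≤ -mink x x by linarith)
    field_simp
    linarith
  · simp only [Prod.smul_snd, smul_eq_mul]
    positivity

/-- The form is positive definite on the orthogonal complement of a timelike vector. This turns
linear identities between points into two scalar checks. -/
theorem eq_zero_of_mink_vec {x : Vec} {z : UpperHalfPlane} (h : mink x (vec z) = 0)
    (h' : mink x x ≤ 0) : x = 0 := by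
  obtain ⟨u, v, w⟩ := x
  have hz := z.im_pos
  have hz' := hz.ne'
  set a := z.re
  set y := z.im
  simp only [mink, vec] at h h'
  have hu : u = 2 * v * a - w * (a ^ 2 + y ^ 2) := by
    field_simp at h
    linarith
  have key : (v - w * a) ^ 2 + (w * y) ^ 2 ≤ 0 := by rw [hu] at h'; nlinarith
  have h1 : w * y = 0 := by nlinarith [sq_nonneg (v - w * a), sq_nonneg (w * y)]
  have h2 : v - w * a = 0 := by nlinarith [sq_nonneg (v - w * a), sq_nonneg (w * y)]
  have hw : w = 0 := (mul_eq_zero.1 h1).resolve_right hz'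
  subst hw
  have hv : v = 0 := by linarith
  subst hv
  simp [hu]

/-! ### Geodesics -/

/-- Hyperbolic interpolation: with `d = dist P Q` the vector at time `t` is `(sinh ((1 - t) d) P +
sinh (t d) Q) / sinh d`. The nonnegative coefficients are recorded because linear inequalities, such
as membership in a triangle, then pass from the ends to the whole segment. -/
theorem exists_geodesic (P Q : UpperHalfPlane) : ∃ g : ℝ → UpperHalfPlane, g 0 = P ∧ g 1 = Q ∧
    (∀ s ∈ Set.Icc (0 : ℝ) 1, ∀ t ∈ Set.Icc (0 : ℝ) 1, dist (g s) (g t) = dist P Q * |s - t|) ∧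
    ∀ t ∈ Set.Icc (0 : ℝ) 1, ∃ α β : ℝ, 0 ≤ α ∧ 0 ≤ β ∧ (t < 1 → 0 < α) ∧ (0 < t → 0 < β) ∧
      vec (g t) = α • vec P + β • vec Q := by
  rcases eq_or_ne P Q with rfl | hPQ
  · refine ⟨fun _ => P, rfl, rfl, by simp, fun t ht => ⟨1 - t, t, by linarith [ht.2], ht.1,
      fun h => by linarith, fun h => h, ?_⟩⟩
    rw [← add_smul]; simp
  set d := dist P Q with hd
  have hd0 : 0 < d := dist_pos.2 hPQ
  have hs : 0 < Real.sinh d := Real.sinh_pos_iff.2 hd0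
  have hch : mink (vec P) (vec Q) = -Real.cosh d := by rw [hd, cosh_dist_eq]; ring
  let A : ℝ → ℝ := fun t => Real.sinh ((1 - t) * d) / Real.sinh d
  let B : ℝ → ℝ := fun t => Real.sinh (t * d) / Real.sinh d
  have hA : ∀ t, t ≤ 1 → 0 ≤ A t := fun t ht =>
    div_nonneg (Real.sinh_nonneg_iff.2 (mul_nonneg (by linarith) hd0.le)) hs.le
  have hB : ∀ t, 0 ≤ t → 0 ≤ B t := fun t ht =>
    div_nonneg (Real.sinh_nonneg_iff.2 (mul_nonneg ht hd0.le)) hs.le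
  have hA' : ∀ t, t < 1 → 0 < A t := fun t ht =>
    div_pos (Real.sinh_pos_iff.2 (mul_pos (by linarith) hd0)) hs
  have hB' : ∀ t, 0 < t → 0 < B t := fun t ht =>
    div_pos (Real.sinh_pos_iff.2 (mul_pos ht hd0)) hs
  have hm : ∀ s t, mink (A s • vec P + B s • vec Q) (A t • vec P + B t • vec Q)
      = -Real.cosh (d * (s - t)) := by
    intro s t
    simp only [mink_add_left, mink_add_right, mink_smul_left, mink_smul_right, mink_vec_self,
      mink_comm (vec Q) (vec P), hch]
    have e1 : (1 - s) * d = d - s * d := by ring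
    have e2 : (1 - t) * d = d - t * d := by ring
    have e3 : d * (s - t) = s * d - t * d := by ring
    simp only [A, B, e1, e2, e3, Real.sinh_sub, Real.cosh_sub]
    have h2 := Real.cosh_sq d
    generalize s * d = x
    generalize t * d = y
    field_simp
    linear_combination Real.sinh x * Real.sinh y * h2
  have hex : ∀ t ∈ Set.Icc (0 : ℝ) 1, ∃ z, vec z = A t • vec P + B t • vec Q := by
    intro t ht
    apply exists_vec_eq
    · rw [hm]; simp
    · simp only [Prod.snd_add, Prod.smul_snd, smul_eq_mul]
      have h1 := vec_last_pos P
      have h2 := vec_last_pos Q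
      have h3 := hA t ht.2
      have h4 := hB t ht.1
      rcases ht.2.lt_or_eq with h | h
      · have := hA' t h; positivity
      · have := hB' t (by linarith); positivity
  choose! g hg using hex
  have h0 : (0 : ℝ) ∈ Set.Icc (0 : ℝ) 1 := by simp
  have h1 : (1 : ℝ) ∈ Set.Icc (0 : ℝ) 1 := by simp
  refine ⟨g, vec_injective ?_, vec_injective ?_, fun s hs' t ht => ?_, fun t ht =>
    ⟨A t, B t, hA t ht.2, hB t ht.1, hA' t, hB' t, hg t ht⟩⟩
  · rw [hg 0 h0]; simp [A, B, hs.ne']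
  · rw [hg 1 h1]; simp [A, B, hs.ne']
  · apply dist_eq_of_mink (by positivity)
    rw [hg s hs', hg t ht, hm, neg_neg, ← Real.cosh_abs, abs_mul, abs_of_pos hd0]

/-- A point of the geodesic from `P` to `Q`, parametrized proportionally to arc length by `[0, 1]`. -/
def geo (P Q : UpperHalfPlane) : ℝ → UpperHalfPlane := (exists_geodesic P Q).choose

theorem geo_zero (P Q : UpperHalfPlane) : geo P Q 0 = P := (exists_geodesic P Q).choose_spec.1

theorem geo_one (P Q : UpperHalfPlane) : geo P Q 1 = Q := (exists_geodesic P Q).choose_spec.2.1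

theorem dist_geo (P Q : UpperHalfPlane) {s t : ℝ} (hs : s ∈ Set.Icc (0 : ℝ) 1)
    (ht : t ∈ Set.Icc (0 : ℝ) 1) : dist (geo P Q s) (geo P Q t) = dist P Q * |s - t| :=
  (exists_geodesic P Q).choose_spec.2.2.1 s hs t ht

theorem vec_geo (P Q : UpperHalfPlane) {t : ℝ} (ht : t ∈ Set.Icc (0 : ℝ) 1) :
    ∃ α β : ℝ, 0 ≤ α ∧ 0 ≤ β ∧ (t < 1 → 0 < α) ∧ (0 < t → 0 < β) ∧
      vec (geo P Q t) = α • vec P + β • vec Q :=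
  (exists_geodesic P Q).choose_spec.2.2.2 t ht

theorem dist_left_geo (P Q : UpperHalfPlane) {t : ℝ} (ht : t ∈ Set.Icc (0 : ℝ) 1) :
    dist P (geo P Q t) = t * dist P Q := by
  have := dist_geo P Q (s := 0) (by simp) ht
  rw [geo_zero] at this
  rw [this, zero_sub, abs_neg, abs_of_nonneg ht.1, mul_comm]

theorem dist_geo_right (P Q : UpperHalfPlane) {t : ℝ} (ht : t ∈ Set.Icc (0 : ℝ) 1) :
    dist (geo P Q t) Q = (1 - t) * dist P Q := by
  have := dist_geo P Q (t := 1) ht (by simp)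
  rw [geo_one] at this
  rw [this, abs_sub_comm, abs_of_nonneg (by linarith [ht.2]), mul_comm]

theorem continuousOn_geo (P Q : UpperHalfPlane) : ContinuousOn (geo P Q) (Set.Icc 0 1) := by
  have : LipschitzOnWith (Real.toNNReal (dist P Q)) (geo P Q) (Set.Icc 0 1) := by
    apply LipschitzOnWith.of_dist_le_mul
    intro s hs t ht
    rw [dist_geo P Q hs ht, Real.coe_toNNReal _ dist_nonneg, Real.dist_eq]
  exact this.continuousOn

/-- The points of a geodesic segment are determined by the distances to its ends. -/
theorem sinh_smul_vec_of_between {P z Q : UpperHalfPlane} {a b : ℝ} (ha : dist P z = a)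
    (hb : dist z Q = b) (hab : dist P Q = a + b) :
    Real.sinh (a + b) • vec z = Real.sinh b • vec P + Real.sinh a • vec Q := by
  have h1 : mink (vec P) (vec z) = -Real.cosh a := by rw [← ha, cosh_dist_eq]; ring
  have h2 : mink (vec z) (vec Q) = -Real.cosh b := by rw [← hb, cosh_dist_eq]; ring
  have h3 : mink (vec P) (vec Q) = -Real.cosh (a + b) := by rw [← hab, cosh_dist_eq]; ring
  have ca := Real.cosh_sq a
  have cb := Real.cosh_sq b
  -- The difference of the two sides is orthogonal to `vec z` and has square zero, so it vanishes.
  rw [← sub_eq_zero]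
  apply eq_zero_of_mink_vec (z := z)
  · simp only [mink_sub_left, mink_add_left, mink_smul_left, mink_vec_self, h1,
      mink_comm (vec Q) (vec z), h2, Real.sinh_add]
    ring
  · apply le_of_eq
    simp only [mink_sub_left, mink_add_left, mink_smul_left, mink_sub_right, mink_add_right,
      mink_smul_right, mink_vec_self, h1, mink_comm (vec Q) (vec z), mink_comm (vec Q) (vec P),
      mink_comm (vec z) (vec P), h2, h3, Real.sinh_add, Real.cosh_add]
    linear_combination Real.sinh a ^ 2 * cb + Real.sinh b ^ 2 * ca

theorem vec_add_of_midpoint {a m b : UpperHalfPlane} {h : ℝ} (h1 : dist a m = h) (h2 : dist m b = h)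
    (h3 : dist a b = 2 * h) : vec a + vec b = (2 * Real.cosh h) • vec m := by
  have := sinh_smul_vec_of_between h1 h2 (by rw [h3]; ring)
  rcases eq_or_ne h 0 with rfl | h0
  · rw [dist_eq_zero] at h1 h2
    subst h1 h2
    simp [two_smul]
  · have hs : Real.sinh h ≠ 0 := by simpa using h0
    have e : Real.sinh (h + h) = Real.sinh h * (2 * Real.cosh h) := by rw [Real.sinh_add]; ring
    rw [e, ← smul_add, mul_smul] at this
    exact (smul_right_injective _ hs this).symm

/-- The median formula: pair the midpoint relation with `vec Q`. Along a geodesic it is the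
functional equation of the hyperbolic cosine. -/
theorem cosh_dist_add_of_midpoint {a m b : UpperHalfPlane} {h : ℝ} (h1 : dist a m = h)
    (h2 : dist m b = h) (h3 : dist a b = 2 * h) (Q : UpperHalfPlane) :
    Real.cosh (dist Q a) + Real.cosh (dist Q b) = 2 * Real.cosh h * Real.cosh (dist Q m) := by
  rw [cosh_dist_eq, cosh_dist_eq, cosh_dist_eq]
  have := congrArg (mink (vec Q)) (vec_add_of_midpoint h1 h2 h3)
  rw [mink_add_right, mink_smul_right] at this
  linarith

end

section

/-! ### Curves that are locally Lipschitz or locally geodesic -/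

/-- Induction along the interval. Nothing is assumed near the left end, as loops are geodesic only
away from their base point; that end is reached by continuity. -/
theorem dist_le_of_locally {X : Type*} [PseudoMetricSpace X] {f : ℝ → X} {a b c : ℝ} (hab : a < b)
    (hf : ContinuousOn f (Set.Icc a b))
    (hloc : ∀ t ∈ Set.Ioo a b, ∃ ε > 0, ∀ s ∈ Set.Ioo t (t + ε), dist (f t) (f s) ≤ c * (s - t)) :
    dist (f a) (f b) ≤ c * (b - a) := by
  have key : ∀ a' ∈ Set.Ioo a b, dist (f a') (f b) ≤ c * (b - a') := by
    intro a' ha'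
    have hsub : Set.Icc a' b ⊆ Set.Icc a b := Set.Icc_subset_Icc_left ha'.1.le
    have hf' := hf.mono hsub
    have : Set.Icc a' b ⊆ {x | dist (f a') (f x) ≤ c * (x - a')} := by
      apply IsClosed.Icc_subset_of_forall_exists_gt
      · rw [Set.inter_comm]
        have hg : ContinuousOn (fun x => dist (f a') (f x) - c * (x - a')) (Set.Icc a' b) :=
          (continuous_dist.comp_continuousOn (continuousOn_const.prodMk hf')).sub (by fun_prop)
        have := hg.preimage_isClosed_of_isClosed isClosed_Icc (isClosed_Iic (a := (0 : ℝ)))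
        convert this using 1
        ext x
        simp
      · simp
      · rintro x ⟨hx, hx'⟩ y hy
        obtain ⟨ε, hε, h⟩ := hloc x ⟨ha'.1.trans_le hx'.1, hx'.2⟩
        have hy' : x < y := hy
        obtain ⟨m, hm1, hm2⟩ := exists_between (lt_min hy' (lt_add_of_pos_right x hε))
        refine ⟨m, ?_, hm1, (hm2.trans_le (min_le_left _ _)).le⟩
        have h1 := h m ⟨hm1, hm2.trans_le (min_le_right _ _)⟩
        have h2 := dist_triangle (f a') (f x) (f m)
        simp only [Set.mem_ofPred_eq] at hx ⊢
        linarith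
    exact this ⟨ha'.2.le, le_rfl⟩
  have hnb : (𝓝[Set.Ioo a b] a).NeBot := by
    rw [← mem_closure_iff_nhdsWithin_neBot, closure_Ioo hab.ne]
    exact ⟨le_rfl, hab.le⟩
  have h1 : Filter.Tendsto (fun x => dist (f x) (f b)) (𝓝[Set.Ioo a b] a) (𝓝 (dist (f a) (f b))) :=
    (((hf a ⟨le_rfl, hab.le⟩).mono Set.Ioo_subset_Icc_self).tendsto).dist tendsto_const_nhds
  have h2 : Filter.Tendsto (fun x => c * (b - x)) (𝓝[Set.Ioo a b] a) (𝓝 (c * (b - a))) :=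
    (Continuous.tendsto (by fun_prop) a).mono_left nhdsWithin_le_nhds
  exact le_of_tendsto_of_tendsto h1 h2 (eventually_nhdsWithin_of_forall key)

/-- A maximum principle for the functional equation of the hyperbolic cosine. -/
theorem nonpos_of_cosh_equation {w : ℝ → ℝ} {a b c : ℝ} (hc : 0 < c)
    (hw : ContinuousOn w (Set.Icc a b)) (ha : w a = 0) (hb : w b = 0)
    (hloc : ∀ t ∈ Set.Ioo a b, ∃ ε > 0, ∀ h ∈ Set.Ioo 0 ε,
      w (t + h) + w (t - h) = 2 * Real.cosh (c * h) * w t) :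
    ∀ t ∈ Set.Icc a b, w t ≤ 0 := by
  intro t ht
  obtain ⟨m, hm, hmax⟩ := isCompact_Icc.exists_isMaxOn ⟨t, ht⟩ hw
  refine (hmax ht).trans ?_
  by_contra! hpos
  have hma : a < m := lt_of_le_of_ne hm.1 (by rintro rfl; linarith)
  have hmb : m < b := lt_of_le_of_ne hm.2 (by rintro rfl; linarith)
  obtain ⟨ε, hε, h⟩ := hloc m ⟨hma, hmb⟩
  obtain ⟨k, hk0, hk⟩ := exists_between (lt_min hε (lt_min (sub_pos.2 hma) (sub_pos.2 hmb)))
  rw [lt_min_iff, lt_min_iff] at hk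
  -- At a positive interior maximum the left side is at most `2 * w m`, while the factor `cosh (c *
  -- k) > 1` makes the right side larger.
  have e := h k ⟨hk0, hk.1⟩
  have h1 : w (m + k) ≤ w m := hmax ⟨by linarith, by linarith⟩
  have h2 : w (m - k) ≤ w m := hmax ⟨by linarith, by linarith⟩
  have h3 : 1 < Real.cosh (c * k) := Real.one_lt_cosh.2 (by positivity)
  nlinarith

theorem eq_zero_of_cosh_equation {w : ℝ → ℝ} {a b c : ℝ} (hc : 0 < c)
    (hw : ContinuousOn w (Set.Icc a b)) (ha : w a = 0) (hb : w b = 0)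
    (hloc : ∀ t ∈ Set.Ioo a b, ∃ ε > 0, ∀ h ∈ Set.Ioo 0 ε,
      w (t + h) + w (t - h) = 2 * Real.cosh (c * h) * w t) :
    ∀ t ∈ Set.Icc a b, w t = 0 := by
  intro t ht
  refine le_antisymm (nonpos_of_cosh_equation hc hw ha hb hloc t ht) ?_
  have := nonpos_of_cosh_equation (w := fun x => -w x) hc hw.neg (by simp [ha]) (by simp [hb])
    (fun t ht => by
      obtain ⟨ε, hε, h⟩ := hloc t ht
      exact ⟨ε, hε, fun k hk => by have := h k hk; linarith⟩) t ht
  linarith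

/-- A curve in the hyperbolic plane that is locally geodesic is geodesic, from its start on. -/
theorem dist_eq_of_locally_geodesic {η : ℝ → UpperHalfPlane} {c τ : ℝ} (hc : 0 < c)
    (hη : ContinuousOn η (Set.Ico 0 τ))
    (hloc : ∀ t ∈ Set.Ioo 0 τ, ∃ ε > 0, ∀ s s' : ℝ, |s - t| < ε → |s' - t| < ε →
      dist (η s) (η s') = c * |s - s'|) :
    ∀ t ∈ Set.Ico 0 τ, dist (η 0) (η t) = c * t := by
  intro b hb
  rcases hb.1.eq_or_lt with rfl | hb0
  · simp
  have hsub : Set.Icc 0 b ⊆ Set.Ico 0 τ := Set.Icc_subset_Ico_right hb.2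
  have hsub' : Set.Ioo 0 b ⊆ Set.Ioo 0 τ := Set.Ioo_subset_Ioo_right hb.2.le
  have hη' := hη.mono hsub
  have hlip : ∀ t ∈ Set.Ioc 0 b, dist (η 0) (η t) ≤ c * t := by
    intro t ht
    have := dist_le_of_locally (f := η) (c := c) ht.1 (hη'.mono (Set.Icc_subset_Icc_right ht.2))
      (fun s hs => by
        obtain ⟨ε, hε, h⟩ := hloc s (hsub' ⟨hs.1, hs.2.trans_le ht.2⟩)
        refine ⟨ε, hε, fun s' hs' => ?_⟩
        have hs1 := hs'.1
        have hs2 := hs'.2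
        rw [h s s' (by simpa using hε) (by rw [abs_of_pos] <;> linarith), abs_sub_comm,
          abs_of_pos (by linarith)])
    simpa using this
  set u : ℝ → ℝ := fun t => Real.cosh (dist (η 0) (η t)) with hu
  have hs0 : 0 < Real.sinh (c * b) := Real.sinh_pos_iff.2 (by positivity)
  -- `cosh (c t) + B sinh (c t)` is the solution of the functional equation that agrees with `u` at
  -- `0` and `b`; uniqueness gives equality in between. It remains to see that `B = 0`.
  set B := (u b - Real.cosh (c * b)) / Real.sinh (c * b) with hB
  have hucont : ContinuousOn u (Set.Icc 0 b) :=
    Real.continuous_cosh.comp_continuousOn (continuous_dist.comp_continuousOn (continuousOn_const.prodMk hη'))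
  have hw := eq_zero_of_cosh_equation
    (w := fun t => u t - Real.cosh (c * t) - B * Real.sinh (c * t)) (a := 0) (b := b) hc
    ((hucont.sub (by fun_prop)).sub (by fun_prop)) (by simp [hu])
    (by simp only [hB]; field_simp; ring) (fun t ht => by
      obtain ⟨ε, hε, h⟩ := hloc t (hsub' ht)
      refine ⟨ε, hε, fun k hk => ?_⟩
      have hk1 := hk.1
      have hk2 := hk.2
      have e := cosh_dist_add_of_midpoint (a := η (t + k)) (m := η t) (b := η (t - k)) (h := c * k)
        (by rw [h _ _ (by rw [abs_of_pos] <;> linarith) (by simpa using hε), abs_of_pos] <;> linarith)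
        (by rw [h _ _ (by simpa using hε) (by rw [abs_of_neg] <;> linarith), abs_of_pos] <;> linarith)
        (by rw [h _ _ (by rw [abs_of_pos] <;> linarith) (by rw [abs_of_neg] <;> linarith),
              abs_of_pos] <;> linarith) (η 0)
      simp only [hu]
      have e1 : c * (t + k) = c * t + c * k := by ring
      have e2 : c * (t - k) = c * t - c * k := by ring
      rw [e1, e2, Real.cosh_add, Real.cosh_sub, Real.sinh_add, Real.sinh_sub]
      linear_combination e)
  -- The curve is `c`-Lipschitz, so `u b ≤ cosh (c b)`.
  have hBle : B ≤ 0 := by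
    have := hlip b ⟨hb0, le_rfl⟩
    apply div_nonpos_of_nonpos_of_nonneg _ hs0.le
    rw [sub_nonpos, Real.cosh_le_cosh, abs_of_nonneg dist_nonneg, abs_of_nonneg (by positivity)]
    exact this
  -- By the half-angle formulas, `u t ≥ 1` says `tanh (c t / 2) + B ≥ 0`; let `t` tend to `0`.
  have hBge : 0 ≤ B := by
    have hpos : ∀ t ∈ Set.Ioc 0 b, 0 ≤ Real.tanh (c * t / 2) + B := by
      intro t ht
      have h1 := hw t ⟨ht.1.le, ht.2⟩
      have h2 : 1 ≤ u t := Real.one_le_cosh _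
      have h3 : 0 < Real.sinh (c * t / 2) := Real.sinh_pos_iff.2 (by have := ht.1; positivity)
      have h4 := Real.cosh_pos (c * t / 2)
      have e1 : c * t = 2 * (c * t / 2) := by ring
      rw [e1, Real.cosh_two_mul, Real.sinh_two_mul, Real.cosh_sq] at h1
      rw [Real.tanh_eq_sinh_div_cosh]
      have : 0 ≤ 2 * Real.sinh (c * t / 2) * (Real.sinh (c * t / 2) + B * Real.cosh (c * t / 2)) := by
        nlinarith
      have := nonneg_of_mul_nonneg_right this (by positivity)
      have : 0 ≤ (Real.sinh (c * t / 2) + B * Real.cosh (c * t / 2)) / Real.cosh (c * t / 2) := by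
        positivity
      convert this using 1
      field_simp
    have hlim : Filter.Tendsto (fun t => Real.tanh (c * t / 2) + B) (𝓝[Set.Ioc 0 b] 0)
        (𝓝 (Real.tanh (c * 0 / 2) + B)) := by
      refine (Continuous.tendsto ?_ 0).mono_left nhdsWithin_le_nhds
      have : Continuous Real.tanh := by
        have : Real.tanh = fun x => Real.sinh x / Real.cosh x := by
          ext x; exact Real.tanh_eq_sinh_div_cosh x
        rw [this]
        exact Real.continuous_sinh.div Real.continuous_cosh fun x => (Real.cosh_pos x).ne'
      fun_prop
    have hnb : (𝓝[Set.Ioc 0 b] (0 : ℝ)).NeBot := by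
      rw [← mem_closure_iff_nhdsWithin_neBot, closure_Ioc hb0.ne]
      exact ⟨le_rfl, hb0.le⟩
    simpa using ge_of_tendsto hlim (eventually_nhdsWithin_of_forall hpos)
  have h1 := hw b ⟨hb0.le, le_rfl⟩
  have hB0 : B = 0 := le_antisymm hBle hBge
  simp only [hB0, zero_mul, sub_zero, hu] at h1
  exact Real.cosh_strictMonoOn.injOn (Set.mem_Ici.2 dist_nonneg)
    (Set.mem_Ici.2 (by positivity : 0 ≤ c * b)) (by linarith)

/-! ### Reflections -/

theorem HalfPlane.exists_reflection (h : HalfPlane) (z : UpperHalfPlane) :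
    ∃ z' : UpperHalfPlane, vec z' = vec z - (2 * h.coord z) • h.normal := by
  apply exists_vec_eq
  · have h1 : mink h.normal (vec z) = h.coord z := rfl
    simp only [mink_sub_left, mink_sub_right, mink_smul_left, mink_smul_right, mink_vec_self,
      mink_normal_self, mink_comm (vec z) h.normal, h1]
    ring
  · have h0 := z.im_pos
    have h1 := h.normalized
    -- A sum of squares over `z.im`, so the reflected vector stays on the upper sheet.
    have e : (vec z - (2 * h.coord z) • h.normal).2.2 =
        (4 * h.a ^ 2 * z.im ^ 2 + (2 * h.a * z.re + h.b) ^ 2) / z.im := by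
      simp only [Prod.snd_sub, Prod.smul_snd, HalfPlane.normal, vec, smul_eq_mul, HalfPlane.coord,
        mink]
      field_simp
      linear_combination -h1
    rw [e]
    apply div_pos _ h0
    rcases eq_or_ne h.a 0 with ha | ha
    · have : h.b ≠ 0 := by rintro hb; simp [ha, hb] at h1
      rw [ha]
      simpa using sq_pos_of_ne_zero this
    · positivity

/-- The reflection in the boundary line of a half-plane. -/
def HalfPlane.refl (h : HalfPlane) (z : UpperHalfPlane) : UpperHalfPlane :=
  (h.exists_reflection z).choose

theorem HalfPlane.vec_refl (h : HalfPlane) (z : UpperHalfPlane) :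
    vec (h.refl z) = vec z - (2 * h.coord z) • h.normal := (h.exists_reflection z).choose_spec

theorem HalfPlane.coord_refl (h k : HalfPlane) (z : UpperHalfPlane) :
    k.coord (h.refl z) = k.coord z - 2 * h.coord z * k.form h := by
  rw [HalfPlane.coord, h.vec_refl, mink_sub_right, mink_smul_right, form_eq_mink]; rfl

theorem HalfPlane.form_self (h : HalfPlane) : h.form h = 1 := by
  rw [form_eq_mink, mink_normal_self]

theorem HalfPlane.coord_refl_self (h : HalfPlane) (z : UpperHalfPlane) :
    h.coord (h.refl z) = -h.coord z := by
  rw [h.coord_refl, h.form_self]; ring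

theorem HalfPlane.refl_refl (h : HalfPlane) (z : UpperHalfPlane) : h.refl (h.refl z) = z := by
  apply vec_injective
  rw [h.vec_refl, h.coord_refl_self, h.vec_refl]
  module

theorem HalfPlane.refl_eq_self (h : HalfPlane) {z : UpperHalfPlane} (hz : h.coord z = 0) :
    h.refl z = z := by
  apply vec_injective
  rw [h.vec_refl, hz]; simp

theorem HalfPlane.mink_refl (h : HalfPlane) (z w : UpperHalfPlane) :
    mink (vec (h.refl z)) (vec w) = mink (vec z) (vec w) - 2 * h.coord z * h.coord w := by
  rw [h.vec_refl, mink_sub_left, mink_smul_left]; rfl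

theorem HalfPlane.isometry_refl (h : HalfPlane) : Isometry h.refl := by
  refine Isometry.of_dist_eq fun z w => dist_eq_of_mink dist_nonneg ?_
  rw [h.mink_refl, mink_comm (vec z), h.mink_refl, h.coord_refl_self, cosh_dist_eq,
    mink_comm (vec w)]
  ring

theorem HalfPlane.dist_refl_refl (h : HalfPlane) (z w : UpperHalfPlane) :
    dist (h.refl z) (h.refl w) = dist z w := h.isometry_refl.dist_eq z w

theorem HalfPlane.dist_refl_comm (h : HalfPlane) (z w : UpperHalfPlane) :
    dist (h.refl z) w = dist z (h.refl w) := by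
  rw [← h.dist_refl_refl z, h.refl_refl]

/-- Points on the same side are at most as far from each other as from the mirror images. -/
theorem HalfPlane.dist_le_dist_refl (h : HalfPlane) {z w : UpperHalfPlane}
    (hzw : 0 ≤ h.coord z * h.coord w) : dist z w ≤ dist (h.refl z) w := by
  rw [dist_le_iff_mink, h.mink_refl]
  nlinarith

theorem isometry_exists (P : UpperHalfPlane) :
    ∃ f : UpperHalfPlane ≃ᵢ UpperHalfPlane, f UpperHalfPlane.I = P := by
  obtain ⟨g, hg⟩ := MulAction.exists_smul_eq (Matrix.SpecialLinearGroup (Fin 2) ℝ)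
    UpperHalfPlane.I P
  exact ⟨IsometryEquiv.constSMul g, hg⟩

end

section

variable {θ : Fin 3 → ℝ}

/-! ### Coordinates on a triangle -/

namespace HypTriangle

/-- The hyperbolic sine of the signed distance to the side number `i`. -/
def x (T : HypTriangle θ) (i : Fin 3) (z : UpperHalfPlane) : ℝ := (T.side i).coord z

/-- The reflection in the side number `i`. -/
def R (T : HypTriangle θ) (i : Fin 3) (z : UpperHalfPlane) : UpperHalfPlane := (T.side i).refl z

variable (T : HypTriangle θ)

theorem mem_region_iff {z : UpperHalfPlane} : z ∈ T.region ↔ ∀ i, 0 ≤ T.x i z :=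
  forall_congr' fun i => (T.side i).eval_nonneg_iff z

theorem continuous_x (i : Fin 3) : Continuous (T.x i) := (T.side i).continuous_coord

theorem isometry_R (i : Fin 3) : Isometry (T.R i) := (T.side i).isometry_refl

theorem R_R (i : Fin 3) (z : UpperHalfPlane) : T.R i (T.R i z) = z := (T.side i).refl_refl z

theorem R_eq_self {i : Fin 3} {z : UpperHalfPlane} (h : T.x i z = 0) : T.R i z = z :=
  (T.side i).refl_eq_self h

theorem dist_R_R (i : Fin 3) (z w : UpperHalfPlane) : dist (T.R i z) (T.R i w) = dist z w :=
  (T.isometry_R i).dist_eq z w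

theorem dist_R_comm (i : Fin 3) (z w : UpperHalfPlane) : dist (T.R i z) w = dist z (T.R i w) :=
  (T.side i).dist_refl_comm z w

theorem x_R_self (i : Fin 3) (z : UpperHalfPlane) : T.x i (T.R i z) = -T.x i z :=
  (T.side i).coord_refl_self z

theorem x_R {i j k : Fin 3} (hij : i ≠ j) (hjk : j ≠ k) (hik : i ≠ k) (z : UpperHalfPlane) :
    T.x j (T.R i z) = T.x j z + 2 * T.x i z * Real.cos (θ k) := by
  have := (T.side i).coord_refl (T.side j) z
  rw [T.angle j i k hij.symm hik hjk] at this
  rw [x, R, this, x, x]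
  ring

theorem dist_le_dist_R {i : Fin 3} {z w : UpperHalfPlane} (h : 0 ≤ T.x i z * T.x i w) :
    dist z w ≤ dist (T.R i z) w := (T.side i).dist_le_dist_refl h

theorem isClosed_region : IsClosed T.region := by
  have : T.region = ⋂ i, {z | 0 ≤ T.x i z} := by
    ext z; simp [T.mem_region_iff]
  rw [this]
  exact isClosed_iInter fun i => isClosed_le continuous_const (T.continuous_x i)

theorem eventually_mem_region {z : UpperHalfPlane} (h : ∀ i, 0 < T.x i z) :
    ∀ᶠ y in 𝓝 z, y ∈ T.region := by
  have : ∀ᶠ y in 𝓝 z, ∀ i, 0 < T.x i y :=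
    Filter.eventually_all.2 fun i => (T.continuous_x i).continuousAt.eventually (lt_mem_nhds (h i))
  filter_upwards [this] with y hy
  exact T.mem_region_iff.2 fun i => (hy i).le

theorem x_of_vec {z P Q : UpperHalfPlane} {α β : ℝ} (h : vec z = α • vec P + β • vec Q)
    (i : Fin 3) : T.x i z = α * T.x i P + β * T.x i Q := by
  rw [x, HalfPlane.coord, h, mink_add_right, mink_smul_right, mink_smul_right]; rfl

theorem geo_mem_region {P Q : UpperHalfPlane} (hP : P ∈ T.region) (hQ : Q ∈ T.region) {t : ℝ}
    (ht : t ∈ Set.Icc (0 : ℝ) 1) : geo P Q t ∈ T.region := by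
  rw [mem_region_iff] at *
  obtain ⟨α, β, hα, hβ, -, -, h⟩ := vec_geo P Q ht
  intro i
  rw [T.x_of_vec h]
  have := hP i
  have := hQ i
  positivity

/-- The union of the triangle with its mirror image in the side number `j`. -/
def wedge (j : Fin 3) : Set UpperHalfPlane := {z | z ∈ T.region ∨ T.R j z ∈ T.region}

variable {T}

theorem R_mem_wedge {j : Fin 3} {z : UpperHalfPlane} (h : z ∈ T.wedge j) : T.R j z ∈ T.wedge j := by
  rcases h with h | h
  · right; rwa [R_R]
  · exact Or.inl h

theorem exists_third {j k : Fin 3} (h : j ≠ k) :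
    ∃ i, i ≠ j ∧ i ≠ k ∧ ∀ l, l = i ∨ l = j ∨ l = k := by
  revert j k; decide

/-- Reflection in the side `j` adds `2 * x j * cos (θ i)` to `x k`. Here the angles being at most `π
/ 2` matters. -/
theorem x_R_nonneg (hc : ∀ i, 0 ≤ Real.cos (θ i)) {j k : Fin 3} (h : k ≠ j) {z : UpperHalfPlane}
    (hk : 0 ≤ T.x k z) (hj : 0 ≤ T.x j z) : 0 ≤ T.x k (T.R j z) := by
  obtain ⟨i, h1, h2, -⟩ := exists_third h
  rw [T.x_R h.symm h1.symm h2.symm]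
  have := hc i
  positivity

/-- The wedge is convex: doubled angles are at most `π`, so it is cut out by the other two sides and
their mirror images. -/
theorem mem_wedge_iff (hc : ∀ i, 0 ≤ Real.cos (θ i)) {j : Fin 3} {z : UpperHalfPlane} :
    z ∈ T.wedge j ↔ ∀ k, k ≠ j → 0 ≤ T.x k z ∧ 0 ≤ T.x k (T.R j z) := by
  constructor
  · rintro (h | h) k hk
    · rw [mem_region_iff] at h
      exact ⟨h k, x_R_nonneg hc hk (h k) (h j)⟩
    · rw [mem_region_iff] at h
      have := x_R_nonneg hc hk (h k) (h j)
      rw [R_R] at this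
      exact ⟨this, h k⟩
  · intro h
    rcases le_total 0 (T.x j z) with h0 | h0
    · left
      rw [mem_region_iff]
      intro i
      rcases eq_or_ne i j with rfl | hi
      · exact h0
      · exact (h i hi).1
    · right
      rw [mem_region_iff]
      intro i
      rcases eq_or_ne i j with rfl | hi
      · rw [x_R_self]; linarith
      · exact (h i hi).2

theorem x_R_of_vec {z P Q : UpperHalfPlane} {α β : ℝ} (h : vec z = α • vec P + β • vec Q)
    (i j : Fin 3) : T.x i (T.R j z) = α * T.x i (T.R j P) + β * T.x i (T.R j Q) := by
  have e : ∀ w, T.x i (T.R j w) = T.x i w - 2 * T.x j w * (T.side i).form (T.side j) :=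
    fun w => (T.side j).coord_refl (T.side i) w
  rw [e, e, e, T.x_of_vec h, T.x_of_vec h]
  ring

theorem geo_mem_wedge (hc : ∀ i, 0 ≤ Real.cos (θ i)) {j : Fin 3} {P Q : UpperHalfPlane}
    (hP : P ∈ T.wedge j) (hQ : Q ∈ T.wedge j) {t : ℝ} (ht : t ∈ Set.Icc (0 : ℝ) 1) :
    geo P Q t ∈ T.wedge j := by
  rw [mem_wedge_iff hc] at *
  obtain ⟨α, β, hα, hβ, -, -, h⟩ := vec_geo P Q ht
  intro k hk
  rw [T.x_of_vec h, x_R_of_vec h]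
  obtain ⟨h1, h2⟩ := hP k hk
  obtain ⟨h3, h4⟩ := hQ k hk
  constructor <;> positivity

end HypTriangle

open HypTriangle

/-! ### The metric of the surface -/

variable (T : HypTriangle θ)

open Classical in
/-- The point `z` of the triangle, as a point of the first (`b = true`) or second (`b = false`) copy
of it in the surface. -/
def copy (b : Bool) (z : UpperHalfPlane) : Surface T :=
  if h : z ∈ T.region then bif b then front T ⟨z, h⟩ else back T ⟨z, h⟩
  else front T ⟨T.nonempty.choose, T.nonempty.choose_spec⟩

variable {T}

theorem copy_true {z : UpperHalfPlane} (h : z ∈ T.region) : copy T true z = front T ⟨z, h⟩ := by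
  simp [copy, h]

theorem copy_false {z : UpperHalfPlane} (h : z ∈ T.region) : copy T false z = back T ⟨z, h⟩ := by
  simp [copy, h]

theorem exists_eq_copy (p : Surface T) : ∃ b, ∃ z ∈ T.region, p = copy T b z := by
  obtain ⟨z | z, rfl⟩ := Quotient.mk''_surjective p
  · exact ⟨true, z, z.2, (copy_true z.2).symm⟩
  · exact ⟨false, z, z.2, (copy_false z.2).symm⟩

theorem dist_front_back (z w : T.region) :
    dist (front T z) (back T w) = ⨅ p : T.boundary, dist z p.1 + dist w p.1 := by
  -- The gluing distance carries an additive parameter, which is zero for the glued space.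
  have : dist (front T z) (back T w) = (⨅ p : T.boundary, dist z p.1 + dist w p.1) + 0 := rfl
  rw [this, add_zero]

theorem dist_copy_self {b : Bool} {z w : UpperHalfPlane} (hz : z ∈ T.region) (hw : w ∈ T.region) :
    dist (copy T b z) (copy T b w) = dist z w := by
  cases b
  · rw [copy_false hz, copy_false hw]; rfl
  · rw [copy_true hz, copy_true hw]; rfl

theorem dist_copy_not_eq (b : Bool) {z w : UpperHalfPlane} (hz : z ∈ T.region) (hw : w ∈ T.region) :
    dist (copy T b z) (copy T (!b) w) =
      ⨅ p : T.boundary, dist z (p.1 : UpperHalfPlane) + dist w (p.1 : UpperHalfPlane) := by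
  cases b
  · rw [Bool.not_false, dist_comm, copy_false hz, copy_true hw, dist_front_back]
    congr 1
    ext p
    rw [add_comm]; rfl
  · rw [Bool.not_true, copy_true hz, copy_false hw, dist_front_back]
    rfl

theorem dist_copy_not_le_add (b : Bool) {z w q : UpperHalfPlane} (hz : z ∈ T.region)
    (hw : w ∈ T.region) (hq : q ∈ T.region) {i : Fin 3} (hi : T.x i q = 0) :
    dist (copy T b z) (copy T (!b) w) ≤ dist z q + dist q w := by
  rw [dist_copy_not_eq b hz hw, dist_comm q w]
  exact ciInf_le (f := fun p : T.boundary =>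
    dist z (p.1 : UpperHalfPlane) + dist w (p.1 : UpperHalfPlane))
    ⟨0, Set.forall_mem_range.2 fun _ => by positivity⟩
    ⟨⟨q, hq⟩, i, ((T.side i).eval_eq_zero_iff q).2 hi⟩

/-- A path through a point `q` of the side `i` can be straightened by reflecting its first part, as
`R i q = q`. Together with `dist_copy_not_le`, the distance between the copies is the minimum over
`j` of `dist (T.R j z) w`. -/
theorem exists_dist_R_le (b : Bool) {z w : UpperHalfPlane} (hz : z ∈ T.region) (hw : w ∈ T.region) :
    ∃ j, dist (T.R j z) w ≤ dist (copy T b z) (copy T (!b) w) := by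
  by_contra! H
  obtain ⟨j, hj⟩ := Finite.exists_min fun j => dist (T.R j z) w
  refine (H j).not_ge ?_
  rw [dist_copy_not_eq b hz hw]
  refine le_ciInf fun p => ?_
  obtain ⟨⟨q, hq⟩, i, hi⟩ := p
  refine (hj i).trans ?_
  have e : T.R i q = q := T.R_eq_self (((T.side i).eval_eq_zero_iff q).1 hi)
  have := dist_triangle (T.R i z) (T.R i q) w
  rw [dist_R_R, e, dist_comm q w] at this
  exact this

/-- The segment from `R j z` to `w` first meets the triangle at a boundary point `q`. As `z` and `q`
are on the same side of the line `j`, the detour from `z` through `q` to `w` is no longer than the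
segment. -/
theorem dist_copy_not_le (b : Bool) {z w : UpperHalfPlane} (hz : z ∈ T.region) (hw : w ∈ T.region)
    (j : Fin 3) : dist (copy T b z) (copy T (!b) w) ≤ dist (T.R j z) w := by
  set g := geo (T.R j z) w with hg
  have hgc := continuousOn_geo (T.R j z) w
  set S := Set.Icc (0 : ℝ) 1 ∩ g ⁻¹' T.region with hS
  have hScl : IsClosed S := hgc.preimage_isClosed_of_isClosed isClosed_Icc T.isClosed_region
  have hSne : S.Nonempty := ⟨1, by simp, by simpa [hg, geo_one] using hw⟩
  have hSb : BddBelow S := ⟨0, fun t ht => ht.1.1⟩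
  obtain ⟨h01, hq⟩ := hScl.csInf_mem hSne hSb
  set t := sInf S with ht
  -- At the first entrance time the point cannot be interior, else the segment would have entered
  -- earlier. If that time is `0`, then `R j z` is itself in the triangle, so it lies on the side
  -- `j`.
  have hbd : ∃ i, T.x i (g t) = 0 := by
    rcases h01.1.eq_or_lt with h0 | h0
    · have h1 : g t = T.R j z := by rw [← h0, hg, geo_zero]
      refine ⟨j, ?_⟩
      have h2 := (T.mem_region_iff.1 hq) j
      have h3 := (T.mem_region_iff.1 hz) j
      rw [h1, x_R_self] at h2 ⊢
      linarith
    · by_contra! hne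
      have hpos : ∀ i, 0 < T.x i (g t) := fun i =>
        lt_of_le_of_ne (T.mem_region_iff.1 hq i) (hne i).symm
      have hev : ∀ᶠ s in 𝓝[Set.Icc 0 1] t, g s ∈ T.region :=
        (hgc t h01).eventually (T.eventually_mem_region hpos)
      have hev' : ∀ᶠ s in 𝓝[<] t, g s ∈ T.region := by
        refine Filter.Eventually.filter_mono ?_ hev
        refine nhdsWithin_le_of_mem ?_
        exact Filter.mem_of_superset (Ioo_mem_nhdsLT h0) fun s hs =>
          ⟨hs.1.le, hs.2.le.trans h01.2⟩
      obtain ⟨s, hs1, hs2⟩ := (hev'.and (Ioo_mem_nhdsLT h0)).exists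
      exact (csInf_le hSb ⟨⟨hs2.1.le, hs2.2.le.trans h01.2⟩, hs1⟩).not_gt hs2.2
  obtain ⟨i, hi⟩ := hbd
  calc dist (copy T b z) (copy T (!b) w) ≤ dist z (g t) + dist (g t) w :=
        dist_copy_not_le_add b hz hw hq hi
    _ ≤ dist (T.R j z) (g t) + dist (g t) w := by
        gcongr
        exact T.dist_le_dist_R (mul_nonneg (T.mem_region_iff.1 hz j) (T.mem_region_iff.1 hq j))
    _ = dist (T.R j z) w := by
        rw [hg, dist_left_geo _ _ h01, dist_geo_right _ _ h01]; ring

theorem copy_not_eq {b : Bool} {z : UpperHalfPlane} (hz : z ∈ T.region) {i : Fin 3}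
    (hi : T.x i z = 0) : copy T (!b) z = copy T b z := by
  rw [eq_comm, ← dist_le_zero]
  have := dist_copy_not_le_add b hz hz hz hi
  simpa using this

theorem copy_injective {b : Bool} {z w : UpperHalfPlane} (hz : z ∈ T.region) (hw : w ∈ T.region)
    (h : copy T b z = copy T b w) : z = w := by
  rw [← dist_eq_zero, ← dist_copy_self (b := b) hz hw, h, dist_self]

theorem copy_eq_copy_not {b : Bool} {z w : UpperHalfPlane} (hz : z ∈ T.region) (hw : w ∈ T.region)
    (h : copy T b z = copy T (!b) w) : z = w ∧ ∃ i, T.x i z = 0 := by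
  obtain ⟨j, hj⟩ := exists_dist_R_le b hz hw
  rw [h, dist_self] at hj
  have e : T.R j z = w := dist_le_zero.1 hj
  have h1 := T.mem_region_iff.1 hz j
  have h2 := T.mem_region_iff.1 hw j
  rw [← e, x_R_self] at h2
  have h3 : T.x j z = 0 := by linarith
  rw [T.R_eq_self h3] at e
  exact ⟨e, j, h3⟩

/-! ### Folding the hyperbolic plane onto the surface -/

variable (T)

open Classical in
/-- The map that sends the triangle to the copy number `b` of it, and its mirror images in its sides
to the other copy. -/
def fold (b : Bool) (z : UpperHalfPlane) : Surface T :=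
  if z ∈ T.region then copy T b z
  else if h : ∃ j, T.R j z ∈ T.region then copy T (!b) (T.R h.choose z) else copy T b z

variable {T}

theorem fold_of_mem {b : Bool} {z : UpperHalfPlane} (h : z ∈ T.region) :
    fold T b z = copy T b z := by simp [fold, h]

/-- The choice in `fold` does not matter: a point in the mirror images in two different sides `j`,
`k` has `x k ≥ 0` by convexity of the wedge and `x k ≤ 0` by reflection, so it lies on the side `k`
and in the triangle. -/
theorem fold_of_R_mem (hc : ∀ i, 0 ≤ Real.cos (θ i)) {b : Bool} {j : Fin 3} {z : UpperHalfPlane}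
    (h : T.R j z ∈ T.region) : fold T b z = copy T (!b) (T.R j z) := by
  by_cases hz : z ∈ T.region
  · have h1 := T.mem_region_iff.1 h j
    have h2 := T.mem_region_iff.1 hz j
    rw [x_R_self] at h1
    have h3 : T.x j z = 0 := by linarith
    rw [fold_of_mem hz, T.R_eq_self h3, copy_not_eq hz h3]
  · have hex : ∃ j, T.R j z ∈ T.region := ⟨j, h⟩
    have hk := hex.choose_spec
    rw [fold, if_neg hz, dif_pos hex]
    set k := hex.choose
    rcases eq_or_ne k j with e | hkj
    · rw [e]
    · exfalso
      have h1 := ((mem_wedge_iff hc).1 (Or.inr h : z ∈ T.wedge j) k hkj).1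
      have h2 := T.mem_region_iff.1 hk k
      rw [x_R_self] at h2
      rw [T.R_eq_self (by linarith)] at hk
      exact hz hk

theorem fold_R (hc : ∀ i, 0 ≤ Real.cos (θ i)) {b : Bool} {j : Fin 3} {z : UpperHalfPlane}
    (h : z ∈ T.wedge j) : fold T b (T.R j z) = fold T (!b) z := by
  rcases h with h | h
  · rw [fold_of_R_mem (j := j) hc (by rwa [R_R]), R_R, fold_of_mem h]
  · rw [fold_of_mem h, fold_of_R_mem hc h, Bool.not_not]

theorem dist_fold_le (hc : ∀ i, 0 ≤ Real.cos (θ i)) {b : Bool} {j : Fin 3} {z w : UpperHalfPlane}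
    (hz : z ∈ T.wedge j) (hw : w ∈ T.wedge j) : dist (fold T b z) (fold T b w) ≤ dist z w := by
  have key : ∀ {z w}, z ∈ T.region → T.R j w ∈ T.region →
      dist (fold T b z) (fold T b w) ≤ dist z w := by
    intro z w hz hw
    rw [fold_of_mem hz, fold_of_R_mem hc hw]
    refine (dist_copy_not_le b hz hw j).trans ?_
    rw [dist_R_R]
  rcases hz with hz | hz <;> rcases hw with hw | hw
  · rw [fold_of_mem hz, fold_of_mem hw, dist_copy_self hz hw]
  · exact key hz hw
  · rw [dist_comm, dist_comm z]; exact key hw hz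
  · rw [fold_of_R_mem hc hz, fold_of_R_mem hc hw, dist_copy_self hz hw, dist_R_R]

/-- A map between metric spaces preserves distances near a point. -/
def IsometricAt {X Y : Type*} [MetricSpace X] [MetricSpace Y] (f : X → Y) (x : X) : Prop :=
  ∃ U ∈ 𝓝 x, ∀ y ∈ U, ∀ z ∈ U, dist (f y) (f z) = dist y z

theorem isometricAt_fold_of_R_pos (hc : ∀ i, 0 ≤ Real.cos (θ i)) {b : Bool} {j : Fin 3}
    {z : UpperHalfPlane} (h : ∀ i, 0 < T.x i (T.R j z)) : IsometricAt (fold T b) z := by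
  refine ⟨_, (T.isometry_R j).continuous.continuousAt.eventually (T.eventually_mem_region h),
    fun y hy w hw => ?_⟩
  rw [fold_of_R_mem hc hy, fold_of_R_mem hc hw, dist_copy_self hy hw, dist_R_R]

/-- Away from the vertices at most one coordinate vanishes, and two copies of a half-disk are glued
to a disk: close to `z` the shortest way between the copies is across the side `j`. -/
theorem isometricAt_fold_of_mem (hc : ∀ i, 0 ≤ Real.cos (θ i)) {b : Bool} {j : Fin 3}
    {z : UpperHalfPlane} (hz : z ∈ T.region) (h : ∀ i, i ≠ j → 0 < T.x i z) :
    IsometricAt (fold T b) z ∧ ∀ᶠ y in 𝓝 z, y ∈ T.wedge j := by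
  rcases (T.mem_region_iff.1 hz j).lt_or_eq with hj | hj
  · have hpos : ∀ i, 0 < T.x i z := fun i => by
      rcases eq_or_ne i j with rfl | hi
      · exact hj
      · exact h i hi
    refine ⟨⟨_, T.eventually_mem_region hpos, fun y hy w hw => ?_⟩,
      (T.eventually_mem_region hpos).mono fun y hy => Or.inl hy⟩
    have hy' : y ∈ T.region := hy
    have hw' : w ∈ T.region := hw
    rw [fold_of_mem hy', fold_of_mem hw', dist_copy_self hy' hw']
  · have hRz := T.R_eq_self hj.symm
    have h1 : ∀ᶠ y in 𝓝 z, y ∈ T.wedge j := by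
      have : ∀ᶠ y in 𝓝 z, ∀ k, k ≠ j → 0 < T.x k y ∧ 0 < T.x k (T.R j y) := by
        refine Filter.eventually_all.2 fun k => ?_
        by_cases hk : k = j
        · simp [hk]
        have e1 := (T.continuous_x k).continuousAt.eventually (lt_mem_nhds (h k hk))
        have e2 := ((T.continuous_x k).comp (T.isometry_R j).continuous).continuousAt.eventually
          (lt_mem_nhds (show 0 < (T.x k ∘ T.R j) z by simpa [hRz] using h k hk))
        filter_upwards [e1, e2] with y h1 h2 _ using ⟨h1, h2⟩
      filter_upwards [this] with y hy
      exact (mem_wedge_iff hc).2 fun k hk => ⟨(hy k hk).1.le, (hy k hk).2.le⟩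
    -- At `(z, z)` the left side is zero and the right side is `dist (T.R l z) z > 0`, so crossing
    -- another side `l` is not competitive nearby.
    have h2 : ∀ᶠ q in 𝓝 (z, z), ∀ l, l ≠ j → dist q.1 q.2 < dist (T.R l q.1) (T.R j q.2) := by
      refine Filter.eventually_all.2 fun l => ?_
      by_cases hl : l = j
      · simp [hl]
      have hl' : T.R l z ≠ z := fun e => by
        have := T.x_R_self l z
        rw [e] at this
        have := h l hl
        linarith
      have c1 : Continuous fun q : UpperHalfPlane × UpperHalfPlane => dist q.1 q.2 := by fun_prop
      have c2 : Continuous fun q : UpperHalfPlane × UpperHalfPlane =>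
          dist (T.R l q.1) (T.R j q.2) :=
        ((T.isometry_R l).continuous.comp continuous_fst).dist
          ((T.isometry_R j).continuous.comp continuous_snd)
      have := c1.continuousAt.eventually_lt c2.continuousAt (x₀ := (z, z))
        (by simpa [hRz] using hl')
      filter_upwards [this] with q hq _ using hq
    refine ⟨?_, h1⟩
    rw [nhds_prod_eq] at h2
    obtain ⟨U, hU, V, hV, hUV⟩ := Filter.mem_prod_iff.1 h2
    refine ⟨U ∩ V ∩ {y | y ∈ T.wedge j}, Filter.inter_mem (Filter.inter_mem hU hV) h1, ?_⟩
    have key : ∀ {y w}, y ∈ U → w ∈ V → y ∈ T.region → T.R j w ∈ T.region →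
        dist y w ≤ dist (fold T b y) (fold T b w) := by
      intro y w hyU hwV hy hw
      rw [fold_of_mem hy, fold_of_R_mem hc hw]
      obtain ⟨l, hl⟩ := exists_dist_R_le b hy hw
      refine le_trans ?_ hl
      rcases eq_or_ne l j with rfl | hlj
      · rw [dist_R_R]
      · exact (hUV (Set.mk_mem_prod hyU hwV) l hlj).le
    rintro y ⟨⟨hyU, hyV⟩, hy⟩ w ⟨⟨hwU, hwV⟩, hw⟩
    refine le_antisymm (dist_fold_le hc hy hw) ?_
    rcases hy with hy | hy <;> rcases hw with hw | hw
    · rw [fold_of_mem hy, fold_of_mem hw, dist_copy_self hy hw]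
    · exact key hyU hwV hy hw
    · rw [dist_comm, dist_comm (fold T b y)]; exact key hwU hyV hw hy
    · rw [fold_of_R_mem hc hy, fold_of_R_mem hc hw, dist_copy_self hy hw, dist_R_R]

end

section

variable {θ : Fin 3 → ℝ}
open HypTriangle

/-! ### The Gram matrix -/

/-- The negative of the determinant of the Gram matrix of the normals. -/
def gramDet (θ : Fin 3 → ℝ) : ℝ :=
  Real.cos (θ 0) ^ 2 + Real.cos (θ 1) ^ 2 + Real.cos (θ 2) ^ 2 +
    2 * Real.cos (θ 0) * Real.cos (θ 1) * Real.cos (θ 2) - 1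

/-- The bilinear form given by the adjugate of the Gram matrix of the normals. -/
def adjForm (θ : Fin 3 → ℝ) (x y : Fin 3 → ℝ) : ℝ :=
  (1 - Real.cos (θ 0) ^ 2) * (x 0 * y 0) + (1 - Real.cos (θ 1) ^ 2) * (x 1 * y 1) +
    (1 - Real.cos (θ 2) ^ 2) * (x 2 * y 2) +
    (Real.cos (θ 2) + Real.cos (θ 0) * Real.cos (θ 1)) * (x 0 * y 1 + x 1 * y 0) +
    (Real.cos (θ 1) + Real.cos (θ 0) * Real.cos (θ 2)) * (x 0 * y 2 + x 2 * y 0) +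
    (Real.cos (θ 0) + Real.cos (θ 1) * Real.cos (θ 2)) * (x 1 * y 2 + x 2 * y 1)

theorem adjForm_eq (θ : Fin 3 → ℝ) {i j k : Fin 3} (hij : i ≠ j) (hjk : j ≠ k) (hik : i ≠ k)
    (x y : Fin 3 → ℝ) : adjForm θ x y =
      (1 - Real.cos (θ i) ^ 2) * (x i * y i) + (1 - Real.cos (θ j) ^ 2) * (x j * y j) +
      (1 - Real.cos (θ k) ^ 2) * (x k * y k) +
      (Real.cos (θ k) + Real.cos (θ i) * Real.cos (θ j)) * (x i * y j + x j * y i) +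
      (Real.cos (θ j) + Real.cos (θ i) * Real.cos (θ k)) * (x i * y k + x k * y i) +
      (Real.cos (θ i) + Real.cos (θ j) * Real.cos (θ k)) * (x j * y k + x k * y j) := by
  obtain rfl | rfl | rfl : i = 0 ∨ i = 1 ∨ i = 2 := by omega
  all_goals obtain rfl | rfl | rfl : j = 0 ∨ j = 1 ∨ j = 2 := by omega
  all_goals obtain rfl | rfl | rfl : k = 0 ∨ k = 1 ∨ k = 2 := by omega
  all_goals first | exact absurd rfl hij | exact absurd rfl hjk | exact absurd rfl hik | skip
  all_goals unfold adjForm; ring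

/-- Four vectors in three-space are dependent, so the mixed Gram matrix of `n₀, n₁, n₂, p` against
`n₀, n₁, n₂, q` is singular. This is its determinant expanded along the last row and column. -/
theorem gram_identity (p q n₀ n₁ n₂ : Vec) :
    mink p q * (mink n₀ n₀ * mink n₁ n₁ * mink n₂ n₂ + 2 * mink n₀ n₁ * mink n₁ n₂ * mink n₀ n₂ -
      mink n₀ n₀ * mink n₁ n₂ ^ 2 - mink n₁ n₁ * mink n₀ n₂ ^ 2 - mink n₂ n₂ * mink n₀ n₁ ^ 2) =
    (mink n₁ n₁ * mink n₂ n₂ - mink n₁ n₂ ^ 2) * (mink n₀ p * mink n₀ q) +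
    (mink n₀ n₀ * mink n₂ n₂ - mink n₀ n₂ ^ 2) * (mink n₁ p * mink n₁ q) +
    (mink n₀ n₀ * mink n₁ n₁ - mink n₀ n₁ ^ 2) * (mink n₂ p * mink n₂ q) +
    (mink n₀ n₂ * mink n₁ n₂ - mink n₀ n₁ * mink n₂ n₂) *
      (mink n₀ p * mink n₁ q + mink n₁ p * mink n₀ q) +
    (mink n₀ n₁ * mink n₁ n₂ - mink n₀ n₂ * mink n₁ n₁) *
      (mink n₀ p * mink n₂ q + mink n₂ p * mink n₀ q) +
    (mink n₀ n₁ * mink n₀ n₂ - mink n₁ n₂ * mink n₀ n₀) *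
      (mink n₁ p * mink n₂ q + mink n₂ p * mink n₁ q) := by
  obtain ⟨p0, p1, p2⟩ := p
  obtain ⟨q0, q1, q2⟩ := q
  obtain ⟨a0, a1, a2⟩ := n₀
  obtain ⟨b0, b1, b2⟩ := n₁
  obtain ⟨c0, c1, c2⟩ := n₂
  simp only [mink]
  ring

theorem gramDet_mul_cosh_dist (T : HypTriangle θ) (p q : UpperHalfPlane) :
    gramDet θ * Real.cosh (dist p q) = adjForm θ (fun i => T.x i p) fun i => T.x i q := by
  have h := gram_identity (vec p) (vec q) (T.side 0).normal (T.side 1).normal (T.side 2).normal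
  simp only [mink_normal_self, ← form_eq_mink, T.angle 0 1 2 (by decide) (by decide) (by decide),
    T.angle 1 2 0 (by decide) (by decide) (by decide),
    T.angle 0 2 1 (by decide) (by decide) (by decide)] at h
  rw [cosh_dist_eq, gramDet, adjForm]
  simp only [HypTriangle.x, HalfPlane.coord]
  linear_combination h

theorem adjForm_self (T : HypTriangle θ) (p : UpperHalfPlane) :
    adjForm θ (fun i => T.x i p) (fun i => T.x i p) = gramDet θ := by
  rw [← gramDet_mul_cosh_dist, dist_self, Real.cosh_zero, mul_one]

/-- The angle sum enters here: `θ k < π - (θ i + θ j)`, and the cosine is decreasing. -/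
theorem cos_add_pos (hθ : ∀ i, 0 ≤ θ i ∧ θ i ≤ Real.pi / 2)
    (hsum : θ 0 + θ 1 + θ 2 < Real.pi) {i j k : Fin 3} (hij : i ≠ j) (hjk : j ≠ k) (hik : i ≠ k) :
    Real.sin (θ i) * Real.sin (θ j) < Real.cos (θ k) + Real.cos (θ i) * Real.cos (θ j) := by
  have hs : θ i + θ j + θ k < Real.pi := by
    have : θ i + θ j + θ k = θ 0 + θ 1 + θ 2 := by
      obtain rfl | rfl | rfl : i = 0 ∨ i = 1 ∨ i = 2 := by omega
      all_goals obtain rfl | rfl | rfl : j = 0 ∨ j = 1 ∨ j = 2 := by omega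
      all_goals obtain rfl | rfl | rfl : k = 0 ∨ k = 1 ∨ k = 2 := by omega
      all_goals first | exact absurd rfl hij | exact absurd rfl hjk | exact absurd rfl hik | ring
    linarith
  have h1 : Real.cos (Real.pi - (θ i + θ j)) < Real.cos (θ k) :=
    Real.strictAntiOn_cos ⟨(hθ k).1, by linarith [(hθ k).2, Real.pi_pos]⟩
      ⟨by linarith [(hθ k).1], by linarith [(hθ i).1, (hθ j).1]⟩ (by linarith)
  rw [Real.cos_pi_sub, Real.cos_add] at h1
  linarith

theorem gramDet_pos (hθ : ∀ i, 0 ≤ θ i ∧ θ i ≤ Real.pi / 2)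
    (hsum : θ 0 + θ 1 + θ 2 < Real.pi) : 0 < gramDet θ := by
  have h := cos_add_pos hθ hsum (i := 0) (j := 1) (k := 2) (by decide) (by decide) (by decide)
  have h0 : 0 ≤ Real.sin (θ 0) :=
    Real.sin_nonneg_of_nonneg_of_le_pi (hθ 0).1 (by linarith [(hθ 0).2, Real.pi_pos])
  have h1 : 0 ≤ Real.sin (θ 1) :=
    Real.sin_nonneg_of_nonneg_of_le_pi (hθ 1).1 (by linarith [(hθ 1).2, Real.pi_pos])
  have e0 := Real.sin_sq_add_cos_sq (θ 0)
  have e1 := Real.sin_sq_add_cos_sq (θ 1)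
  -- A difference of two squares, which `cos_add_pos` compares.
  have e : gramDet θ = (Real.cos (θ 2) + Real.cos (θ 0) * Real.cos (θ 1)) ^ 2 -
      (Real.sin (θ 0) * Real.sin (θ 1)) ^ 2 := by
    rw [gramDet]
    linear_combination (1 - Real.cos (θ 1) ^ 2) * e0 + Real.sin (θ 0) ^ 2 * e1
  rw [e]
  have := mul_nonneg h0 h1
  nlinarith

variable {T : HypTriangle θ}

theorem eq_of_x_eq (hD : 0 < gramDet θ) {p q : UpperHalfPlane} (h : ∀ i, T.x i p = T.x i q) :
    p = q := by
  have h1 := gramDet_mul_cosh_dist T p q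
  rw [funext h, adjForm_self] at h1
  apply eq_of_mink_vec
  rw [← cosh_dist_eq]
  nlinarith

/-- With two coordinates zero, the equation `adjForm θ x x = gramDet θ` determines the square of the
third, and the triangle determines its sign. -/
theorem eq_of_x_eq_zero (hD : 0 < gramDet θ) {j k : Fin 3} (hjk : j ≠ k) {p q : UpperHalfPlane}
    (hp : p ∈ T.region) (hq : q ∈ T.region) (h1 : T.x j p = 0) (h2 : T.x k p = 0)
    (h3 : T.x j q = 0) (h4 : T.x k q = 0) : p = q := by
  obtain ⟨i, hij, hik, hall⟩ := exists_third hjk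
  have e : ∀ z w : UpperHalfPlane, T.x j z = 0 → T.x k z = 0 → T.x j w = 0 → T.x k w = 0 →
      adjForm θ (fun i => T.x i z) (fun i => T.x i w) =
        (1 - Real.cos (θ i) ^ 2) * (T.x i z * T.x i w) := by
    intro z w a1 a2 a3 a4
    rw [adjForm_eq θ hij hjk hik]
    simp [a1, a2, a3, a4]
  have ep := adjForm_self T p
  have eq' := adjForm_self T q
  rw [e p p h1 h2 h1 h2] at ep
  rw [e q q h3 h4 h3 h4] at eq'
  have hc : (1 - Real.cos (θ i) ^ 2) ≠ 0 := by rintro h; rw [h] at ep; linarith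
  have h5 : T.x i p * T.x i p = T.x i q * T.x i q := mul_left_cancel₀ hc (ep.trans eq'.symm)
  have h6 : T.x i p = T.x i q := by
    rwa [mul_self_inj (T.mem_region_iff.1 hp i) (T.mem_region_iff.1 hq i)] at h5
  refine eq_of_x_eq (T := T) hD fun l => ?_
  rcases hall l with rfl | rfl | rfl
  · exact h6
  · rw [h1, h3]
  · rw [h2, h4]

end

section

variable {θ : Fin 3 → ℝ}
open HypTriangle

/-! ### Charts -/

section Chart

variable {X Y : Type*} [MetricSpace X] [MetricSpace Y]

theorem IsometricAt.continuousAt {f : X → Y} {x : X} (h : IsometricAt f x) : ContinuousAt f x := by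
  obtain ⟨U, hU, h⟩ := h
  rw [ContinuousAt, tendsto_iff_dist_tendsto_zero]
  have h1 : Filter.Tendsto (fun y => dist y x) (𝓝 x) (𝓝 0) := by
    rw [← tendsto_iff_dist_tendsto_zero]; exact Filter.tendsto_id
  refine h1.congr' ?_
  filter_upwards [hU] with y hy
  exact (h y hy x (mem_of_mem_nhds hU)).symm

/-- `Φ` and `Ψ` are mutually inverse local isometries between the balls of radius `r` at `a` and
at `p`. -/
structure IsChart (a : X) (p : Y) (r : ℝ) (Φ : X → Y) (Ψ : Y → X) : Prop where
  maps : ∀ x ∈ Metric.ball a r, Φ x ∈ Metric.ball p r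
  maps' : ∀ q ∈ Metric.ball p r, Ψ q ∈ Metric.ball a r
  left_inv : ∀ x ∈ Metric.ball a r, Ψ (Φ x) = x
  right_inv : ∀ q ∈ Metric.ball p r, Φ (Ψ q) = q
  isometricAt : ∀ x ∈ Metric.ball a r, IsometricAt Φ x
  isometricAt' : ∀ q ∈ Metric.ball p r, IsometricAt Ψ q
  center : 0 < r → Φ a = p

variable {a : X} {p : Y} {r : ℝ} {Φ : X → Y} {Ψ : Y → X}

theorem IsChart.center' (h : IsChart a p r Φ Ψ) (hr : 0 < r) : Ψ p = a := by
  rw [← h.center hr, h.left_inv a (Metric.mem_ball_self hr)]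

theorem IsChart.symm (h : IsChart a p r Φ Ψ) : IsChart p a r Ψ Φ :=
  ⟨h.maps', h.maps, h.right_inv, h.left_inv, h.isometricAt', h.isometricAt, h.center'⟩

/-- Local isometries preserve lengths of curves but need not preserve distances; this is the
inequality that survives. -/
theorem dist_le_of_isometricAt {f : ℝ → X} {L : ℝ}
    (hf : ∀ s ∈ Set.Icc (0 : ℝ) 1, ∀ t ∈ Set.Icc (0 : ℝ) 1, dist (f s) (f t) ≤ L * |s - t|)
    (hmem : ∀ t ∈ Set.Icc (0 : ℝ) 1, IsometricAt Φ (f t)) : dist (Φ (f 0)) (Φ (f 1)) ≤ L := by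
  have hL : 0 ≤ L := by
    have := hf 0 (by simp) 1 (by simp)
    have h2 := dist_nonneg (x := f 0) (y := f 1)
    norm_num at this
    linarith
  have hfc : ContinuousOn f (Set.Icc 0 1) := by
    have : LipschitzOnWith (Real.toNNReal L) f (Set.Icc 0 1) :=
      LipschitzOnWith.of_dist_le_mul fun s hs t ht => by
        rw [Real.coe_toNNReal _ hL, Real.dist_eq]; exact hf s hs t ht
    exact this.continuousOn
  have := dist_le_of_locally (f := Φ ∘ f) (c := L) zero_lt_one
    (fun t ht => (hmem t ht).continuousAt.comp_continuousWithinAt (hfc t ht)) fun t ht => by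
      obtain ⟨U, hU, h⟩ := hmem t ⟨ht.1.le, ht.2.le⟩
      have h1 : ∀ᶠ s in 𝓝 t, f s ∈ U :=
        (hfc.continuousAt (Icc_mem_nhds ht.1 ht.2)).eventually hU
      obtain ⟨ε, hε, h2⟩ := Metric.eventually_nhds_iff.1 (h1.and (Ioo_mem_nhds ht.1 ht.2))
      refine ⟨ε, hε, fun s hs => ?_⟩
      have hs1 := hs.1
      have hs2 := hs.2
      obtain ⟨h3, h4⟩ := h2 (y := s) (by rw [Real.dist_eq, abs_of_pos] <;> linarith)
      simp only [Function.comp]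
      rw [h _ h1.self_of_nhds _ h3]
      refine (hf t ⟨ht.1.le, ht.2.le⟩ s ⟨h4.1.le, h4.2.le⟩).trans_eq ?_
      rw [abs_sub_comm, abs_of_pos (by linarith)]
  simpa using this

/-- Replaces a homeomorphism of subtypes by a pair of total functions, whose values off the balls
are irrelevant. -/
theorem exists_isChart_iff :
    (∃ φ : Metric.ball a r ≃ₜ Metric.ball p r,
      (∀ x : Metric.ball a r, (x : X) = a → (φ x : Y) = p) ∧
      ∀ x, ∃ U ∈ 𝓝 x, ∀ y ∈ U, ∀ z ∈ U, dist (φ y) (φ z) = dist y z) ↔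
    ∃ Φ Ψ, IsChart a p r Φ Ψ := by
  classical
  constructor
  · rintro ⟨φ, hφ, hloc⟩
    have e1 : ∀ x (h : x ∈ Metric.ball a r),
        (if h : x ∈ Metric.ball a r then (φ ⟨x, h⟩ : Y) else p) = φ ⟨x, h⟩ :=
      fun x h => dif_pos h
    have e2 : ∀ q (h : q ∈ Metric.ball p r),
        (if h : q ∈ Metric.ball p r then (φ.symm ⟨q, h⟩ : X) else a) = φ.symm ⟨q, h⟩ :=
      fun q h => dif_pos h
    refine ⟨fun x => if h : x ∈ Metric.ball a r then φ ⟨x, h⟩ else p,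
      fun q => if h : q ∈ Metric.ball p r then φ.symm ⟨q, h⟩ else a, ?_, ?_, ?_, ?_, ?_, ?_, ?_⟩
    · intro x hx; rw [e1 x hx]; exact (φ ⟨x, hx⟩).2
    · intro q hq; rw [e2 q hq]; exact (φ.symm ⟨q, hq⟩).2
    · intro x hx; simp only [e1 x hx]; rw [e2 _ (φ ⟨x, hx⟩).2]; simp
    · intro q hq; simp only [e2 q hq]; rw [e1 _ (φ.symm ⟨q, hq⟩).2]; simp
    · intro x hx
      obtain ⟨U, hU, h⟩ := hloc ⟨x, hx⟩
      obtain ⟨u, hu, huU⟩ := mem_nhds_subtype _ _ _ |>.1 hU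
      refine ⟨u ∩ Metric.ball a r, Filter.inter_mem hu (Metric.isOpen_ball.mem_nhds hx),
        fun y hy z hz => ?_⟩
      simp only [e1 y hy.2, e1 z hz.2]
      exact h ⟨y, hy.2⟩ (huU hy.1) ⟨z, hz.2⟩ (huU hz.1)
    · intro q hq
      obtain ⟨U, hU, h⟩ := hloc (φ.symm ⟨q, hq⟩)
      have hV := φ.symm.continuous.continuousAt.preimage_mem_nhds hU
      obtain ⟨u, hu, huU⟩ := mem_nhds_subtype _ _ _ |>.1 hV
      refine ⟨u ∩ Metric.ball p r, Filter.inter_mem hu (Metric.isOpen_ball.mem_nhds hq),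
        fun y hy z hz => ?_⟩
      simp only [e2 y hy.2, e2 z hz.2]
      have := h (φ.symm ⟨y, hy.2⟩) (huU hy.1) (φ.symm ⟨z, hz.2⟩) (huU hz.1)
      simp only [Homeomorph.apply_symm_apply] at this
      exact this.symm
    · intro hr
      simp only [e1 a (Metric.mem_ball_self hr)]
      exact hφ _ rfl
  · rintro ⟨Φ, Ψ, h⟩
    refine ⟨{ toFun := fun x => ⟨Φ x, h.maps x x.2⟩
              invFun := fun q => ⟨Ψ q, h.maps' q q.2⟩
              left_inv := fun x => Subtype.ext (h.left_inv x x.2)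
              right_inv := fun q => Subtype.ext (h.right_inv q q.2)
              continuous_toFun := ?_
              continuous_invFun := ?_ }, ?_, ?_⟩
    · refine Continuous.subtype_mk (continuous_iff_continuousAt.2 fun x => ?_) _
      exact (h.isometricAt x x.2).continuousAt.comp continuousAt_subtype_val
    · refine Continuous.subtype_mk (continuous_iff_continuousAt.2 fun x => ?_) _
      exact (h.isometricAt' x x.2).continuousAt.comp continuousAt_subtype_val
    · intro x hx
      have hr : 0 < r := dist_nonneg.trans_lt x.2
      exact (congrArg Φ hx).trans (h.center hr)
    · intro x
      obtain ⟨U, hU, hU'⟩ := h.isometricAt x x.2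
      exact ⟨_, continuousAt_subtype_val.preimage_mem_nhds hU, fun y hy z hz => hU' y hy z hz⟩

theorem IsChart.comp {Z : Type*} [MetricSpace Z] {c : Z} (f : Z ≃ᵢ X) (hf : f c = a)
    (h : IsChart a p r Φ Ψ) : IsChart c p r (Φ ∘ f) (f.symm ∘ Ψ) := by
  have hb : ∀ x, x ∈ Metric.ball c r ↔ f x ∈ Metric.ball a r := fun x => by
    rw [Metric.mem_ball, Metric.mem_ball, ← hf, f.dist_eq]
  refine ⟨fun x hx => h.maps _ ((hb x).1 hx), fun q hq => ?_, fun x hx => ?_, fun q hq => ?_,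
    fun x hx => ?_, fun q hq => ?_, fun hr => ?_⟩
  · rw [hb]; simpa using h.maps' q hq
  · simp [h.left_inv _ ((hb x).1 hx)]
  · simp [h.right_inv q hq]
  · obtain ⟨U, hU, hU'⟩ := h.isometricAt _ ((hb x).1 hx)
    refine ⟨_, f.continuous.continuousAt.preimage_mem_nhds hU, fun y hy z hz => ?_⟩
    rw [← f.dist_eq y z]
    exact hU' _ hy _ hz
  · obtain ⟨U, hU, hU'⟩ := h.isometricAt' q hq
    refine ⟨U, hU, fun y hy z hz => ?_⟩
    rw [← hU' y hy z hz]
    exact f.symm.dist_eq _ _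
  · simp [hf, h.center hr]

/-- The distance to the centre is preserved along geodesics. -/
theorem IsChart.dist_le (h : IsChart a p r Φ Ψ) (hr : 0 < r) {f : ℝ → X} {x : X} {L : ℝ}
    (hL : L < r) (h0 : f 0 = a) (h1 : f 1 = x)
    (hf : ∀ s ∈ Set.Icc (0 : ℝ) 1, ∀ t ∈ Set.Icc (0 : ℝ) 1, dist (f s) (f t) ≤ L * |s - t|) :
    dist p (Φ x) ≤ L := by
  have := dist_le_of_isometricAt (Φ := Φ) hf fun t ht => h.isometricAt _ <| by
    have := hf t ht 0 (by simp)
    rw [h0, sub_zero, abs_of_nonneg ht.1] at this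
    rw [Metric.mem_ball]
    have hL0 : 0 ≤ L := by
      have := hf 0 (by simp) 1 (by simp)
      have h2 := dist_nonneg (x := f 0) (y := f 1)
      norm_num at this
      linarith
    nlinarith [ht.2]
  rwa [h0, h1, h.center hr] at this

end Chart

theorem injRadius_eq_of_isChart {T : HypTriangle θ} {p : Surface T} {r : ℝ} (hr : 0 ≤ r)
    (h : ∃ Φ Ψ, IsChart UpperHalfPlane.I p r Φ Ψ)
    (h' : ∀ s, r < s → ∀ Φ Ψ, ¬ IsChart UpperHalfPlane.I p s Φ Ψ) : injRadius T p = r := by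
  refine IsGreatest.csSup_eq ⟨⟨hr, exists_isChart_iff.2 h⟩, ?_⟩
  rintro s ⟨-, hs⟩
  obtain ⟨Φ, Ψ, hs⟩ := exists_isChart_iff.1 hs
  by_contra! hrs
  exact h' s hrs Φ Ψ hs

end

section

variable {θ : Fin 3 → ℝ} {T : HypTriangle θ}

open HypTriangle

/-! ### The disk of radius `r` at a point folds onto the ball of the surface -/

theorem exists_vec_of_between {P z Q : UpperHalfPlane} (h : dist P z + dist z Q = dist P Q) :
    ∃ α β : ℝ, 0 ≤ α ∧ 0 ≤ β ∧ vec z = α • vec P + β • vec Q := by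
  rcases eq_or_ne P Q with rfl | hPQ
  · rw [dist_self] at h
    have : dist P z = 0 := by linarith [dist_nonneg (x := P) (y := z), dist_nonneg (x := z) (y := P)]
    rw [dist_eq_zero.1 this]
    exact ⟨1, 0, zero_le_one, le_rfl, by simp⟩
  · have hs : 0 < Real.sinh (dist P z + dist z Q) := by
      rw [h]; exact Real.sinh_pos_iff.2 (dist_pos.2 hPQ)
    have e := sinh_smul_vec_of_between (z := z) rfl rfl h.symm
    refine ⟨Real.sinh (dist z Q) / Real.sinh (dist P z + dist z Q),
      Real.sinh (dist P z) / Real.sinh (dist P z + dist z Q),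
      div_nonneg (Real.sinh_nonneg_iff.2 dist_nonneg) hs.le,
      div_nonneg (Real.sinh_nonneg_iff.2 dist_nonneg) hs.le, ?_⟩
    rw [div_eq_inv_mul, div_eq_inv_mul, mul_smul, mul_smul, ← smul_add, ← e, smul_smul,
      inv_mul_cancel₀ hs.ne', one_smul]

theorem mem_region_of_between {P z Q : UpperHalfPlane} (h : dist P z + dist z Q = dist P Q)
    (hP : P ∈ T.region) (hQ : Q ∈ T.region) : z ∈ T.region := by
  obtain ⟨α, β, hα, hβ, e⟩ := exists_vec_of_between h
  rw [mem_region_iff] at *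
  intro i
  rw [T.x_of_vec e]
  have := hP i
  have := hQ i
  positivity

theorem mem_wedge_of_between (hc : ∀ i, 0 ≤ Real.cos (θ i)) {j : Fin 3} {P z Q : UpperHalfPlane}
    (h : dist P z + dist z Q = dist P Q) (hP : P ∈ T.wedge j) (hQ : Q ∈ T.wedge j) :
    z ∈ T.wedge j := by
  obtain ⟨α, β, hα, hβ, e⟩ := exists_vec_of_between h
  rw [mem_wedge_iff hc] at *
  intro k hk
  rw [T.x_of_vec e, x_R_of_vec e]
  obtain ⟨h1, h2⟩ := hP k hk
  obtain ⟨h3, h4⟩ := hQ k hk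
  constructor <;> positivity

/-- The mirror images of `P` in the sides of the triangle have distance at least `2 r`. -/
def Separated (T : HypTriangle θ) (P : UpperHalfPlane) (r : ℝ) : Prop :=
  ∀ j k, j ≠ k → 2 * r ≤ dist (T.R j P) (T.R k P)

section Lower

variable {P : UpperHalfPlane} {r : ℝ}

/-- Triangle inequality. Only one inequality is strict, so that points of the open disk can be
compared with points on its boundary circle. -/
theorem Separated.eq (hr : Separated T P r) {y : UpperHalfPlane} {j k : Fin 3}
    (hj : dist (T.R j P) y < r) (hk : dist (T.R k P) y ≤ r) : j = k := by
  by_contra hne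
  have := hr j k hne
  have := dist_triangle_right (T.R j P) (T.R k P) y
  linarith

/-- A point on the side `i` is as far from `R i P` as from `P`, so a point on two sides would be too
close to two mirror images. -/
theorem Separated.exists_pos (hr : Separated T P r) {z : UpperHalfPlane} (hz : z ∈ T.region)
    (hPz : dist P z < r) : ∃ j, ∀ i, i ≠ j → 0 < T.x i z := by
  by_contra! H
  have key : ∀ i, T.x i z ≤ 0 → dist (T.R i P) z < r := fun i hi => by
    rw [T.dist_R_comm, T.R_eq_self (le_antisymm hi (T.mem_region_iff.1 hz i))]
    exact hPz
  obtain ⟨i, -, hi⟩ := H 0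
  obtain ⟨k, hk, hk'⟩ := H i
  exact hk (hr.eq (key k hk') (key i hi).le)

/-- The open disk does not reach the far sides of a mirror image: if `R j z` were on another side
`i`, it would be closer than `r` to both `R i P` and `R j P`. -/
theorem Separated.R_pos (hr : Separated T P r) (hP : P ∈ T.region) {z : UpperHalfPlane}
    {j : Fin 3} (hz : z ∉ T.region) (hjz : T.R j z ∈ T.region) (hPz : dist P z < r) (i : Fin 3) :
    0 < T.x i (T.R j z) := by
  have h1 := T.mem_region_iff.1 hjz
  refine lt_of_le_of_ne (h1 i) fun e => ?_
  rcases eq_or_ne i j with rfl | hij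
  · have := T.R_eq_self e.symm
    rw [R_R] at this
    rw [← this] at hjz
    exact hz hjz
  · have h2 : dist (T.R j P) (T.R j z) < r := by rwa [dist_R_R]
    have h3 : dist P (T.R j z) ≤ dist (T.R j P) (T.R j z) :=
      T.dist_le_dist_R (mul_nonneg (T.mem_region_iff.1 hP j) (h1 j))
    refine hij (hr.eq (?_ : dist (T.R i P) (T.R j z) < r) h2.le)
    rw [T.dist_R_comm, T.R_eq_self e.symm]
    exact h3.trans_lt h2

theorem Separated.isometricAt (hc : ∀ i, 0 ≤ Real.cos (θ i)) (hr : Separated T P r)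
    (hP : P ∈ T.region) {z : UpperHalfPlane} {j : Fin 3} (hz : z ∈ T.wedge j) (hPz : dist P z < r)
    (b : Bool) : IsometricAt (fold T b) z ∧ ∀ᶠ y in 𝓝 z, ∃ j, y ∈ T.wedge j := by
  by_cases hz' : z ∈ T.region
  · obtain ⟨k, hk⟩ := hr.exists_pos hz' hPz
    obtain ⟨h1, h2⟩ := isometricAt_fold_of_mem hc (b := b) hz' hk
    exact ⟨h1, h2.mono fun y hy => ⟨k, hy⟩⟩
  · have h := hr.R_pos hP hz' (hz.resolve_left hz') hPz
    exact ⟨isometricAt_fold_of_R_pos hc h, ((T.isometry_R j).continuous.continuousAt.eventually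
      (T.eventually_mem_region h)).mono fun y hy => ⟨j, Or.inr hy⟩⟩

theorem isClosed_wedge (T : HypTriangle θ) (j : Fin 3) : IsClosed (T.wedge j) :=
  T.isClosed_region.union (T.isClosed_region.preimage (T.isometry_R j).continuous)

/-- Connectedness of the segment from `P` to `z`: the union of the wedges is closed, and a
neighbourhood of each of its points that lies in the open disk. -/
theorem Separated.exists_mem_wedge (hc : ∀ i, 0 ≤ Real.cos (θ i)) (hr : Separated T P r)
    (hP : P ∈ T.region) {z : UpperHalfPlane} (hPz : dist P z < r) : ∃ j, z ∈ T.wedge j := by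
  set E : Set UpperHalfPlane := ⋃ j, T.wedge j with hE
  have hEcl : IsClosed E := isClosed_iUnion_of_finite fun j => isClosed_wedge T j
  set s := geo P z '' Set.Icc 0 1 with hs
  have hball : ∀ y ∈ s, dist P y < r := by
    rintro y ⟨t, ht, rfl⟩
    rw [dist_left_geo P z ht]
    nlinarith [ht.1, ht.2, dist_nonneg (x := P) (y := z)]
  have hnhds : ∀ y ∈ s, y ∈ E → y ∈ interior E := by
    intro y hy hyE
    obtain ⟨j, hj⟩ := Set.mem_iUnion.1 hyE
    rw [mem_interior_iff_mem_nhds]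
    filter_upwards [(hr.isometricAt hc hP hj (hball y hy) true).2] with w hw
    exact Set.mem_iUnion.2 hw
  have hPs : P ∈ s := ⟨0, by simp, geo_zero P z⟩
  have hsub : s ⊆ interior E := by
    refine (isPreconnected_Icc.image _ (continuousOn_geo P z)).subset_of_closure_inter_subset
      isOpen_interior ⟨P, hPs, hnhds P hPs (Set.mem_iUnion.2 ⟨0, Or.inl hP⟩)⟩ ?_
    rintro y ⟨hy1, hy2⟩
    exact hnhds y hy2 (closure_minimal interior_subset hEcl hy1)
  have := interior_subset (hsub ⟨1, by simp, geo_one P z⟩)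
  exact Set.mem_iUnion.1 this

theorem dist_copy_fold_le (hc : ∀ i, 0 ≤ Real.cos (θ i)) (hP : P ∈ T.region) {z : UpperHalfPlane}
    {j : Fin 3} (hz : z ∈ T.wedge j) (b : Bool) : dist (copy T b P) (fold T b z) ≤ dist P z := by
  rw [← fold_of_mem hP]
  exact dist_fold_le hc (Or.inl hP) hz

/-- Every point of the surface lifts to a point at the same distance from the centre. These lifts
make up the inverse of the chart. -/
theorem exists_fold_eq (hc : ∀ i, 0 ≤ Real.cos (θ i)) (hP : P ∈ T.region) (b : Bool)
    (q : Surface T) : ∃ j, ∃ z ∈ T.wedge j, fold T b z = q ∧ dist P z = dist (copy T b P) q := by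
  obtain ⟨b', y, hy, rfl⟩ := exists_eq_copy q
  rcases eq_or_ne b' b with rfl | hb
  · exact ⟨0, y, Or.inl hy, fold_of_mem hy, (dist_copy_self hP hy).symm⟩
  · obtain rfl : b' = !b := by cases b <;> cases b' <;> simp at hb ⊢
    obtain ⟨j, hj⟩ := exists_dist_R_le b hP hy
    have hRy : T.R j (T.R j y) ∈ T.region := by rwa [R_R]
    refine ⟨j, T.R j y, Or.inr hRy, by rw [fold_of_R_mem hc hRy, R_R], ?_⟩
    rw [← T.dist_R_comm]
    exact le_antisymm hj (dist_copy_not_le b hP hy j)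

/-- Points with the same image under folding either agree or are mirror images. -/
theorem fold_eq_fold (hc : ∀ i, 0 ≤ Real.cos (θ i)) {z w : UpperHalfPlane} {j k : Fin 3}
    (hz : z ∈ T.wedge j) (hw : w ∈ T.wedge k) {b : Bool} (h : fold T b z = fold T b w) :
    z = w ∨ ∃ j k, j ≠ k ∧ T.R j z = T.R k w ∧ T.R j z ∈ T.region := by
  have key : ∀ {z w : UpperHalfPlane} {k : Fin 3}, z ∈ T.region → T.R k w ∈ T.region →
      fold T b z = fold T b w → z = w ∨
        ∃ j k, j ≠ k ∧ T.R j z = T.R k w ∧ T.R j z ∈ T.region := by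
    intro z w k hz hw h
    rw [fold_of_mem hz, fold_of_R_mem hc hw] at h
    obtain ⟨h1, l, hl⟩ := copy_eq_copy_not hz hw h
    have h2 := T.R_eq_self hl
    rcases eq_or_ne l k with rfl | hlk
    · left; rw [h1, R_R] at h2; rw [h1, ← h2]
    · right; exact ⟨l, k, hlk, by rw [h2, h1], by rwa [h2]⟩
  rcases hz with hz | hz <;> rcases hw with hw | hw
  · rw [fold_of_mem hz, fold_of_mem hw] at h
    exact Or.inl (copy_injective hz hw h)
  · exact key hz hw h
  · rcases key hw hz h.symm with h1 | ⟨j, k, h1, h2, h3⟩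
    · exact Or.inl h1.symm
    · exact Or.inr ⟨k, j, h1.symm, h2.symm, h2 ▸ h3⟩
  · rw [fold_of_R_mem hc hz, fold_of_R_mem hc hw] at h
    have := copy_injective hz hw h
    rcases eq_or_ne j k with rfl | hjk
    · left; rw [← T.R_R j z, this, R_R]
    · exact Or.inr ⟨j, k, hjk, this, hz⟩

/-- Different points with the same image have a common mirror image `R j z = R k w`, which would be
too close to both `R j P` and `R k P`. -/
theorem Separated.fold_injOn (hc : ∀ i, 0 ≤ Real.cos (θ i)) (hr : Separated T P r)
    (hP : P ∈ T.region) {z w : UpperHalfPlane} (hz : dist P z < r) (hw : dist P w ≤ r)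
    {k : Fin 3} (hwk : w ∈ T.wedge k) {b : Bool} (h : fold T b z = fold T b w) : z = w := by
  obtain ⟨j, hj⟩ := hr.exists_mem_wedge hc hP hz
  rcases fold_eq_fold hc hj hwk h with h | ⟨j, k, hjk, h1, -⟩
  · exact h
  · refine absurd (hr.eq (y := T.R j z) ?_ ?_) hjk
    · rwa [dist_R_R]
    · rwa [h1, dist_R_R]

theorem Separated.exists_isChart (hc : ∀ i, 0 ≤ Real.cos (θ i)) (hr : Separated T P r)
    (hP : P ∈ T.region) (b : Bool) : ∃ Ψ, IsChart P (copy T b P) r (fold T b) Ψ ∧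
      ∀ q, dist P (Ψ q) = dist (copy T b P) q := by
  choose J Ψ hJ hΨ hd using exists_fold_eq hc hP b
  have hmem : ∀ q, q ∈ Metric.ball (copy T b P) r → dist P (Ψ q) < r := fun q hq => by
    rw [hd, dist_comm]; exact hq
  have hcont : ∀ q ∈ Metric.ball (copy T b P) r, ContinuousAt Ψ q := by
    intro q hq
    obtain ⟨s, hs1, hs2⟩ := exists_between (hmem q hq)
    have hK := isCompact_closedBall P s
    -- The chosen lifts are continuous because they stay in a compact disk and every cluster point
    -- folds to `q`, so it equals `Ψ q` by injectivity.
    refine hK.tendsto_nhds_of_unique_mapClusterPt ?_ ?_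
    · have : ∀ᶠ q' in 𝓝 q, dist (copy T b P) q' < s :=
        (continuous_const.dist continuous_id).continuousAt.eventually
          (gt_mem_nhds (by simpa [← hd] using hs1))
      filter_upwards [this] with q' hq'
      rw [Metric.mem_closedBall, dist_comm, hd]
      exact hq'.le
    · intro y hy hcl
      have hyr : dist P y < r := by
        rw [Metric.mem_closedBall, dist_comm] at hy; exact hy.trans_lt hs2
      obtain ⟨j, hj⟩ := hr.exists_mem_wedge hc hP hyr
      have h1 : ContinuousAt (fold T b) y := (hr.isometricAt hc hP hj hyr b).1.continuousAt
      have h2 : MapClusterPt (fold T b y) (𝓝 q) (fold T b ∘ Ψ) := hcl.continuousAt_comp h1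
      have h3 : fold T b ∘ Ψ = id := funext hΨ
      rw [h3] at h2
      have h4 : fold T b y = q := by
        have : ClusterPt (fold T b y) (𝓝 q) := by simpa [MapClusterPt] using h2
        have : (𝓝 (fold T b y) ⊓ 𝓝 q).NeBot := this
        exact eq_of_nhds_neBot this
      exact hr.fold_injOn hc hP hyr (hmem q hq).le (hJ q) (h4.trans (hΨ q).symm)
  refine ⟨Ψ, ⟨fun x hx => ?_, fun q hq => ?_, fun x hx => ?_, fun q _ => hΨ q, fun x hx => ?_,
    fun q hq => ?_, fun _ => fold_of_mem hP⟩, hd⟩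
  · rw [Metric.mem_ball, dist_comm] at *
    obtain ⟨j, hj⟩ := hr.exists_mem_wedge hc hP hx
    exact (dist_copy_fold_le hc hP hj b).trans_lt hx
  · rw [Metric.mem_ball, dist_comm]
    exact hmem q hq
  · rw [Metric.mem_ball, dist_comm] at hx
    obtain ⟨j, hj⟩ := hr.exists_mem_wedge hc hP hx
    refine (hr.fold_injOn hc hP hx ?_ (hJ _) (hΨ _).symm).symm
    rw [hd]
    exact (dist_copy_fold_le hc hP hj b).trans hx.le
  · rw [Metric.mem_ball, dist_comm] at hx
    obtain ⟨j, hj⟩ := hr.exists_mem_wedge hc hP hx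
    exact (hr.isometricAt hc hP hj hx b).1
  · obtain ⟨U, hU, h⟩ := (hr.isometricAt hc hP (hJ q) (hmem q hq) b).1
    refine ⟨_, (hcont q hq).preimage_mem_nhds hU, fun y hy z hz => ?_⟩
    rw [← h _ hy _ hz, hΨ, hΨ]

end Lower

/-! ### Larger balls are not disks -/

theorem exists_opposite (m : UpperHalfPlane) {h : ℝ} (hh : 0 ≤ h) :
    ∃ y z : UpperHalfPlane, dist y m = h ∧ dist m z = h ∧ dist y z = 2 * h := by
  obtain ⟨f, rfl⟩ := isometry_exists m
  have hi := UpperHalfPlane.isometry_vertical_line 0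
  have hI : UpperHalfPlane.I = UpperHalfPlane.mk ⟨0, Real.exp 0⟩ (Real.exp_pos 0) := by
    apply UpperHalfPlane.ext; simp [UpperHalfPlane.I, Complex.ext_iff]
  refine ⟨f (UpperHalfPlane.mk ⟨0, Real.exp h⟩ (Real.exp_pos h)),
    f (UpperHalfPlane.mk ⟨0, Real.exp (-h)⟩ (Real.exp_pos (-h))), ?_, ?_, ?_⟩
  · rw [f.dist_eq, hI, hi.dist_eq, Real.dist_eq, sub_zero, abs_of_nonneg hh]
  · rw [f.dist_eq, hI, hi.dist_eq, Real.dist_eq, zero_sub, neg_neg, abs_of_nonneg hh]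
  · rw [f.dist_eq, hi.dist_eq, Real.dist_eq, sub_neg_eq_add, abs_of_nonneg (by linarith)]; ring

theorem x_add_of_midpoint {a m b : UpperHalfPlane} {h : ℝ} (h1 : dist a m = h) (h2 : dist m b = h)
    (h3 : dist a b = 2 * h) (i : Fin 3) : T.x i a + T.x i b = 2 * Real.cosh h * T.x i m := by
  have := congrArg (mink (T.side i).normal) (vec_add_of_midpoint h1 h2 h3)
  rwa [mink_add_right, mink_smul_right] at this

theorem copy_eq_of_boundary {A : UpperHalfPlane} (hA : A ∈ T.region) {i : Fin 3}
    (hi : T.x i A = 0) (b b' : Bool) : copy T b A = copy T b' A := by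
  have := copy_not_eq (b := b) hA hi
  cases b <;> cases b' <;> simp_all

/-- No neighbourhood of a cone point is isometric to an open set of the hyperbolic plane. -/
theorem not_isometricAt_of_vertex (hc : ∀ i, 0 ≤ Real.cos (θ i)) (hD : 0 < gramDet θ)
    {A : UpperHalfPlane} (hA : A ∈ T.region) {j k : Fin 3} (hjk : j ≠ k) (hj : T.x j A = 0)
    (hk : T.x k A = 0) (b : Bool) {Φ : UpperHalfPlane → Surface T} {m : UpperHalfPlane}
    (hm : Φ m = copy T b A) : ¬ IsometricAt Φ m := by
  rintro ⟨U, hU, hiso⟩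
  obtain ⟨ε, hε, hball⟩ := Metric.mem_nhds_iff.1 hU
  obtain ⟨h, h0, hhε⟩ := exists_between hε
  obtain ⟨y, z, h1, h2, h3⟩ := exists_opposite m h0.le
  have hy : y ∈ U := hball (by rw [Metric.mem_ball, h1]; exact hhε)
  have hz : z ∈ U := hball (by rw [Metric.mem_ball, dist_comm, h2]; exact hhε)
  have hmU := mem_of_mem_nhds hU
  have e1 := hiso y hy m hmU
  have e2 := hiso m hmU z hz
  have e3 := hiso y hy z hz
  rw [h1, hm] at e1
  rw [h2, hm] at e2
  rw [h3] at e3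
  obtain ⟨b₁, Y, hY, eY⟩ := exists_eq_copy (Φ y)
  obtain ⟨b₂, Z, hZ, eZ⟩ := exists_eq_copy (Φ z)
  rw [eY, copy_eq_of_boundary hA hj b b₁, dist_copy_self hY hA] at e1
  rw [eZ, copy_eq_of_boundary hA hj b b₂, dist_copy_self hA hZ] at e2
  rw [eY, eZ] at e3
  have hYA : T.x j Y = 0 → T.x k Y = 0 → False := fun h4 h5 => by
    rw [eq_of_x_eq_zero hD hjk hY hA h4 h5 hj hk, dist_self] at e1
    exact h0.ne e1
  have y0 := T.mem_region_iff.1 hY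
  have z0 := T.mem_region_iff.1 hZ
  rcases eq_or_ne b₁ b₂ with rfl | hb
  -- Both images in one copy: `A` is their midpoint, so their nonnegative coordinates `x j` and `x
  -- k` add up to zero.
  · rw [dist_copy_self hY hZ] at e3
    have f := x_add_of_midpoint (T := T) e1 e2 e3
    have fj := f j
    have fk := f k
    rw [hj, mul_zero] at fj
    rw [hk, mul_zero] at fk
    exact hYA (by linarith [y0 j, z0 j]) (by linarith [y0 k, z0 k])
  · obtain rfl : b₂ = !b₁ := by cases b₁ <;> cases b₂ <;> simp at hb ⊢
    -- Images in different copies: the distance `2 h` is attained across both sides at the vertex,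
    -- so `A` is the midpoint of `R l Y` and `Z` for `l = j` and for `l = k`.
    have key : ∀ l, T.x l A = 0 → ∀ i, T.x i A = 0 → T.x i (T.R l Y) + T.x i Z = 0 := by
      intro l hl i hi
      have e4 : dist (T.R l Y) A = h := by rw [T.dist_R_comm, T.R_eq_self hl, e1]
      have e5 : dist (T.R l Y) Z = 2 * h := by
        refine le_antisymm ?_ (e3 ▸ dist_copy_not_le b₁ hY hZ l)
        linarith [dist_triangle (T.R l Y) A Z]
      have := x_add_of_midpoint (T := T) e4 e2 e5 i
      rwa [hi, mul_zero] at this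
    have f1 := key j hj k hk
    have f2 := key k hk j hj
    have g1 := x_R_nonneg hc hjk.symm (y0 k) (y0 j)
    have g2 := x_R_nonneg hc hjk (y0 j) (y0 k)
    have f3 := key k hk k hk
    have f4 := key j hj j hj
    rw [x_R_self] at f3 f4
    exact hYA (by linarith [z0 k, z0 j]) (by linarith [z0 k, z0 j])

section Upper

variable {P : UpperHalfPlane} {r : ℝ} {j k : Fin 3}

/-- The midpoint of two nearest mirror images lies in the triangle. -/
theorem Separated.midpoint (hc : ∀ i, 0 ≤ Real.cos (θ i)) (hr : Separated T P r)
    (hP : P ∈ T.region) (hjk : j ≠ k) (hd : dist (T.R j P) (T.R k P) = 2 * r) (hr0 : 0 < r)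
    {M : UpperHalfPlane} (h1 : dist (T.R j P) M = r) (h2 : dist M (T.R k P) = r) :
    M ∈ T.region ∧ ∀ i, i ≠ j → i ≠ k → 0 < T.x i M ∧
      Real.cosh r * T.x j M = T.x k P * Real.cos (θ i) ∧
      Real.cosh r * T.x k M = T.x j P * Real.cos (θ i) := by
  obtain ⟨i, hij, hik, hall⟩ := exists_third hjk
  have hp := T.mem_region_iff.1 hP
  have f := x_add_of_midpoint (T := T) h1 h2 hd
  have fj := f j
  have fk := f k
  rw [x_R_self, T.x_R hjk.symm hij.symm hik.symm] at fj
  rw [x_R_self, T.x_R hjk hik.symm hij.symm] at fk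
  have hch := Real.cosh_pos r
  have ej : Real.cosh r * T.x j M = T.x k P * Real.cos (θ i) := by linarith
  have ek : Real.cosh r * T.x k M = T.x j P * Real.cos (θ i) := by linarith
  have hMj : 0 ≤ T.x j M := by
    have := mul_nonneg (hp k) (hc i)
    rw [← ej] at this
    exact nonneg_of_mul_nonneg_right this hch
  have hMk : 0 ≤ T.x k M := by
    have := mul_nonneg (hp j) (hc i)
    rw [← ek] at this
    exact nonneg_of_mul_nonneg_right this hch
  -- Otherwise `R i P` is no farther from `M` than `P` is, hence within `r`. Then `M` is also the
  -- midpoint of `R i P` and `R j P`, which forces `R i P = R k P`.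
  have hMi : 0 < T.x i M := by
    by_contra! hneg
    have h3 : dist P M ≤ r := by
      rw [← h1]; exact T.dist_le_dist_R (mul_nonneg (hp j) hMj)
    have h4 : dist (T.R i P) M ≤ r := by
      refine le_trans ?_ h3
      have := T.dist_le_dist_R (i := i) (z := T.R i P) (w := M)
        (by rw [x_R_self]; nlinarith [hp i])
      rwa [R_R] at this
    have h5 := hr i j hij
    have h6 := dist_triangle_right (T.R i P) (T.R j P) M
    have h7 : dist (T.R i P) M = r := by linarith
    have h8 : dist (T.R i P) (T.R j P) = 2 * r := by linarith
    rw [dist_comm] at h1 h2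
    have v1 := vec_add_of_midpoint h7 h1 h8
    rw [dist_comm] at h1 h2
    have v2 := vec_add_of_midpoint h1 h2 hd
    rw [← v2, add_comm] at v1
    have := vec_injective (add_left_cancel v1)
    have h9 := hr i k hik
    rw [this, dist_self] at h9
    linarith
  refine ⟨T.mem_region_iff.2 fun l => ?_, fun l hl1 hl2 => ?_⟩
  · rcases hall l with rfl | rfl | rfl
    · exact hMi.le
    · exact hMj
    · exact hMk
  · rcases hall l with rfl | rfl | rfl
    · exact ⟨hMi, ej, ek⟩
    · exact absurd rfl hl1
    · exact absurd rfl hl2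

theorem Separated.le_dist_copy_not (hr : Separated T P r) (hP : P ∈ T.region) (hjk : j ≠ k)
    {M : UpperHalfPlane} (hM : M ∈ T.region) (h1 : dist (T.R j P) M ≤ r)
    (h2 : dist M (T.R k P) ≤ r) (b : Bool) : r ≤ dist (copy T b P) (copy T (!b) M) := by
  obtain ⟨l, hl⟩ := exists_dist_R_le b hP hM
  by_contra! hlt
  have h3 := hr.eq (hl.trans_lt hlt) h1
  rw [dist_comm] at h2
  have h4 := hr.eq (hl.trans_lt hlt) h2
  exact hjk (h3.symm.trans h4)

/-- In a larger chart the midpoint `M` of two mirror images would be at distance at least `r` from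
the centre, while two opposite points at distance `h` from it are at distance at most `r - h`.
Convexity of the hyperbolic cosine of the distance forbids this. -/
theorem Separated.not_isChart (hc : ∀ i, 0 ≤ Real.cos (θ i)) (hD : 0 < gramDet θ)
    (hr : Separated T P r) (hP : P ∈ T.region) (hjk : j ≠ k)
    (hd : dist (T.R j P) (T.R k P) = 2 * r) (b : Bool) {s : ℝ} (hs : r < s)
    (Φ : UpperHalfPlane → Surface T) (Ψ : Surface T → UpperHalfPlane) :
    ¬ IsChart UpperHalfPlane.I (copy T b P) s Φ Ψ := by
  intro hch
  have hr0 : 0 ≤ r := by linarith [dist_nonneg (x := T.R j P) (y := T.R k P)]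
  have hs0 : 0 < s := hr0.trans_lt hs
  -- For `r = 0` two mirror images coincide, so `P` is a vertex.
  rcases hr0.eq_or_lt with rfl | hr0
  · have e : T.R j P = T.R k P := dist_eq_zero.1 (by linarith)
    have ej : T.x j P + T.x j (T.R k P) = 0 := by rw [← e, x_R_self]; ring
    have ek : T.x k P + T.x k (T.R j P) = 0 := by rw [e, x_R_self]; ring
    have hp := T.mem_region_iff.1 hP
    have hj := x_R_nonneg hc hjk (hp j) (hp k)
    have hk := x_R_nonneg hc hjk.symm (hp k) (hp j)
    exact not_isometricAt_of_vertex hc hD hP hjk (by linarith [hp j]) (by linarith [hp k]) b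
      (hch.center hs0) (hch.isometricAt _ (Metric.mem_ball_self hs0))
  set M := geo (T.R j P) (T.R k P) (1 / 2) with hM
  have hhalf : (1 / 2 : ℝ) ∈ Set.Icc (0 : ℝ) 1 := by constructor <;> norm_num
  have h1 : dist (T.R j P) M = r := by rw [hM, dist_left_geo _ _ hhalf, hd]; ring
  have h2 : dist M (T.R k P) = r := by rw [hM, dist_geo_right _ _ hhalf, hd]; ring
  obtain ⟨hMT, hMi⟩ := hr.midpoint hc hP hjk hd hr0 h1 h2
  obtain ⟨i, hij, hik, hall⟩ := exists_third hjk
  have hMi := (hMi i hij hik).1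
  have hRj : T.R j P ∈ T.wedge j := R_mem_wedge (Or.inl hP)
  have hRk : T.R k P ∈ T.wedge k := R_mem_wedge (Or.inl hP)
  have ep : ∀ l, fold T (!b) (T.R l P) = copy T b P := fun l => by
    rw [fold_R hc (Or.inl hP), Bool.not_not, fold_of_mem hP]
  have eM : fold T (!b) M = copy T (!b) M := fold_of_mem hMT
  have hMge : r ≤ dist (copy T b P) (copy T (!b) M) :=
    hr.le_dist_copy_not hP hjk hMT h1.le h2.le b
  have hMball : copy T (!b) M ∈ Metric.ball (copy T b P) s := by
    rw [Metric.mem_ball, dist_comm, ← eM, ← ep j]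
    exact (dist_fold_le hc hRj (Or.inl hMT)).trans_lt (h1 ▸ hs)
  -- The midpoint can be a cone point (of angle `π`); then the larger ball contains a cone point.
  by_cases hvert : T.x j M = 0 ∧ T.x k M = 0
  · exact not_isometricAt_of_vertex hc hD hMT hjk hvert.1 hvert.2 (!b) (hch.right_inv _ hMball)
      (hch.isometricAt _ (hch.maps' _ hMball))
  obtain ⟨l, hl⟩ : ∃ l, ∀ i, i ≠ l → 0 < T.x i M := by
    have hm := T.mem_region_iff.1 hMT
    by_cases hj : T.x j M = 0
    · have hk : T.x k M ≠ 0 := fun hk => hvert ⟨hj, hk⟩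
      refine ⟨j, fun l hl => ?_⟩
      rcases hall l with rfl | rfl | rfl
      · exact hMi
      · exact absurd rfl hl
      · exact lt_of_le_of_ne (hm _) hk.symm
    · refine ⟨k, fun l hl => ?_⟩
      rcases hall l with rfl | rfl | rfl
      · exact hMi
      · exact lt_of_le_of_ne (hm _) (Ne.symm hj)
      · exact absurd rfl hl
  obtain ⟨U, hU, hUiso⟩ := (isometricAt_fold_of_mem hc (b := !b) hMT hl).1
  obtain ⟨V, hV, hViso⟩ := hch.isometricAt' _ hMball
  have hVc : fold T (!b) ⁻¹' V ∈ 𝓝 M :=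
    (IsometricAt.continuousAt ⟨U, hU, hUiso⟩).preimage_mem_nhds (eM ▸ hV)
  obtain ⟨ε, hε, hball⟩ := Metric.mem_nhds_iff.1 (Filter.inter_mem hU hVc)
  obtain ⟨h, h0, hh⟩ := exists_between (lt_min hε hr0)
  rw [lt_min_iff] at hh
  have htt : 1 - h / r ∈ Set.Icc (0 : ℝ) 1 := by
    constructor
    · rw [sub_nonneg, div_le_one hr0]; exact hh.2.le
    · have : 0 < h / r := by positivity
      linarith
  have hpt : ∀ l, T.R l P ∈ T.wedge l → dist (T.R l P) M = r → ∃ y ∈ T.wedge l,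
      dist y M = h ∧ dist (T.R l P) y = r - h := by
    intro l hRl hlM
    refine ⟨geo (T.R l P) M (1 - h / r), geo_mem_wedge hc hRl (Or.inl hMT) htt, ?_, ?_⟩
    · rw [dist_geo_right _ _ htt, hlM]; field_simp; ring
    · rw [dist_left_geo _ _ htt, hlM]; field_simp
  obtain ⟨y, hyw, hyM, hyP⟩ := hpt j hRj h1
  obtain ⟨z, hzw, hzM, hzP⟩ := hpt k hRk (by rw [dist_comm]; exact h2)
  have hyz : dist y z = 2 * h := by
    apply le_antisymm
    · linarith [dist_triangle_right y z M]
    · have := dist_triangle4 (T.R j P) y z (T.R k P)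
      rw [hd, hyP, dist_comm z, hzP] at this
      linarith
  have hyU := hball (show y ∈ Metric.ball M ε by rw [Metric.mem_ball, hyM]; exact hh.1)
  have hzU := hball (show z ∈ Metric.ball M ε by rw [Metric.mem_ball, hzM]; exact hh.1)
  have hMU := mem_of_mem_nhds (Filter.inter_mem hU hVc)
  have tr : ∀ a ∈ U ∩ fold T (!b) ⁻¹' V, ∀ c ∈ U ∩ fold T (!b) ⁻¹' V,
      dist (Ψ (fold T (!b) a)) (Ψ (fold T (!b) c)) = dist a c := fun a ha c hc' => by
    rw [hViso _ ha.2 _ hc'.2, hUiso _ ha.1 _ hc'.1]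
  have hle : ∀ l, T.R l P ∈ T.wedge l → ∀ y ∈ T.wedge l, dist (T.R l P) y = r - h →
      dist UpperHalfPlane.I (Ψ (fold T (!b) y)) ≤ r - h := by
    intro l hRl y hy hly
    refine hch.symm.dist_le hs0 (f := fun t => fold T (!b) (geo (T.R l P) y t)) (by linarith)
      (by simp only [geo_zero, ep]) (by simp only [geo_one]) fun s hs t ht => ?_
    refine (dist_fold_le hc (geo_mem_wedge hc hRl hy hs) (geo_mem_wedge hc hRl hy ht)).trans ?_
    rw [dist_geo _ _ hs ht, hly]
  have hge : r ≤ dist UpperHalfPlane.I (Ψ (fold T (!b) M)) := by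
    rw [eM]
    refine hMge.trans ?_
    set m := Ψ (copy T (!b) M) with hm
    have hmb : m ∈ Metric.ball UpperHalfPlane.I s := hch.maps' _ hMball
    rw [Metric.mem_ball, dist_comm] at hmb
    have := hch.dist_le hs0 (f := geo UpperHalfPlane.I m) hmb (geo_zero _ _) (geo_one _ _)
      fun s hs t ht => (dist_geo _ _ hs ht).le
    rwa [hm, hch.right_inv _ hMball] at this
  -- The contradiction: `2 cosh h cosh r ≤ 2 cosh (r - h) = 2 cosh r cosh h - 2 sinh r sinh h`.
  have hmid := cosh_dist_add_of_midpoint (h := h) ((tr y hyU M hMU).trans hyM)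
    ((tr M hMU z hzU).trans (by rw [dist_comm]; exact hzM)) ((tr y hyU z hzU).trans hyz)
    UpperHalfPlane.I
  have c1 : ∀ {a c : ℝ}, 0 ≤ a → a ≤ c → Real.cosh a ≤ Real.cosh c := fun ha hac => by
    rw [Real.cosh_le_cosh, abs_of_nonneg ha, abs_of_nonneg (ha.trans hac)]; exact hac
  have i1 := c1 dist_nonneg (hle j hRj y hyw hyP)
  have i2 := c1 dist_nonneg (hle k hRk z hzw hzP)
  have i3 := c1 hr0.le hge
  have i4 := Real.cosh_sub r h
  have i5 : 0 < Real.sinh r * Real.sinh h :=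
    mul_pos (Real.sinh_pos_iff.2 hr0) (Real.sinh_pos_iff.2 h0)
  have i6 := Real.cosh_pos h
  nlinarith

end Upper

theorem Separated.injRadius_eq (hc : ∀ i, 0 ≤ Real.cos (θ i)) (hD : 0 < gramDet θ)
    {P : UpperHalfPlane} {r : ℝ} (hr : Separated T P r) (hP : P ∈ T.region) {j k : Fin 3}
    (hjk : j ≠ k) (hd : dist (T.R j P) (T.R k P) = 2 * r) (b : Bool) :
    injRadius T (copy T b P) = r := by
  have hr0 : 0 ≤ r := by linarith [dist_nonneg (x := T.R j P) (y := T.R k P)]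
  refine injRadius_eq_of_isChart hr0 ?_ fun s hs Φ Ψ => hr.not_isChart hc hD hP hjk hd b hs Φ Ψ
  obtain ⟨f, hf⟩ := isometry_exists P
  obtain ⟨Ψ, hΨ, -⟩ := hr.exists_isChart hc hP b
  exact ⟨_, _, hΨ.comp f hf⟩

end

section

variable {θ : Fin 3 → ℝ} {T : HypTriangle θ}

open HypTriangle

/-! ### The function to be maximized -/

namespace HypTriangle

/-- The square of the hyperbolic sine of half the length of the loop at `z` around the vertex number
`i`. -/
def g (T : HypTriangle θ) (i : Fin 3) (z : UpperHalfPlane) : ℝ :=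
  T.x (i + 1) z ^ 2 + T.x (i + 2) z ^ 2 + 2 * T.x (i + 1) z * T.x (i + 2) z * Real.cos (θ i)

/-- The minimum of the three functions `g i`. -/
def m (T : HypTriangle θ) (z : UpperHalfPlane) : ℝ := min (T.g 0 z) (min (T.g 1 z) (T.g 2 z))

variable (T)

theorem g_eq {i j k : Fin 3} (hij : i ≠ j) (hjk : j ≠ k) (hik : i ≠ k) (z : UpperHalfPlane) :
    T.g i z = T.x j z ^ 2 + T.x k z ^ 2 + 2 * T.x j z * T.x k z * Real.cos (θ i) := by
  have : (j = i + 1 ∧ k = i + 2) ∨ (j = i + 2 ∧ k = i + 1) := by omega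
  rcases this with ⟨rfl, rfl⟩ | ⟨rfl, rfl⟩ <;> rw [g]
  ring

theorem continuous_g (i : Fin 3) : Continuous (T.g i) := by
  have := T.continuous_x (i + 1)
  have := T.continuous_x (i + 2)
  unfold g
  fun_prop

theorem continuous_m : Continuous T.m :=
  (T.continuous_g 0).min ((T.continuous_g 1).min (T.continuous_g 2))

theorem lt_m_iff {z : UpperHalfPlane} {a : ℝ} : a < T.m z ↔ ∀ i, a < T.g i z := by
  rw [m, lt_min_iff, lt_min_iff, Fin.forall_fin_succ, Fin.forall_fin_two]; rfl

theorem le_m_iff {z : UpperHalfPlane} {a : ℝ} : a ≤ T.m z ↔ ∀ i, a ≤ T.g i z := by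
  rw [m, le_min_iff, le_min_iff, Fin.forall_fin_succ, Fin.forall_fin_two]; rfl

theorem m_le (z : UpperHalfPlane) (i : Fin 3) : T.m z ≤ T.g i z := T.le_m_iff.1 le_rfl i

theorem exists_g_eq_m (z : UpperHalfPlane) : ∃ i, T.g i z = T.m z := by
  by_contra! H
  exact lt_irrefl _ (T.lt_m_iff.2 fun i => lt_of_le_of_ne (T.m_le z i) (H i).symm)

variable {T}

theorem g_nonneg (hc : ∀ i, 0 ≤ Real.cos (θ i)) {z : UpperHalfPlane} (hz : z ∈ T.region)
    (i : Fin 3) : 0 ≤ T.g i z := by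
  rw [mem_region_iff] at hz
  have := hz (i + 1)
  have := hz (i + 2)
  have := hc i
  unfold g
  positivity

theorem sq_le_g (hc : ∀ i, 0 ≤ Real.cos (θ i)) {z : UpperHalfPlane} (hz : z ∈ T.region)
    {i j : Fin 3} (hij : i ≠ j) : T.x j z ^ 2 ≤ T.g i z := by
  obtain ⟨k, hki, hkj, -⟩ := exists_third hij
  rw [T.g_eq hij hkj.symm hki.symm]
  rw [mem_region_iff] at hz
  have := mul_nonneg (mul_nonneg (hz j) (hz k)) (hc i)
  nlinarith [sq_nonneg (T.x k z)]

theorem m_nonneg (hc : ∀ i, 0 ≤ Real.cos (θ i)) {z : UpperHalfPlane} (hz : z ∈ T.region) :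
    0 ≤ T.m z := T.le_m_iff.2 (g_nonneg hc hz)

theorem g_of_x_eq_zero {i j k : Fin 3} (hij : i ≠ j) (hjk : j ≠ k) (hik : i ≠ k)
    {z : UpperHalfPlane} (h : T.x j z = 0) : T.g i z = T.x k z ^ 2 := by
  rw [T.g_eq hij hjk hik, h]; ring

theorem x_eq_zero_of_g (hc : ∀ i, 0 ≤ Real.cos (θ i)) {z : UpperHalfPlane} (hz : z ∈ T.region)
    {i j : Fin 3} (hij : i ≠ j) (h : T.g i z = 0) : T.x j z = 0 := by
  have := sq_le_g hc hz hij
  rw [h] at this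
  exact pow_eq_zero_iff two_ne_zero |>.1 (le_antisymm this (sq_nonneg _))

theorem cosh_dist_R_R {i j k : Fin 3} (hij : i ≠ j) (hjk : j ≠ k) (hik : i ≠ k)
    (z : UpperHalfPlane) : Real.cosh (dist (T.R j z) (T.R k z)) = 1 + 2 * T.g i z := by
  have e1 := (T.side j).mink_refl z (T.R k z)
  have e2 := (T.side k).mink_refl z z
  have e3 := T.x_R hjk.symm hij.symm hik.symm z
  have e4 : mink (vec z) (vec (T.R k z)) = mink (vec (T.R k z)) (vec z) := mink_comm _ _
  rw [cosh_dist_eq, T.g_eq hij hjk hik]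
  rw [mink_vec_self] at e2
  change mink (vec (T.R j z)) (vec (T.R k z)) = _ - 2 * T.x j z * T.x j (T.R k z) at e1
  change mink (vec (T.R k z)) (vec z) = -1 - 2 * T.x k z * T.x k z at e2
  rw [e1, e4, e2, e3]
  ring

theorem dist_R_R_le_iff {i j k : Fin 3} (hij : i ≠ j) (hjk : j ≠ k) (hik : i ≠ k)
    {z : UpperHalfPlane} {r : ℝ} (hr : 0 ≤ r) :
    (dist (T.R j z) (T.R k z) ≤ 2 * r ↔ T.g i z ≤ Real.sinh r ^ 2) ∧
    (2 * r ≤ dist (T.R j z) (T.R k z) ↔ Real.sinh r ^ 2 ≤ T.g i z) := by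
  have e := cosh_dist_R_R (T := T) hij hjk hik z
  have e2 := Real.cosh_two_mul r
  have e3 := Real.cosh_sq r
  have h1 : 0 ≤ 2 * r := by linarith
  constructor
  · have : dist (T.R j z) (T.R k z) ≤ 2 * r ↔
        Real.cosh (dist (T.R j z) (T.R k z)) ≤ Real.cosh (2 * r) := by
      rw [Real.cosh_le_cosh, abs_of_nonneg dist_nonneg, abs_of_nonneg h1]
    rw [this, e, e2, e3]
    constructor <;> intro h <;> linarith
  · have : 2 * r ≤ dist (T.R j z) (T.R k z) ↔
        Real.cosh (2 * r) ≤ Real.cosh (dist (T.R j z) (T.R k z)) := by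
      rw [Real.cosh_le_cosh, abs_of_nonneg dist_nonneg, abs_of_nonneg h1]
    rw [this, e, e2, e3]
    constructor <;> intro h <;> linarith

/-- The injectivity radius at the two points of the surface that correspond to `z`. -/
def rad (T : HypTriangle θ) (z : UpperHalfPlane) : ℝ := Real.arsinh √(T.m z)

theorem rad_nonneg (z : UpperHalfPlane) : 0 ≤ T.rad z :=
  Real.arsinh_nonneg_iff.2 (Real.sqrt_nonneg _)

theorem sinh_rad_sq (hc : ∀ i, 0 ≤ Real.cos (θ i)) {z : UpperHalfPlane} (hz : z ∈ T.region) :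
    Real.sinh (T.rad z) ^ 2 = T.m z := by
  rw [rad, Real.sinh_arsinh, Real.sq_sqrt (m_nonneg hc hz)]

theorem rad_le_rad_iff (hc : ∀ i, 0 ≤ Real.cos (θ i)) {z w : UpperHalfPlane} (hw : w ∈ T.region) :
    T.rad z ≤ T.rad w ↔ T.m z ≤ T.m w := by
  rw [rad, rad, Real.arsinh_le_arsinh, Real.sqrt_le_sqrt_iff (m_nonneg hc hw)]

theorem rad_pos_iff {z : UpperHalfPlane} : 0 < T.rad z ↔ 0 < T.m z := by
  rw [rad, Real.arsinh_pos_iff, Real.sqrt_pos]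

end HypTriangle

theorem separated_rad (hc : ∀ i, 0 ≤ Real.cos (θ i)) {z : UpperHalfPlane} (hz : z ∈ T.region) :
    Separated T z (T.rad z) := by
  intro j k hjk
  obtain ⟨i, hij, hik, -⟩ := exists_third hjk
  rw [(dist_R_R_le_iff hij hjk hik (rad_nonneg z)).2, sinh_rad_sq hc hz]
  exact T.m_le z i

theorem dist_R_R_eq_of_g_eq (hc : ∀ i, 0 ≤ Real.cos (θ i)) {z : UpperHalfPlane} (hz : z ∈ T.region)
    {i j k : Fin 3} (hij : i ≠ j) (hjk : j ≠ k) (hik : i ≠ k) (h : T.g i z = T.m z) :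
    dist (T.R j z) (T.R k z) = 2 * T.rad z := by
  have h' := dist_R_R_le_iff (T := T) (z := z) hij hjk hik (rad_nonneg (T := T) z)
  rw [sinh_rad_sq hc hz, h] at h'
  exact le_antisymm (h'.1.2 le_rfl) (h'.2.2 le_rfl)

theorem exists_dist_R_R_eq (hc : ∀ i, 0 ≤ Real.cos (θ i)) {z : UpperHalfPlane} (hz : z ∈ T.region) :
    ∃ j k, j ≠ k ∧ dist (T.R j z) (T.R k z) = 2 * T.rad z := by
  obtain ⟨i, hi⟩ := T.exists_g_eq_m z
  have h1 : i ≠ i + 1 := by omega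
  have h2 : i + 1 ≠ i + 2 := by omega
  have h3 : i ≠ i + 2 := by omega
  exact ⟨i + 1, i + 2, h2, dist_R_R_eq_of_g_eq hc hz h1 h2 h3 hi⟩

/-- The geometry of the surface is now encoded in the explicit function `m` on the triangle. -/
theorem injRadius_copy (hc : ∀ i, 0 ≤ Real.cos (θ i)) (hD : 0 < gramDet θ) {z : UpperHalfPlane}
    (hz : z ∈ T.region) (b : Bool) : injRadius T (copy T b z) = T.rad z := by
  obtain ⟨j, k, hjk, h⟩ := exists_dist_R_R_eq hc hz
  exact (separated_rad hc hz).injRadius_eq hc hD hz hjk h b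

/-! ### Maxima -/

/-- Completing the square in `x i`. At a proper vertex the linear form is `√D * sin (θ i)` times the
hyperbolic cosine of the distance to it; at an ideal vertex its square is `D * g i`. -/
theorem adjForm_single_sq (θ : Fin 3 → ℝ) {i j k : Fin 3} (hij : i ≠ j) (hjk : j ≠ k) (hik : i ≠ k)
    (x : Fin 3 → ℝ) : ((1 - Real.cos (θ i) ^ 2) * x i +
        (Real.cos (θ k) + Real.cos (θ i) * Real.cos (θ j)) * x j +
        (Real.cos (θ j) + Real.cos (θ i) * Real.cos (θ k)) * x k) ^ 2 =
      gramDet θ * (x j ^ 2 + x k ^ 2 + 2 * x j * x k * Real.cos (θ i)) +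
        (1 - Real.cos (θ i) ^ 2) * adjForm θ x x := by
  rw [adjForm_eq θ hij hjk hik]
  have : gramDet θ = Real.cos (θ i) ^ 2 + Real.cos (θ j) ^ 2 + Real.cos (θ k) ^ 2 +
      2 * Real.cos (θ i) * Real.cos (θ j) * Real.cos (θ k) - 1 := by
    obtain rfl | rfl | rfl : i = 0 ∨ i = 1 ∨ i = 2 := by omega
    all_goals obtain rfl | rfl | rfl : j = 0 ∨ j = 1 ∨ j = 2 := by omega
    all_goals obtain rfl | rfl | rfl : k = 0 ∨ k = 1 ∨ k = 2 := by omega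
    all_goals first | exact absurd rfl hij | exact absurd rfl hjk | exact absurd rfl hik | skip
    all_goals unfold gramDet; ring
  rw [this]
  ring

theorem one_sub_cos_sq_nonneg (t : ℝ) : 0 ≤ 1 - Real.cos t ^ 2 := by
  have := Real.sin_sq_add_cos_sq t
  nlinarith [sq_nonneg (Real.sin t)]

/-- A point of the triangle is determined by the distances to the vertices, and cannot be moved away
from all of them. -/
theorem eq_of_g_le (hc : ∀ i, 0 ≤ Real.cos (θ i)) (hD : 0 < gramDet θ) {p q : UpperHalfPlane}
    (hq : q ∈ T.region) (h : ∀ i, T.g i p ≤ T.g i q) : p = q := by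
  let l : Fin 3 → Fin 3 → Fin 3 → UpperHalfPlane → ℝ := fun i j k z =>
    (1 - Real.cos (θ i) ^ 2) * T.x i z +
      (Real.cos (θ k) + Real.cos (θ i) * Real.cos (θ j)) * T.x j z +
      (Real.cos (θ j) + Real.cos (θ i) * Real.cos (θ k)) * T.x k z
  have hl : ∀ i j k, i ≠ j → j ≠ k → i ≠ k → l i j k p ≤ l i j k q := by
    intro i j k hij hjk hik
    have hsq : ∀ z, l i j k z ^ 2 =
        gramDet θ * T.g i z + (1 - Real.cos (θ i) ^ 2) * gramDet θ := fun z => by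
      have h1 := adjForm_single_sq θ hij hjk hik fun i => T.x i z
      rw [adjForm_self] at h1
      rw [T.g_eq hij hjk hik]
      exact h1
    have hnn : 0 ≤ l i j k q := by
      rw [mem_region_iff] at hq
      have := hq i
      have := hq j
      have := hq k
      have := hc i
      have := hc j
      have := hc k
      have := one_sub_cos_sq_nonneg (θ i)
      simp only [l]
      positivity
    -- The squares of the linear forms are ordered like the `g i`, and only the form at `q` needs a
    -- sign.
    refine (le_abs_self _).trans (abs_le_of_sq_le_sq ?_ hnn)
    rw [hsq, hsq]
    have := mul_le_mul_of_nonneg_left (h i) hD.le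
    linarith
  have h0 := hl 0 1 2 (by decide) (by decide) (by decide)
  have h1 := hl 1 0 2 (by decide) (by decide) (by decide)
  have h2 := hl 2 0 1 (by decide) (by decide) (by decide)
  have e1 := gramDet_mul_cosh_dist T p q
  have e2 := adjForm_self T q
  rw [mem_region_iff] at hq
  have k0 := mul_le_mul_of_nonneg_left h0 (hq 0)
  have k1 := mul_le_mul_of_nonneg_left h1 (hq 1)
  have k2 := mul_le_mul_of_nonneg_left h2 (hq 2)
  simp only [adjForm, l] at *
  -- The bilinear form is `∑ x i q * l i p`; replacing `l i p` by the larger `l i q` gives `adjForm`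
  -- of `q` with itself.
  have : gramDet θ * Real.cosh (dist p q) ≤ gramDet θ := by
    rw [e1]
    conv_rhs => rw [← e2]
    linarith
  apply eq_of_mink_vec
  rw [← cosh_dist_eq]
  nlinarith

/-- Small perturbations of a point in the direction of a vector. -/
theorem eventually_exists_near (P : UpperHalfPlane) (W : Vec) {δ : ℝ} (hδ : 0 < δ) :
    ∀ᶠ ε in 𝓝[>] (0 : ℝ), ∃ Q, dist P Q < δ ∧ mink (vec P + ε • W) (vec P + ε • W) < 0 ∧
      vec Q = (1 / √(-mink (vec P + ε • W) (vec P + ε • W))) • (vec P + ε • W) := by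
  have e : ∀ ε : ℝ, mink (vec P + ε • W) (vec P + ε • W) =
      -1 + 2 * ε * mink (vec P) W + ε ^ 2 * mink W W := fun ε => by
    simp only [mink_add_left, mink_add_right, mink_smul_left, mink_smul_right, mink_vec_self,
      mink_comm W (vec P)]
    ring
  have c1 : Continuous fun ε : ℝ => -1 + 2 * ε * mink (vec P) W + ε ^ 2 * mink W W := by fun_prop
  have c2 : Continuous fun ε : ℝ => (vec P).2.2 + ε * W.2.2 := by fun_prop
  have h1 : ∀ᶠ ε in 𝓝 (0 : ℝ), -1 + 2 * ε * mink (vec P) W + ε ^ 2 * mink W W < 0 :=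
    c1.continuousAt.eventually (gt_mem_nhds (by norm_num))
  have h2 : ∀ᶠ ε in 𝓝 (0 : ℝ), 0 < (vec P).2.2 + ε * W.2.2 :=
    c2.continuousAt.eventually (lt_mem_nhds (by simpa using vec_last_pos P))
  -- This function of `ε` is the hyperbolic cosine of the distance from `P` to the perturbed point;
  -- it equals `1` at `0`.
  have c3 : ContinuousAt (fun ε : ℝ =>
      1 / √(-(-1 + 2 * ε * mink (vec P) W + ε ^ 2 * mink W W)) * (1 - ε * mink (vec P) W)) 0 := by
    refine ContinuousAt.mul (ContinuousAt.div continuousAt_const ?_ ?_) (by fun_prop)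
    · exact (Real.continuous_sqrt.comp c1.neg).continuousAt
    · norm_num
  have h3 := c3.eventually_lt (continuousAt_const (y := Real.cosh δ)) (by
    simpa using hδ.ne')
  filter_upwards [nhdsWithin_le_nhds h1, nhdsWithin_le_nhds h2, nhdsWithin_le_nhds h3]
    with ε k1 k2 k3
  rw [← e] at k1 k3
  obtain ⟨Q, hQ⟩ := exists_vec_eq_smul k1 (by simpa using k2)
  refine ⟨Q, ?_, k1, hQ⟩
  have : Real.cosh (dist P Q) < Real.cosh δ := by
    have e' : mink (vec P) (vec P + ε • W) = -1 + ε * mink (vec P) W := by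
      rw [mink_add_right, mink_smul_right, mink_vec_self]
    rw [cosh_dist_eq, hQ, mink_smul_right, e']
    refine lt_of_eq_of_lt ?_ k3
    ring
  rwa [Real.cosh_lt_cosh, abs_of_nonneg dist_nonneg, abs_of_pos hδ] at this

theorem x_of_smul_add {P Q : UpperHalfPlane} {c ε : ℝ} {W : Vec}
    (h : vec Q = c • (vec P + ε • W)) (i : Fin 3) :
    T.x i Q = c * (T.x i P + ε * mink (T.side i).normal W) := by
  rw [HypTriangle.x, HalfPlane.coord, h, mink_smul_right, mink_add_right, mink_smul_right]; rfl

theorem mink_normal_normal (T : HypTriangle θ) {i j k : Fin 3} (hij : i ≠ j) (hjk : j ≠ k)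
    (hik : i ≠ k) : mink (T.side i).normal (T.side j).normal = -Real.cos (θ k) := by
  rw [← form_eq_mink, T.angle i j k hij hjk hik]

theorem eventually_pos_add_mul {a : ℝ} (ha : 0 < a) (c : ℝ) :
    ∀ᶠ ε in 𝓝[>] (0 : ℝ), 0 < a + ε * c := by
  have : Continuous fun ε : ℝ => a + ε * c := by fun_prop
  exact nhdsWithin_le_nhds (this.continuousAt.eventually (lt_mem_nhds (by simpa using ha)))

/-- Moving away from the side number `k` increases the distances to both vertices on it. -/
theorem exists_near_g_lt (hc : ∀ i, 0 ≤ Real.cos (θ i)) {P : UpperHalfPlane} (hP : P ∈ T.region)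
    {i j k : Fin 3} (hij : i ≠ j) (hjk : j ≠ k) (hik : i ≠ k) (hi : 0 < T.x i P)
    (hj : 0 < T.x j P) {δ : ℝ} (hδ : 0 < δ) :
    ∃ Q ∈ T.region, dist P Q < δ ∧ T.g i P < T.g i Q ∧ T.g j P < T.g j Q := by
  have hp := T.mem_region_iff.1 hP
  obtain ⟨ε, ⟨⟨Q, hQ, hneg, hvec⟩, h1, h2⟩, hε⟩ :=
    ((eventually_exists_near P (T.side k).normal hδ).and
      ((eventually_pos_add_mul hi (-Real.cos (θ j))).and
        (eventually_pos_add_mul hj (-Real.cos (θ i))))).and self_mem_nhdsWithin |>.exists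
  have hε : 0 < ε := hε
  have e : mink (vec P + ε • (T.side k).normal) (vec P + ε • (T.side k).normal) =
      -1 + 2 * ε * T.x k P + ε ^ 2 := by
    have h3 : mink (T.side k).normal (vec P) = T.x k P := rfl
    simp only [mink_add_left, mink_add_right, mink_smul_left, mink_smul_right, mink_vec_self,
      mink_comm (vec P) (T.side k).normal, mink_normal_self, h3]
    ring
  rw [e] at hneg hvec
  set ν := -(-1 + 2 * ε * T.x k P + ε ^ 2) with hν
  have hν0 : 0 < ν := by linarith
  have hν1 : ν < 1 := by nlinarith [hp k]
  have hsq := Real.sq_sqrt hν0.le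
  have hs0 : 0 < √ν := Real.sqrt_pos.2 hν0
  have xi := x_of_smul_add (T := T) hvec i
  have xj := x_of_smul_add (T := T) hvec j
  have xk := x_of_smul_add (T := T) hvec k
  rw [mink_normal_normal T hik hjk.symm hij] at xi
  rw [mink_normal_normal T hjk hik.symm hij.symm] at xj
  rw [mink_normal_self, mul_one] at xk
  have key : ∀ i j, i ≠ j → j ≠ k → i ≠ k → 0 < T.x j P →
      T.x j Q = 1 / √ν * (T.x j P + ε * -Real.cos (θ i)) → T.g i P < T.g i Q := by
    intro i j hij hjk hik hj xj
    have hg := sq_le_g hc hP hij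
    have hg' : 0 < T.g i P := lt_of_lt_of_le (by positivity) hg
    -- Adding `ε` times the normal of the side `k` increases `g i` by `sin² θ i * (1 - ν)`, and
    -- normalizing divides by `ν < 1`. So `g i` grows even at an ideal vertex.
    have hgQ : T.g i Q = (T.g i P + (1 - Real.cos (θ i) ^ 2) * (1 - ν)) / ν := by
      rw [T.g_eq hij hjk hik, T.g_eq hij hjk hik, xj, xk]
      field_simp
      rw [hsq, hν]
      ring
    rw [hgQ, lt_div_iff₀ hν0]
    have := one_sub_cos_sq_nonneg (θ i)
    nlinarith [mul_nonneg this (sub_nonneg.2 hν1.le)]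
  refine ⟨Q, T.mem_region_iff.2 fun l => ?_, hQ, key i j hij hjk hik hj xj,
    key j i hij.symm hik hjk hi xi⟩
  have hl : l = i ∨ l = j ∨ l = k := by omega
  rcases hl with rfl | rfl | rfl
  · rw [xi]; positivity
  · rw [xj]; positivity
  · rw [xk]; have := hp l; positivity

/-- A zero of `m` in the triangle is a vertex; adding a small multiple of the sum of the two normals
there moves it into the interior. -/
theorem exists_near_m_pos (hc : ∀ i, 0 ≤ Real.cos (θ i)) (hD : 0 < gramDet θ) {P : UpperHalfPlane}
    (hP : P ∈ T.region) (hm : T.m P = 0) {δ : ℝ} (hδ : 0 < δ) :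
    ∃ Q ∈ T.region, dist P Q < δ ∧ 0 < T.m Q := by
  have hp := T.mem_region_iff.1 hP
  obtain ⟨i, hi⟩ := T.exists_g_eq_m P
  rw [hm] at hi
  obtain ⟨j, k, hij, hjk, hik⟩ : ∃ j k : Fin 3, i ≠ j ∧ j ≠ k ∧ i ≠ k :=
    ⟨i + 1, i + 2, by omega, by omega, by omega⟩
  have hj := x_eq_zero_of_g hc hP hij hi
  have hk := x_eq_zero_of_g hc hP hik hi
  have hDi := adjForm_self T P
  rw [adjForm_eq θ hij hjk hik, hj, hk] at hDi
  -- The coordinates of the vertex satisfy `sin² θ i * x i ^ 2 = D > 0`, so a vertex in the plane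
  -- has positive angle.
  have hci : 0 < 1 - Real.cos (θ i) := by
    by_contra! hneg
    have h1 : Real.cos (θ i) = 1 := le_antisymm (Real.cos_le_one _) (by linarith)
    rw [h1] at hDi
    norm_num at hDi
    linarith
  have hxi : 0 < T.x i P := by
    refine lt_of_le_of_ne (hp i) fun e => ?_
    rw [← e] at hDi
    norm_num at hDi
    linarith
  obtain ⟨ε, ⟨⟨Q, hQ, hneg, hvec⟩, h1⟩, hε⟩ :=
    ((eventually_exists_near P ((T.side j).normal + (T.side k).normal) hδ).and
      (eventually_pos_add_mul hxi (-Real.cos (θ k) + -Real.cos (θ j)))).and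
        self_mem_nhdsWithin |>.exists
  have hε : 0 < ε := hε
  have hs0 := Real.sqrt_pos.2 (neg_pos.2 hneg)
  generalize √(-mink (vec P + ε • ((T.side j).normal + (T.side k).normal))
    (vec P + ε • ((T.side j).normal + (T.side k).normal))) = s at hvec hs0
  have xi := x_of_smul_add (T := T) hvec i
  have xj := x_of_smul_add (T := T) hvec j
  have xk := x_of_smul_add (T := T) hvec k
  rw [mink_add_right, mink_normal_normal T hij hjk hik,
    mink_normal_normal T hik hjk.symm hij] at xi
  rw [mink_add_right, mink_normal_normal T hjk hik.symm hij.symm, mink_normal_self, hj] at xj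
  rw [mink_add_right, mink_normal_normal T hjk.symm hij.symm hik.symm, mink_normal_self, hk] at xk
  have pi : 0 < T.x i Q := by rw [xi]; positivity
  have pj : 0 < T.x j Q := by
    rw [xj]
    have : 0 < 0 + ε * (1 + -Real.cos (θ i)) := by nlinarith
    positivity
  have pk : 0 < T.x k Q := by
    rw [xk]
    have : 0 < 0 + ε * (-Real.cos (θ i) + 1) := by nlinarith
    positivity
  have hpos : ∀ l, 0 < T.x l Q := fun l => by
    have hl : l = i ∨ l = j ∨ l = k := by omega
    rcases hl with rfl | rfl | rfl <;> assumption
  have hQT := T.mem_region_iff.2 fun l => (hpos l).le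
  refine ⟨Q, hQT, hQ, T.lt_m_iff.2 fun l => ?_⟩
  have := hpos (l + 1)
  exact lt_of_lt_of_le (by positivity) (sq_le_g hc hQT (show l ≠ l + 1 by omega))

/-- If `g k > m`, moving away from the side `k` increases the other two functions and keeps `g k >
m`, so `m` is not locally maximal. -/
theorem g_eq_of_localMax (hc : ∀ i, 0 ≤ Real.cos (θ i)) (hD : 0 < gramDet θ) {P : UpperHalfPlane}
    (hP : P ∈ T.region) {δ : ℝ} (hδ : 0 < δ)
    (hmax : ∀ Q ∈ T.region, dist P Q < δ → T.m Q ≤ T.m P) :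
    0 < T.m P ∧ ∀ i, T.g i P = T.m P := by
  have hm : 0 < T.m P := by
    refine lt_of_le_of_ne (m_nonneg hc hP) fun e => ?_
    obtain ⟨Q, hQ, hd, hpos⟩ := exists_near_m_pos hc hD hP e.symm hδ
    exact (hmax Q hQ hd).not_gt (e ▸ hpos)
  refine ⟨hm, ?_⟩
  by_contra! H
  obtain ⟨k, hk⟩ := H
  have hk : T.m P < T.g k P := lt_of_le_of_ne (T.m_le P k) hk.symm
  have hp := T.mem_region_iff.1 hP
  have move : ∀ {i j k : Fin 3}, i ≠ j → j ≠ k → i ≠ k → 0 < T.x i P → 0 < T.x j P →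
      T.m P < T.g k P → False := by
    intro i j k hij hjk hik hi hj hk
    have hev : ∀ᶠ Q in 𝓝 P, T.m P < T.g k Q :=
      (T.continuous_g k).continuousAt.eventually (lt_mem_nhds hk)
    obtain ⟨δ', hδ', h⟩ := Metric.eventually_nhds_iff.1 hev
    obtain ⟨Q, hQ, hd, hgi, hgj⟩ := exists_near_g_lt hc hP hij hjk hik hi hj (lt_min hδ hδ')
    rw [lt_min_iff] at hd
    refine (hmax Q hQ hd.1).not_gt (T.lt_m_iff.2 fun l => ?_)
    have hl : l = i ∨ l = j ∨ l = k := by omega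
    rcases hl with rfl | rfl | rfl
    · exact (T.m_le P _).trans_lt hgi
    · exact (T.m_le P _).trans_lt hgj
    · exact h (by rw [dist_comm]; exact hd.2)
  obtain ⟨i, hi⟩ := T.exists_g_eq_m P
  have hik : i ≠ k := by rintro rfl; exact hk.ne' hi
  obtain ⟨j, hji, hjk, -⟩ := exists_third hik
  have hxi : 0 < T.x i P := by
    refine lt_of_le_of_ne (hp i) fun e => ?_
    have h1 := g_of_x_eq_zero hik.symm hji.symm hjk.symm e.symm
    have h2 := sq_le_g hc hP hji.symm
    linarith
  rcases (hp j).lt_or_eq with hxj | hxj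
  · exact move hji.symm hjk hik hxi hxj hk
  -- If `P` is on the side `j`, then `g j ≥ x i ^ 2 = g k > m`, and the side `j` takes the role of
  -- `k`.
  · have h1 := g_of_x_eq_zero hjk.symm hji hik.symm hxj.symm
    have h2 := sq_le_g hc hP hji
    rcases (hp k).lt_or_eq with hxk | hxk
    · exact move hik hjk.symm hji.symm hxi hxk (by linarith)
    · have := g_of_x_eq_zero hji.symm hjk hik hxj.symm
      rw [← hxk] at this
      rw [this] at hi
      norm_num at hi
      linarith

/-! ### Existence of a maximum point -/

/-- All terms of `adjForm θ x x = D` are nonnegative. If `θ i > 0`, the term of `x i ^ 2` bounds `x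
i`. If `θ i = 0`, the mixed terms bound `x i * (x j + x k)`, and `ε ≤ g i = (x j + x k) ^ 2` keeps
the point away from the cusp. -/
theorem exists_x_le (hθ : ∀ i, 0 ≤ θ i ∧ θ i ≤ Real.pi / 2) (hsum : θ 0 + θ 1 + θ 2 < Real.pi)
    (hc : ∀ i, 0 ≤ Real.cos (θ i)) (T : HypTriangle θ) {ε : ℝ} (hε : 0 < ε) (i : Fin 3) :
    ∃ C, ∀ z ∈ T.region, ε ≤ T.m z → T.x i z ≤ C := by
  have hD := gramDet_pos hθ hsum
  obtain ⟨j, k, hij, hjk, hik⟩ : ∃ j k : Fin 3, i ≠ j ∧ j ≠ k ∧ i ≠ k :=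
    ⟨i + 1, i + 2, by omega, by omega, by omega⟩
  have hs := one_sub_cos_sq_nonneg (θ i)
  have hj := one_sub_cos_sq_nonneg (θ j)
  have hk := one_sub_cos_sq_nonneg (θ k)
  have hci := hc i
  have hcj := hc j
  have hck := hc k
  have hform : ∀ z ∈ T.region, (1 - Real.cos (θ i) ^ 2) * T.x i z ^ 2 ≤ gramDet θ ∧
      2 * ((Real.cos (θ k) + Real.cos (θ i) * Real.cos (θ j)) * (T.x i z * T.x j z) +
      (Real.cos (θ j) + Real.cos (θ i) * Real.cos (θ k)) * (T.x i z * T.x k z)) ≤ gramDet θ := by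
    intro z hz
    rw [mem_region_iff] at hz
    have xi := hz i
    have xj := hz j
    have xk := hz k
    have e := adjForm_self T z
    rw [adjForm_eq θ hij hjk hik] at e
    have t1 : 0 ≤ (1 - Real.cos (θ i) ^ 2) * (T.x i z * T.x i z) := by positivity
    have t2 : 0 ≤ (1 - Real.cos (θ j) ^ 2) * (T.x j z * T.x j z) := by positivity
    have t3 : 0 ≤ (1 - Real.cos (θ k) ^ 2) * (T.x k z * T.x k z) := by positivity
    have t4 : 0 ≤ (Real.cos (θ k) + Real.cos (θ i) * Real.cos (θ j)) *
      (T.x i z * T.x j z + T.x j z * T.x i z) := by positivity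
    have t5 : 0 ≤ (Real.cos (θ j) + Real.cos (θ i) * Real.cos (θ k)) *
      (T.x i z * T.x k z + T.x k z * T.x i z) := by positivity
    have t6 : 0 ≤ (Real.cos (θ i) + Real.cos (θ j) * Real.cos (θ k)) *
      (T.x j z * T.x k z + T.x k z * T.x j z) := by positivity
    constructor <;> linarith
  rcases hs.lt_or_eq with hs | hs
  · refine ⟨√(gramDet θ / (1 - Real.cos (θ i) ^ 2)), fun z hz _ => Real.le_sqrt_of_sq_le ?_⟩
    rw [le_div_iff₀ hs, mul_comm]
    exact (hform z hz).1
  · have hci1 : Real.cos (θ i) = 1 := by nlinarith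
    have hκ : 0 < Real.cos (θ k) + Real.cos (θ j) := by
      have := cos_add_pos hθ hsum hij hjk hik
      have h0 : Real.sin (θ i) = 0 := by
        have := Real.sin_sq_add_cos_sq (θ i)
        rw [hci1] at this
        exact pow_eq_zero_iff two_ne_zero |>.1 (by linarith)
      rw [h0, zero_mul, hci1, one_mul] at this
      exact this
    refine ⟨gramDet θ / ((Real.cos (θ k) + Real.cos (θ j)) * √ε), fun z hz hm => ?_⟩
    have h1 := (hform z hz).2
    have h2 := hm.trans (T.m_le z i)
    rw [T.g_eq hij hjk hik, hci1] at h2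
    rw [hci1] at h1
    rw [mem_region_iff] at hz
    have xi := hz i
    have xj := hz j
    have xk := hz k
    have h3 : √ε ≤ T.x j z + T.x k z := by
      rw [Real.sqrt_le_left (by positivity)]
      linarith
    rw [le_div_iff₀ (mul_pos hκ (Real.sqrt_pos.2 hε))]
    have h4 : T.x i z * ((Real.cos (θ k) + Real.cos (θ j)) * √ε) ≤
        T.x i z * ((Real.cos (θ k) + Real.cos (θ j)) * (T.x j z + T.x k z)) := by gcongr
    nlinarith [mul_nonneg (mul_nonneg xi hκ.le) (add_nonneg xj xk)]

/-- A superlevel set of `m` is compact: the hyperbolic cosine of the distance to `Q₀` is linear in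
the coordinates with nonnegative coefficients, and the coordinates are bounded. -/
theorem exists_m_max (hθ : ∀ i, 0 ≤ θ i ∧ θ i ≤ Real.pi / 2) (hsum : θ 0 + θ 1 + θ 2 < Real.pi)
    (hc : ∀ i, 0 ≤ Real.cos (θ i)) (T : HypTriangle θ) :
    ∃ P ∈ T.region, ∀ Q ∈ T.region, T.m Q ≤ T.m P := by
  have hD := gramDet_pos hθ hsum
  obtain ⟨Q₀, hQ₀, hm₀⟩ : ∃ Q ∈ T.region, 0 < T.m Q := by
    obtain ⟨z, hz⟩ := T.nonempty
    have hz : z ∈ T.region := hz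
    rcases (m_nonneg hc hz).lt_or_eq with h | h
    · exact ⟨z, hz, h⟩
    · obtain ⟨Q, hQ, -, h⟩ := exists_near_m_pos hc hD hz h.symm one_pos
      exact ⟨Q, hQ, h⟩
  set K := T.region ∩ {z | T.m Q₀ ≤ T.m z} with hK
  have hKcl : IsClosed K := T.isClosed_region.inter (isClosed_le continuous_const T.continuous_m)
  choose C hC using exists_x_le hθ hsum hc T hm₀
  have hKb : Bornology.IsBounded K := by
    refine (Metric.isBounded_iff_subset_closedBall Q₀).2
      ⟨2 * (adjForm θ (fun i => T.x i Q₀) C / gramDet θ), fun z hz => ?_⟩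
    have h1 := gramDet_mul_cosh_dist T Q₀ z
    have hx : ∀ i, T.x i z ≤ C i := fun i => hC i z hz.1 hz.2
    have h2 : adjForm θ (fun i => T.x i Q₀) (fun i => T.x i z) ≤
        adjForm θ (fun i => T.x i Q₀) C := by
      have hq := T.mem_region_iff.1 hQ₀
      have q0 := hq 0
      have q1 := hq 1
      have q2 := hq 2
      have x0 := hx 0
      have x1 := hx 1
      have x2 := hx 2
      have s0 := one_sub_cos_sq_nonneg (θ 0)
      have s1 := one_sub_cos_sq_nonneg (θ 1)
      have s2 := one_sub_cos_sq_nonneg (θ 2)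
      have c0 := hc 0
      have c1 := hc 1
      have c2 := hc 2
      unfold adjForm
      gcongr
    have h3 : Real.cosh (dist Q₀ z) ≤ adjForm θ (fun i => T.x i Q₀) C / gramDet θ := by
      rw [le_div_iff₀ hD, mul_comm, h1]
      exact h2
    have h4 := Real.add_one_le_exp (dist Q₀ z)
    have h5 := Real.cosh_add_sinh (dist Q₀ z)
    have h6 := Real.sinh_lt_cosh (dist Q₀ z)
    rw [Metric.mem_closedBall, dist_comm]
    linarith
  obtain ⟨P, hP, hmax⟩ := (Metric.isCompact_of_isClosed_isBounded hKcl hKb).exists_isMaxOn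
    ⟨Q₀, hQ₀, le_refl (T.m Q₀)⟩ T.continuous_m.continuousOn
  refine ⟨P, hP.1, fun Q hQ => ?_⟩
  rcases le_total (T.m Q₀) (T.m Q) with h | h
  · exact hmax ⟨hQ, h⟩
  · exact h.trans hP.2

end

section

variable {θ : Fin 3 → ℝ} {T : HypTriangle θ}

open HypTriangle

/-! ### Lengths of paths -/

section Length

variable {X : Type*} [MetricSpace X]

theorem ofReal_le_pathLength {p q : X} (γ : Path p q) {s t : I} (hst : s ≤ t) :
    ENNReal.ofReal (dist p (γ s) + dist (γ s) (γ t) + dist (γ t) q) ≤ pathLength γ := by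
  have h1 := eVariationOn.Icc_add_Icc γ (s := Set.univ) (bot_le (a := s)) hst (Set.mem_univ _)
  have h2 := eVariationOn.Icc_add_Icc γ (s := Set.univ) (bot_le (a := t)) (le_top (a := t))
    (Set.mem_univ _)
  simp only [Set.univ_inter] at h1 h2
  have e0 : edist p (γ s) ≤ eVariationOn γ (Set.Icc ⊥ s) := by
    have := eVariationOn.edist_le γ (s := Set.Icc ⊥ s) (x := 0) (y := s) ⟨le_rfl, bot_le⟩
      ⟨bot_le, le_rfl⟩
    rwa [γ.source] at this
  have e1 : edist (γ s) (γ t) ≤ eVariationOn γ (Set.Icc s t) :=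
    eVariationOn.edist_le γ ⟨le_rfl, hst⟩ ⟨hst, le_rfl⟩
  have e2 : edist (γ t) q ≤ eVariationOn γ (Set.Icc t ⊤) := by
    have := eVariationOn.edist_le γ (s := Set.Icc t ⊤) (x := t) (y := 1) ⟨le_rfl, le_top⟩
      ⟨le_top, le_rfl⟩
    rwa [γ.target] at this
  rw [ENNReal.ofReal_add (by positivity) dist_nonneg, ENNReal.ofReal_add dist_nonneg dist_nonneg,
    ← edist_dist, ← edist_dist, ← edist_dist]
  calc _ ≤ eVariationOn γ (Set.Icc ⊥ s) + eVariationOn γ (Set.Icc s t) +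
        eVariationOn γ (Set.Icc t ⊤) := add_le_add (add_le_add e0 e1) e2
    _ = eVariationOn γ (Set.Icc ⊥ ⊤) := by rw [h1, h2]
    _ ≤ _ := eVariationOn.mono _ (Set.subset_univ _)

theorem pathLength_le {p q : X} (γ : Path p q) {L : ℝ} (hL : 0 ≤ L)
    (h : ∀ s t : I, dist (γ s) (γ t) ≤ L * |(s : ℝ) - t|) : pathLength γ ≤ ENNReal.ofReal L := by
  have hl : LipschitzOnWith (Real.toNNReal L) (fun t : ℝ => γ.extend t) (Set.Icc 0 1) :=
    LipschitzOnWith.of_dist_le_mul fun s hs t ht => by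
      rw [Real.coe_toNNReal _ hL, Real.dist_eq, γ.extend_apply hs, γ.extend_apply ht]
      exact h _ _
  have h1 := hl.comp_eVariationOn_le (g := fun t : I => (t : ℝ)) (s := Set.univ)
    fun t _ => t.2
  have h2 : eVariationOn (fun t : I => (t : ℝ)) Set.univ ≤ ENNReal.ofReal (1 - 0) := by
    have := MonotoneOn.eVariationOn_eq (f := fun t : I => (t : ℝ)) (s := Set.univ)
      (fun _ _ _ _ h => h) (a := 0) (b := 1) (Set.mem_univ _) (Set.mem_univ _)
    refine le_trans (eVariationOn.mono _ ?_) this.le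
    intro t _
    exact ⟨Set.mem_univ _, t.2.1, t.2.2⟩
  have h3 : ((fun t : ℝ => γ.extend t) ∘ fun t : I => (t : ℝ)) = γ := by
    ext t; simp
  rw [h3] at h1
  refine h1.trans ?_
  calc _ ≤ (Real.toNNReal L : ENNReal) * ENNReal.ofReal (1 - 0) := by gcongr
    _ = _ := by simp [ENNReal.ofReal]

end Length

/-! ### Curves that are locally length-realizing -/

/-- The curve is geodesic with speed `c` on the open unit interval. -/
def LocallyGeodesic {X : Type*} [MetricSpace X] (e : ℝ → X) (c : ℝ) : Prop :=
  ContinuousOn e (Set.Icc 0 1) ∧ ∀ t ∈ Set.Ioo (0 : ℝ) 1, ∃ ε > 0, ∀ s s' : ℝ,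
    |s - t| < ε → |s' - t| < ε → dist (e s) (e s') = c * |s - s'|

namespace LocallyGeodesic

variable {X : Type*} [MetricSpace X] {e : ℝ → X} {c : ℝ}

theorem reverse (h : LocallyGeodesic e c) : LocallyGeodesic (fun t => e (1 - t)) c := by
  refine ⟨h.1.comp (by fun_prop) fun t ht => ⟨by linarith [ht.2], by linarith [ht.1]⟩,
    fun t ht => ?_⟩
  obtain ⟨ε, hε, H⟩ := h.2 (1 - t) ⟨by linarith [ht.2], by linarith [ht.1]⟩
  refine ⟨ε, hε, fun s s' hs hs' => ?_⟩
  rw [H (1 - s) (1 - s') (by rw [← abs_neg]; ring_nf; ring_nf at hs; exact hs)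
    (by rw [← abs_neg]; ring_nf; ring_nf at hs'; exact hs')]
  rw [← abs_neg]; ring_nf

theorem dist_le (h : LocallyGeodesic e c) {s t : ℝ} (hs : 0 ≤ s) (hst : s ≤ t) (ht : t ≤ 1) :
    dist (e s) (e t) ≤ c * (t - s) := by
  rcases hst.eq_or_lt with rfl | hst
  · simp
  refine dist_le_of_locally hst (h.1.mono (Set.Icc_subset_Icc hs ht)) fun u hu => ?_
  obtain ⟨ε, hε, H⟩ := h.2 u ⟨by linarith [hu.1], by linarith [hu.2]⟩
  refine ⟨ε, hε, fun w hw => ?_⟩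
  have hw1 := hw.1
  rw [H u w (by simpa using hε) (by rw [abs_of_pos] <;> linarith [hw.2]), abs_sub_comm,
    abs_of_pos (by linarith)]

/-- In a ball that is isometric to a ball of the hyperbolic plane, a geodesic that starts at the
centre moves away with constant speed. -/
theorem chart (h : LocallyGeodesic e c) (hc : 0 < c) {P : UpperHalfPlane} {p : X} {r τ : ℝ}
    {Φ : UpperHalfPlane → X} {Ψ : X → UpperHalfPlane} (hch : IsChart P p r Φ Ψ) (h0 : e 0 = p)
    (hτ : τ ≤ 1) (hb : ∀ t ∈ Set.Ico 0 τ, dist p (e t) < r) :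
    (∀ t ∈ Set.Ico 0 τ, dist P (Ψ (e t)) = c * t) ∧
    ∀ s t, 0 ≤ s → s ≤ t → t < τ → dist (Ψ (e s)) (Ψ (e t)) ≤ c * (t - s) := by
  have hb' : ∀ t ∈ Set.Ico 0 τ, e t ∈ Metric.ball p r := fun t ht => by
    rw [Metric.mem_ball, dist_comm]; exact hb t ht
  have hcont : ContinuousOn (fun t => Ψ (e t)) (Set.Ico 0 τ) := fun t ht =>
    (hch.isometricAt' _ (hb' t ht)).continuousAt.comp_continuousWithinAt
      ((h.1.mono (Set.Ico_subset_Icc_self.trans (Set.Icc_subset_Icc_right hτ))) t ht)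
  have hloc : ∀ t ∈ Set.Ioo 0 τ, ∃ ε > 0, ∀ s s' : ℝ, |s - t| < ε → |s' - t| < ε →
      dist (Ψ (e s)) (Ψ (e s')) = c * |s - s'| := by
    intro t ht
    obtain ⟨ε, hε, H⟩ := h.2 t ⟨ht.1, ht.2.trans_le hτ⟩
    obtain ⟨U, hU, hU'⟩ := hch.isometricAt' _ (hb' t ⟨ht.1.le, ht.2⟩)
    have : ∀ᶠ s in 𝓝 t, e s ∈ U :=
      (h.1.continuousAt (Icc_mem_nhds ht.1 (ht.2.trans_le hτ))).eventually hU
    obtain ⟨ε', hε', H'⟩ := Metric.eventually_nhds_iff.1 this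
    refine ⟨min ε ε', lt_min hε hε', fun s s' hs hs' => ?_⟩
    rw [hU' _ (H' (by rw [Real.dist_eq]; exact hs.trans_le (min_le_right _ _)))
      _ (H' (by rw [Real.dist_eq]; exact hs'.trans_le (min_le_right _ _)))]
    exact H s s' (hs.trans_le (min_le_left _ _)) (hs'.trans_le (min_le_left _ _))
  constructor
  · intro t ht
    have h1 := dist_eq_of_locally_geodesic hc hcont hloc t ht
    have hr : 0 < r := dist_nonneg.trans_lt (hb t ht)
    simp only [h0, hch.center' hr] at h1
    exact h1
  · intro s t hs hst ht
    rcases hst.eq_or_lt with rfl | hst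
    · simp
    refine dist_le_of_locally (f := fun t => Ψ (e t)) hst
      (hcont.mono fun u hu => ⟨hs.trans hu.1, hu.2.trans_lt ht⟩) fun u hu => ?_
    obtain ⟨ε, hε, H⟩ := hloc u ⟨by linarith [hu.1], by linarith [hu.2]⟩
    refine ⟨ε, hε, fun w hw => ?_⟩
    have hw1 := hw.1
    rw [H u w (by simpa using hε) (by rw [abs_of_pos] <;> linarith [hw.2]), abs_sub_comm,
      abs_of_pos (by linarith)]

variable {P : UpperHalfPlane} {p : X} {r : ℝ} {Φ : UpperHalfPlane → X} {Ψ : X → UpperHalfPlane}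

theorem dist_eq (h : LocallyGeodesic e c) (hc : 0 < c) (hch : IsChart P p r Φ Ψ)
    (hd : ∀ q, dist P (Ψ q) = dist p q) (h0 : e 0 = p) (hr : 0 < r) (hrc : r ≤ c) {t : ℝ}
    (ht : t ∈ Set.Icc 0 (r / c)) : dist p (e t) = c * t := by
  have hτ : r / c ≤ 1 := (div_le_one hc).2 hrc
  have hτ0 : 0 < r / c := div_pos hr hc
  have key : Set.EqOn (fun t => dist p (e t)) (fun t => c * t) (Set.Ico 0 (r / c)) := by
    intro t ht
    have := (h.chart hc hch h0 hτ fun t ht => by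
      have h1 := h.dist_le le_rfl ht.1 (ht.2.le.trans hτ)
      rw [h0] at h1
      have := (lt_div_iff₀ hc).1 ht.2
      nlinarith).1 t ht
    rwa [hd] at this
  refine key.of_subset_closure (t := Set.Icc 0 (r / c)) ?_ (by fun_prop) Set.Ico_subset_Icc_self
    ?_ ht
  · exact (continuous_const.dist continuous_id).comp_continuousOn
      (h.1.mono (Set.Icc_subset_Icc_right hτ))
  · rw [closure_Ico hτ0.ne]

/-- A closed curve of speed `c < 2 r` would never leave the ball, where it moves away from `p` at
constant speed and cannot return. -/
theorem two_mul_le (h : LocallyGeodesic e c) (hc : 0 < c) (hch : IsChart P p r Φ Ψ)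
    (hd : ∀ q, dist P (Ψ q) = dist p q) (h0 : e 0 = p) (h1 : e 1 = p) : 2 * r ≤ c := by
  by_contra! hlt
  have hle : ∀ t, 0 ≤ t → t ≤ 1 → dist p (e t) ≤ c * t ∧ dist p (e t) ≤ c * (1 - t) := by
    intro t ht0 ht1
    have e1 := h.dist_le le_rfl ht0 ht1
    have e2 := h.dist_le ht0 ht1 le_rfl
    rw [h0] at e1
    rw [h1, dist_comm] at e2
    exact ⟨by linarith, e2⟩
  -- At time `3 / 4` (any time after `1 / 2` serves) the distance from `p` would be `3 c / 4`, but
  -- it is at most `c / 4`.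
  have e3 := (h.chart hc hch h0 le_rfl fun t ht => by
      obtain ⟨h2, h3⟩ := hle t ht.1 ht.2.le
      linarith).1 (3 / 4) ⟨by norm_num, by norm_num⟩
  rw [hd] at e3
  have := (hle (3 / 4) (by norm_num) (by norm_num)).2
  linarith

end LocallyGeodesic

theorem IsGeodesicLoop.locallyGeodesic {v : Fin 3} {p : Surface T} {γ : Path p p}
    (h : IsGeodesicLoop T v γ) : ∃ c, 0 < c ∧ LocallyGeodesic γ.extend c := by
  obtain ⟨-, -, -, c, hc, H⟩ := h
  refine ⟨c, hc, γ.continuous_extend.continuousOn, fun t ht => ?_⟩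
  obtain ⟨U, hU, hU'⟩ := H ⟨t, ht.1.le, ht.2.le⟩ ht.1 ht.2
  obtain ⟨u, hu, huU⟩ := mem_nhds_subtype _ _ _ |>.1 hU
  obtain ⟨ε, hε, hb⟩ := Metric.mem_nhds_iff.1
    (Filter.inter_mem hu (Icc_mem_nhds ht.1 ht.2))
  refine ⟨ε, hε, fun s s' hs hs' => ?_⟩
  rw [← Real.dist_eq] at hs hs'
  obtain ⟨hs1, hs2⟩ := hb hs
  obtain ⟨hs1', hs2'⟩ := hb hs'
  rw [γ.extend_apply hs2, γ.extend_apply hs2']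
  exact hU' ⟨s, hs2⟩ (huU hs1) ⟨s', hs2'⟩ (huU hs1')

section

variable {P : UpperHalfPlane} {p : Surface T} {r : ℝ} {Φ : UpperHalfPlane → Surface T}
  {Ψ : Surface T → UpperHalfPlane} {v : Fin 3} {γ : Path p p}

theorem IsGeodesicLoop.le_pathLength (h : IsGeodesicLoop T v γ) (hch : IsChart P p r Φ Ψ)
    (hd : ∀ q, dist P (Ψ q) = dist p q) (hr : 0 < r) : ENNReal.ofReal (2 * r) ≤ pathLength γ := by
  obtain ⟨c, hc, hg⟩ := h.locallyGeodesic
  have h2 := hg.two_mul_le hc hch hd (by simp) (by simp)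
  have ht : r / c ∈ Set.Icc (0 : ℝ) 1 := ⟨(div_pos hr hc).le, (div_le_one hc).2 (by linarith)⟩
  have h3 := hg.dist_eq hc hch hd (by simp) hr (by linarith) (t := r / c) ⟨ht.1, le_rfl⟩
  rw [mul_div_cancel₀ _ hc.ne', γ.extend_apply ht] at h3
  refine le_trans (le_of_eq ?_) (ofReal_le_pathLength γ (le_refl ⟨r / c, ht⟩))
  rw [dist_self, dist_comm _ p, h3]
  ring_nf

/-- The speed `c` is at least `2 r`. If it were larger, the points at the times `r / c` and `1 - r /
c` would both be at distance `r` from `p`; the length `2 r` leaves nothing between them, so they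
coincide, contrary to simplicity. -/
theorem IsGeodesicLoop.speed (h : IsGeodesicLoop T v γ) (hch : IsChart P p r Φ Ψ)
    (hd : ∀ q, dist P (Ψ q) = dist p q) (hr : 0 < r)
    (hl : pathLength γ = ENNReal.ofReal (2 * r)) : LocallyGeodesic γ.extend (2 * r) := by
  obtain ⟨c, hc, hg⟩ := h.locallyGeodesic
  have h2 := hg.two_mul_le hc hch hd (by simp) (by simp)
  rcases h2.eq_or_lt with rfl | h2
  · exact hg
  exfalso
  have ht : r / c ∈ Set.Icc (0 : ℝ) 1 := ⟨(div_pos hr hc).le, (div_le_one hc).2 (by linarith)⟩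
  have hlt : r / c < 1 / 2 := by rw [div_lt_iff₀ hc]; linarith
  have ht' : 1 - r / c ∈ Set.Icc (0 : ℝ) 1 := ⟨by linarith [ht.2], by linarith [ht.1]⟩
  have h3 := hg.dist_eq hc hch hd (by simp) hr (by linarith) (t := r / c) ⟨ht.1, le_rfl⟩
  have h4 := hg.reverse.dist_eq hc hch hd (by simp) hr (by linarith) (t := r / c) ⟨ht.1, le_rfl⟩
  rw [mul_div_cancel₀ _ hc.ne', γ.extend_apply ht] at h3
  rw [mul_div_cancel₀ _ hc.ne', γ.extend_apply ht'] at h4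
  have h5 := ofReal_le_pathLength γ (s := ⟨r / c, ht⟩) (t := ⟨1 - r / c, ht'⟩)
    (Subtype.mk_le_mk.2 (by linarith))
  rw [hl, dist_comm _ p, h3, h4, ENNReal.ofReal_le_ofReal_iff (by linarith)] at h5
  have h6 : γ ⟨r / c, ht⟩ = γ ⟨1 - r / c, ht'⟩ :=
    dist_le_zero.1 (by linarith)
  rcases h.1 _ _ h6 with h7 | ⟨h7, -⟩ | ⟨h7, -⟩
  · have := congrArg Subtype.val h7
    simp only at this
    linarith
  · have := congrArg Subtype.val h7
    simp only [Set.Icc.coe_zero] at this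
    have := div_pos hr hc
    linarith
  · have := congrArg Subtype.val h7
    simp only [Set.Icc.coe_one] at this
    linarith

end

end

section

variable {θ : Fin 3 → ℝ} {T : HypTriangle θ}

open HypTriangle

/-! ### The initial half of a shortest loop -/

theorem eq_geo_of_between {P z Q : UpperHalfPlane} {t : ℝ} (ht : t ∈ Set.Icc (0 : ℝ) 1)
    (h1 : dist P z = t * dist P Q) (h2 : dist z Q = (1 - t) * dist P Q) : z = geo P Q t := by
  rcases eq_or_ne P Q with rfl | hPQ
  · rw [dist_self, mul_zero] at h1
    have h3 := dist_left_geo P P ht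
    rw [dist_self, mul_zero] at h3
    rw [← dist_eq_zero.1 h1, ← dist_eq_zero.1 h3]
  · apply vec_injective
    have e1 := sinh_smul_vec_of_between h1 h2 (by ring)
    have e2 := sinh_smul_vec_of_between (dist_left_geo P Q ht) (dist_geo_right P Q ht) (by ring)
    rw [← e2] at e1
    refine smul_right_injective _ ?_ e1
    rw [show t * dist P Q + (1 - t) * dist P Q = dist P Q by ring]
    exact (Real.sinh_pos_iff.2 (dist_pos.2 hPQ)).ne'

/-- Geodesics do not branch. -/
theorem eq_of_between {P z x y : UpperHalfPlane} {a b : ℝ} (ha : 0 < a) (h : dist P z = a)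
    (hx : dist z x = b) (hy : dist z y = b) (hPx : dist P x = a + b) (hPy : dist P y = a + b) :
    x = y := by
  have e1 := sinh_smul_vec_of_between h hx hPx
  rw [sinh_smul_vec_of_between h hy hPy, add_right_inj] at e1
  exact vec_injective (smul_right_injective _ (Real.sinh_pos_iff.2 ha).ne' e1.symm)

theorem geo_between (P Q : UpperHalfPlane) {s t u : ℝ} (hs : 0 ≤ s) (hst : s ≤ t) (htu : t ≤ u)
    (hu : u ≤ 1) :
    dist (geo P Q s) (geo P Q t) + dist (geo P Q t) (geo P Q u) =
      dist (geo P Q s) (geo P Q u) := by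
  have key : ∀ {a b : ℝ}, 0 ≤ a → a ≤ b → b ≤ 1 →
      dist (geo P Q a) (geo P Q b) = dist P Q * (b - a) := fun ha hab hb => by
    rw [dist_geo P Q ⟨ha, by linarith⟩ ⟨by linarith, hb⟩, abs_sub_comm,
      abs_of_nonneg (by linarith)]
  rw [key hs hst (by linarith), key (by linarith) htu hu, key hs (by linarith) hu]
  ring

theorem continuousOn_fold_geo (hc : ∀ i, 0 ≤ Real.cos (θ i)) {j : Fin 3} {P Q : UpperHalfPlane}
    (hP : P ∈ T.wedge j) (hQ : Q ∈ T.wedge j) (b : Bool) :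
    ContinuousOn (fun t => fold T b (geo P Q t)) (Set.Icc 0 1) := by
  have : LipschitzOnWith (Real.toNNReal (dist P Q)) (fun t => fold T b (geo P Q t))
      (Set.Icc 0 1) := by
    refine LipschitzOnWith.of_dist_le_mul fun s hs t ht => ?_
    rw [Real.coe_toNNReal _ dist_nonneg, Real.dist_eq, ← dist_geo P Q hs ht]
    exact dist_fold_le hc (geo_mem_wedge hc hP hQ hs) (geo_mem_wedge hc hP hQ ht)
  exact this.continuousOn

/-- Up to time `1 / 2` the curve is in the open ball and lifts to a radius of the disk. The end of
the radius lies outside the chart; it is found by compactness in the closed union of the wedges,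
where folding still makes sense. -/
theorem LocallyGeodesic.exists_geo {e : ℝ → Surface T} {P : UpperHalfPlane} {r : ℝ} {b : Bool}
    (hg : LocallyGeodesic e (2 * r)) (hc : ∀ i, 0 ≤ Real.cos (θ i)) (hP : P ∈ T.region)
    (hsep : Separated T P r) (hr : 0 < r) (h0 : e 0 = copy T b P) :
    ∃ x j, x ∈ T.wedge j ∧ dist P x = r ∧
      ∀ t ∈ Set.Icc (0 : ℝ) (1 / 2), e t = fold T b (geo P x (2 * t)) := by
  obtain ⟨Ψ, hch, hd⟩ := hsep.exists_isChart hc hP b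
  have hb : ∀ t ∈ Set.Ico (0 : ℝ) (1 / 2), dist (copy T b P) (e t) < r := fun t ht => by
    have := hg.dist_le le_rfl ht.1 (by linarith [ht.2])
    rw [h0] at this
    nlinarith [ht.2]
  obtain ⟨h1, h2⟩ := hg.chart (by linarith) hch h0 (by norm_num) hb
  set S : Set UpperHalfPlane := Metric.closedBall P r ∩ ⋃ j, T.wedge j with hS
  have hSc : IsCompact S :=
    (isCompact_closedBall P r).inter_right (isClosed_iUnion_of_finite fun j => isClosed_wedge T j)
  set u : ℕ → ℝ := fun n => 1 / 2 - 1 / 2 * (1 / ((n : ℝ) + 1)) with hu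
  have hu1 : ∀ n, u n ∈ Set.Ico (0 : ℝ) (1 / 2) := fun n => by
    have h3 : 0 < 1 / ((n : ℝ) + 1) := by positivity
    have h4 : 1 / ((n : ℝ) + 1) ≤ 1 := by
      rw [div_le_one (by positivity)]
      linarith [n.cast_nonneg (α := ℝ)]
    constructor <;> simp only [hu] <;> linarith
  have hu2 : Filter.Tendsto u Filter.atTop (𝓝 (1 / 2)) := by
    have := (tendsto_one_div_add_atTop_nhds_zero_nat (𝕜 := ℝ)).const_mul (1 / 2)
    simpa only [mul_zero, sub_zero] using this.const_sub (1 / 2)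
  have huS : ∀ n, Ψ (e (u n)) ∈ S := fun n => by
    have h3 := hb _ (hu1 n)
    rw [← hd] at h3
    exact ⟨by rw [Metric.mem_closedBall, dist_comm]; exact h3.le,
      Set.mem_iUnion.2 (hsep.exists_mem_wedge hc hP h3)⟩
  obtain ⟨x, hxS, φ, hφ, hlim⟩ := hSc.tendsto_subseq huS
  obtain ⟨j, hj⟩ := Set.mem_iUnion.1 hxS.2
  have hu3 := hu2.comp hφ.tendsto_atTop
  have hPx : dist P x = r := by
    refine tendsto_nhds_unique (tendsto_const_nhds.dist hlim) ?_
    have : Filter.Tendsto (fun n => 2 * r * u (φ n)) Filter.atTop (𝓝 (2 * r * (1 / 2))) :=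
      hu3.const_mul _
    rw [show 2 * r * (1 / 2) = r by ring] at this
    exact this.congr fun n => (h1 _ (hu1 _)).symm
  have key : Set.EqOn e (fun t => fold T b (geo P x (2 * t))) (Set.Ico 0 (1 / 2)) := by
    intro t ht
    have h3 : dist (Ψ (e t)) x ≤ 2 * r * (1 / 2 - t) := by
      refine le_of_tendsto_of_tendsto (tendsto_const_nhds.dist hlim)
        ((hu3.sub_const t).const_mul (2 * r)) ?_
      filter_upwards [hu3.eventually (lt_mem_nhds ht.2)] with n hn
      exact h2 _ _ ht.1 (le_of_lt hn) (hu1 _).2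
    have h4 := h1 t ht
    have h5 := dist_triangle P (Ψ (e t)) x
    have h6 : Ψ (e t) = geo P x (2 * t) := by
      refine eq_geo_of_between ⟨by linarith [ht.1], by linarith [ht.2]⟩ ?_ ?_
      · rw [h4, hPx]; ring
      · rw [hPx]; rw [hPx] at h5; linarith
    simp only [← h6]
    refine (hch.right_inv _ ?_).symm
    rw [Metric.mem_ball, dist_comm]
    exact hb t ht
  refine ⟨x, j, hj, hPx, fun t ht => ?_⟩
  refine key.of_subset_closure (hg.1.mono (Set.Icc_subset_Icc_right (by norm_num))) ?_
    Set.Ico_subset_Icc_self (by rw [closure_Ico (by norm_num)]) ht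
  exact (continuousOn_fold_geo hc (Or.inl hP) hj b).comp (f := fun t : ℝ => 2 * t) (by fun_prop)
    fun t ht => ⟨by linarith [ht.1], by linarith [ht.2]⟩

/-! ### The loop around a vertex -/

/-- The loop around a vertex, as the image of the segment between the mirror images of `P` in the
sides at this vertex. -/
def bigon (T : HypTriangle θ) (b : Bool) (P : UpperHalfPlane) (j k : Fin 3) (t : ℝ) : Surface T :=
  fold T (!b) (geo (T.R j P) (T.R k P) t)

theorem geo_symm (P Q : UpperHalfPlane) {t : ℝ} (ht : t ∈ Set.Icc (0 : ℝ) 1) :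
    geo P Q t = geo Q P (1 - t) := by
  refine eq_geo_of_between ⟨by linarith [ht.2], by linarith [ht.1]⟩ ?_ ?_
  · rw [dist_comm, dist_geo_right P Q ht, dist_comm Q]
  · rw [dist_comm, dist_left_geo P Q ht, dist_comm Q]; ring

theorem bigon_symm (b : Bool) (P : UpperHalfPlane) (j k : Fin 3) {t : ℝ}
    (ht : t ∈ Set.Icc (0 : ℝ) 1) : bigon T b P j k t = bigon T b P k j (1 - t) := by
  rw [bigon, bigon, geo_symm _ _ ht]

section Bigon

variable {P : UpperHalfPlane} {j k : Fin 3}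

theorem geo_R_mem_wedge (hP : P ∈ T.region) (hc : ∀ i, 0 ≤ Real.cos (θ i))
    (hM : geo (T.R j P) (T.R k P) (1 / 2) ∈ T.region) {t : ℝ} (ht : t ∈ Set.Icc (0 : ℝ) (1 / 2)) :
    geo (T.R j P) (T.R k P) t ∈ T.wedge j := by
  have h := geo_between (T.R j P) (T.R k P) (s := 0) le_rfl ht.1 ht.2 (by norm_num)
  rw [geo_zero] at h
  exact mem_wedge_of_between hc h (R_mem_wedge (Or.inl hP)) (Or.inl hM)

/-- Reflecting the first half of the segment in the side `j` turns it into a radius from `P`. -/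
theorem bigon_eq (hP : P ∈ T.region) (hc : ∀ i, 0 ≤ Real.cos (θ i))
    (hM : geo (T.R j P) (T.R k P) (1 / 2) ∈ T.region) {t : ℝ} (ht : t ∈ Set.Icc (0 : ℝ) (1 / 2))
    (b : Bool) : bigon T b P j k t = fold T b (T.R j (geo (T.R j P) (T.R k P) t)) :=
  (fold_R hc (geo_R_mem_wedge hP hc hM ht)).symm

theorem bigon_zero (hP : P ∈ T.region) (hc : ∀ i, 0 ≤ Real.cos (θ i))
    (hM : geo (T.R j P) (T.R k P) (1 / 2) ∈ T.region) (b : Bool) :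
    bigon T b P j k 0 = copy T b P := by
  rw [bigon_eq hP hc hM (by norm_num), geo_zero, R_R, fold_of_mem hP]

theorem bigon_one (hP : P ∈ T.region) (hc : ∀ i, 0 ≤ Real.cos (θ i))
    (hM : geo (T.R j P) (T.R k P) (1 / 2) ∈ T.region) (b : Bool) :
    bigon T b P j k 1 = copy T b P := by
  rw [geo_symm _ _ (by norm_num)] at hM
  norm_num at hM
  rw [bigon_symm _ _ _ _ (by norm_num), sub_self, bigon_zero hP hc (by norm_num; exact hM)]

/-- The first half of the loop crosses a side. -/
theorem bigon_crossing (hP : P ∈ T.region) (hc : ∀ i, 0 ≤ Real.cos (θ i))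
    (hM : geo (T.R j P) (T.R k P) (1 / 2) ∈ T.region) (b : Bool) :
    ∃ s ∈ Set.Icc (0 : ℝ) (1 / 2),
      (∀ t ∈ Set.Icc 0 s, ∃ z ∈ T.region, bigon T b P j k t = copy T b z) ∧
      (∀ t ∈ Set.Icc s (1 / 2), ∃ z ∈ T.region, bigon T b P j k t = copy T (!b) z) ∧
      ∃ z ∈ T.region, T.x j z = 0 ∧ bigon T b P j k s = copy T b z := by
  set Y := geo (T.R j P) (T.R k P) with hY
  have hcont : ContinuousOn (fun t => T.x j (Y t)) (Set.Icc 0 (1 / 2)) :=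
    (T.continuous_x j).comp_continuousOn
      ((continuousOn_geo _ _).mono (Set.Icc_subset_Icc_right (by norm_num)))
  have h0 : T.x j (Y 0) ≤ 0 := by
    rw [hY, geo_zero, x_R_self]
    linarith [T.mem_region_iff.1 hP j]
  obtain ⟨s, hs, hs0⟩ := intermediate_value_Icc (by norm_num) hcont
    ⟨h0, T.mem_region_iff.1 hM j⟩
  have hRs : T.R j (Y s) = Y s := T.R_eq_self hs0
  have hYs : Y s ∈ T.region := by
    rcases geo_R_mem_wedge hP hc hM hs with h | h
    · exact h
    · rwa [← hY, hRs] at h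
  have hfirst : ∀ t ∈ Set.Icc 0 s, T.R j (Y t) ∈ T.region := by
    intro t ht
    have h := geo_between (T.R j P) (T.R k P) (s := 0) le_rfl ht.1 ht.2 (by linarith [hs.2])
    rw [geo_zero, ← hY] at h
    refine mem_region_of_between (P := P) (Q := Y s) ?_ hP hYs
    rw [← T.dist_R_comm, T.dist_R_comm j (Y t), hRs, h, T.dist_R_comm, hRs]
  refine ⟨s, hs, fun t ht => ⟨_, hfirst t ht, ?_⟩, fun t ht => ⟨Y t, ?_, ?_⟩, Y s, hYs, hs0, ?_⟩
  · rw [bigon_eq hP hc hM ⟨ht.1, ht.2.trans hs.2⟩, fold_of_mem (hfirst t ht)]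
  · exact mem_region_of_between (geo_between _ _ hs.1 ht.1 ht.2 (by norm_num)) hYs hM
  · exact fold_of_mem (mem_region_of_between (geo_between _ _ hs.1 ht.1 ht.2 (by norm_num)) hYs hM)
  · rw [bigon_eq hP hc hM hs, ← hY, hRs, fold_of_mem hYs]

end Bigon

end

section

variable {θ : Fin 3 → ℝ} {T : HypTriangle θ}

open HypTriangle

/-! ### Geodesic loops of minimal length -/

theorem copy_mem_singularSet_iff {b : Bool} {z : UpperHalfPlane} (hz : z ∈ T.region) :
    copy T b z ∈ singularSet T ↔ ∃ v, ∀ i, i ≠ v → T.x i z = 0 := by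
  simp only [singularSet, conePoint, Set.mem_iUnion, Set.mem_image, Set.mem_ofPred_eq]
  refine exists_congr fun v => ⟨?_, fun h => ?_⟩
  · rintro ⟨w, hw, h⟩
    rw [← copy_true w.2] at h
    have hw' : ∀ i, i ≠ v → T.x i w = 0 := fun i hi =>
      ((T.side i).eval_eq_zero_iff w).1 (hw i hi)
    have : (w : UpperHalfPlane) = z := by
      cases b
      · exact (copy_eq_copy_not w.2 hz h).1
      · exact copy_injective w.2 hz h
    rwa [← this]
  · refine ⟨⟨z, hz⟩, fun i hi => ((T.side i).eval_eq_zero_iff z).2 (h i hi), ?_⟩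
    rw [← copy_true hz]
    obtain ⟨i, hi⟩ := exists_ne v
    exact copy_eq_of_boundary hz (h i hi) _ _

theorem copy_mem_sideSet_iff {b : Bool} {z : UpperHalfPlane} (hz : z ∈ T.region) {i : Fin 3} :
    copy T b z ∈ sideSet T i ↔ T.x i z = 0 := by
  simp only [sideSet, Set.mem_image, Set.mem_ofPred_eq]
  constructor
  · rintro ⟨w, hw, h⟩
    rw [← copy_true w.2] at h
    have : (w : UpperHalfPlane) = z := by
      cases b
      · exact (copy_eq_copy_not w.2 hz h).1
      · exact copy_injective w.2 hz h
    rw [← this]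
    exact ((T.side i).eval_eq_zero_iff w).1 hw
  · intro h
    refine ⟨⟨z, hz⟩, ((T.side i).eval_eq_zero_iff z).2 h, ?_⟩
    rw [← copy_true hz]
    exact copy_eq_of_boundary hz h _ _

section Bigon

variable {P : UpperHalfPlane} {r : ℝ} {j k : Fin 3}

theorem R_geo_eq (hd : dist (T.R j P) (T.R k P) = 2 * r) {x : UpperHalfPlane} (hx : dist P x = r)
    (h : T.R j x = geo (T.R j P) (T.R k P) (1 / 2)) {t : ℝ} (ht : t ∈ Set.Icc (0 : ℝ) (1 / 2)) :
    T.R j (geo P x (2 * t)) = geo (T.R j P) (T.R k P) t := by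
  have ht' : 2 * t ∈ Set.Icc (0 : ℝ) 1 := ⟨by linarith [ht.1], by linarith [ht.2]⟩
  have h1 : dist (T.R j P) (T.R j (geo P x (2 * t))) = t * (2 * r) := by
    rw [dist_R_R, dist_left_geo P x ht', hx]; ring
  have h2 : dist (T.R j (geo P x (2 * t))) (T.R j x) = (1 - 2 * t) * r := by
    rw [dist_R_R, dist_geo_right P x ht', hx]
  have h3 := dist_geo_right (T.R j P) (T.R k P) (t := 1 / 2) (by norm_num)
  rw [← h, hd] at h3
  have h4 := dist_triangle (T.R j (geo P x (2 * t))) (T.R j x) (T.R k P)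
  have h5 := dist_triangle (T.R j P) (T.R j (geo P x (2 * t))) (T.R k P)
  refine eq_geo_of_between ⟨ht.1, by linarith [ht.2]⟩ (by rw [h1, hd]) ?_
  rw [hd] at h5 ⊢
  linarith

/-- Rigidity: the loop and its reverse both start with radii, with ends `x` and `x'` over the same
point. Simplicity gives `x ≠ x'`, so `R j x = R k x'` for some `j ≠ k`, and this point is the
midpoint of the segment from `R j P` to `R k P`. -/
theorem IsGeodesicLoop.exists_bigon (hc : ∀ i, 0 ≤ Real.cos (θ i)) (hsep : Separated T P r)
    (hP : P ∈ T.region) (hr : 0 < r) {b : Bool} {v : Fin 3} {γ : Path (copy T b P) (copy T b P)}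
    (h : IsGeodesicLoop T v γ) (hl : pathLength γ = ENNReal.ofReal (2 * r)) :
    ∃ j k, j ≠ k ∧ dist (T.R j P) (T.R k P) = 2 * r ∧
      geo (T.R j P) (T.R k P) (1 / 2) ∈ T.region ∧ ∀ t : I, γ t = bigon T b P j k t := by
  obtain ⟨Ψ, hch, hΨ⟩ := hsep.exists_isChart hc hP b
  have hg := h.speed hch hΨ hr hl
  obtain ⟨x, j', hj', hx, hxe⟩ := hg.exists_geo (b := b) hc hP hsep hr (by simp)
  obtain ⟨x', k', hk', hx', hxe'⟩ := hg.reverse.exists_geo (b := b) hc hP hsep hr (by simp)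
  have hne : x ≠ x' := by
    rintro rfl
    have h1 := hxe (1 / 4) (by norm_num)
    rw [← hxe' (1 / 4) (by norm_num), γ.extend_apply (by norm_num),
      γ.extend_apply (by norm_num)] at h1
    have h2 := h.1 _ _ h1
    simp only [Subtype.ext_iff, Set.Icc.coe_zero, Set.Icc.coe_one] at h2
    norm_num at h2
  have hf : fold T b x = fold T b x' := by
    have h1 := hxe (1 / 2) (by norm_num)
    have h2 := hxe' (1 / 2) (by norm_num)
    norm_num [geo_one] at h1 h2
    rw [← h1, ← h2]
  obtain ⟨j, k, hjk, hy, hyT⟩ := (fold_eq_fold hc hj' hk' hf).resolve_left hne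
  have h1 : dist (T.R j P) (T.R j x) = r := by rw [dist_R_R, hx]
  have h2 : dist (T.R j x) (T.R k P) = r := by rw [hy, dist_R_R, dist_comm, hx']
  have hd : dist (T.R j P) (T.R k P) = 2 * r :=
    le_antisymm (by linarith [dist_triangle (T.R j P) (T.R j x) (T.R k P)]) (hsep j k hjk)
  have hM : T.R j x = geo (T.R j P) (T.R k P) (1 / 2) :=
    eq_geo_of_between (by norm_num) (by rw [h1, hd]; ring) (by rw [h2, hd]; ring)
  have hMT := hM ▸ hyT
  refine ⟨j, k, hjk, hd, hMT, fun t => ?_⟩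
  rw [← γ.extend_extends']
  rcases le_total (t : ℝ) (1 / 2) with ht | ht
  · have ht' : (t : ℝ) ∈ Set.Icc (0 : ℝ) (1 / 2) := ⟨t.2.1, ht⟩
    rw [hxe t ht', bigon_eq hP hc hMT ht', ← R_geo_eq hd hx hM ht', R_R]
  · have ht' : 1 - (t : ℝ) ∈ Set.Icc (0 : ℝ) (1 / 2) := ⟨by linarith [t.2.2], by linarith⟩
    have h3 := hxe' _ ht'
    have hM' : T.R k x' = geo (T.R k P) (T.R j P) (1 / 2) := by
      rw [geo_symm _ _ (by norm_num), ← hy, hM]; norm_num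
    rw [sub_sub_cancel] at h3
    rw [h3, bigon_symm _ _ _ _ t.2, bigon_eq hP hc (by rwa [← hM', ← hy]) ht',
      ← R_geo_eq (by rw [dist_comm, hd]) hx' hM' ht', R_R]

/-- Folding is known to be contracting on one wedge at a time; the halves lie in the wedges of `j`
and of `k`, so the estimate is split at the midpoint. -/
theorem dist_bigon_le (hc : ∀ i, 0 ≤ Real.cos (θ i)) (hP : P ∈ T.region)
    (hd : dist (T.R j P) (T.R k P) = 2 * r)
    (hM : geo (T.R j P) (T.R k P) (1 / 2) ∈ T.region) (b : Bool) {s t : ℝ}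
    (hs : s ∈ Set.Icc (0 : ℝ) 1) (ht : t ∈ Set.Icc (0 : ℝ) 1) :
    dist (bigon T b P j k s) (bigon T b P j k t) ≤ 2 * r * |s - t| := by
  have hM' : geo (T.R k P) (T.R j P) (1 / 2) ∈ T.region := by
    rw [geo_symm _ _ (by norm_num)]; norm_num; norm_num at hM; exact hM
  have left : ∀ {s t : ℝ}, s ∈ Set.Icc (0 : ℝ) (1 / 2) → t ∈ Set.Icc (0 : ℝ) (1 / 2) →
      dist (bigon T b P j k s) (bigon T b P j k t) ≤ 2 * r * |s - t| := fun {s t} hs ht => by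
    rw [← hd, ← dist_geo _ _ ⟨hs.1, by linarith [hs.2]⟩ ⟨ht.1, by linarith [ht.2]⟩]
    exact dist_fold_le hc (geo_R_mem_wedge hP hc hM hs) (geo_R_mem_wedge hP hc hM ht)
  have right : ∀ {s t : ℝ}, s ∈ Set.Icc (1 / 2 : ℝ) 1 → t ∈ Set.Icc (1 / 2 : ℝ) 1 →
      dist (bigon T b P j k s) (bigon T b P j k t) ≤ 2 * r * |s - t| := fun {s t} hs ht => by
    have hs' : s ∈ Set.Icc (0 : ℝ) 1 := ⟨by linarith [hs.1], hs.2⟩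
    have ht' : t ∈ Set.Icc (0 : ℝ) 1 := ⟨by linarith [ht.1], ht.2⟩
    rw [← hd, ← dist_geo _ _ hs' ht']
    rw [bigon, bigon, geo_symm _ _ hs', geo_symm _ _ ht']
    exact dist_fold_le hc (geo_R_mem_wedge hP hc hM' ⟨by linarith [hs.2], by linarith [hs.1]⟩)
      (geo_R_mem_wedge hP hc hM' ⟨by linarith [ht.2], by linarith [ht.1]⟩)
  wlog hst : s ≤ t generalizing s t
  · rw [dist_comm, abs_sub_comm]
    exact this ht hs (le_of_not_ge hst)
  rcases le_total t (1 / 2) with h1 | h1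
  · exact left ⟨hs.1, by linarith⟩ ⟨ht.1, h1⟩
  rcases le_total s (1 / 2) with h2 | h2
  · have e1 := left (s := s) (t := 1 / 2) ⟨hs.1, h2⟩ (by norm_num)
    have e2 := right (s := 1 / 2) (t := t) (by norm_num) ⟨h1, ht.2⟩
    rw [abs_sub_comm, abs_of_nonneg (by linarith)] at e1 e2 ⊢
    linarith [dist_triangle (bigon T b P j k s) (bigon T b P j k (1 / 2)) (bigon T b P j k t)]
  · exact right ⟨h2, hs.2⟩ ⟨h1, ht.2⟩

theorem continuousOn_bigon (hc : ∀ i, 0 ≤ Real.cos (θ i)) (hP : P ∈ T.region)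
    (hM : geo (T.R j P) (T.R k P) (1 / 2) ∈ T.region) (b : Bool) :
    ContinuousOn (bigon T b P j k) (Set.Icc 0 1) := by
  have : LipschitzOnWith (Real.toNNReal (dist (T.R j P) (T.R k P))) (bigon T b P j k)
      (Set.Icc 0 1) := by
    refine LipschitzOnWith.of_dist_le_mul fun s hs t ht => ?_
    rw [Real.coe_toNNReal _ dist_nonneg, Real.dist_eq]
    exact (dist_bigon_le (r := dist (T.R j P) (T.R k P) / 2) hc hP (by ring) hM b hs ht).trans_eq
      (by ring)
  exact this.continuousOn

/-- The loop around a vertex as a path. -/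
def bigonPath (hc : ∀ i, 0 ≤ Real.cos (θ i)) (hP : P ∈ T.region)
    (hM : geo (T.R j P) (T.R k P) (1 / 2) ∈ T.region) (b : Bool) :
    Path (copy T b P) (copy T b P) where
  toFun t := bigon T b P j k t
  continuous_toFun := (continuousOn_bigon hc hP hM b).comp_continuous continuous_subtype_val
    fun t => t.2
  source' := bigon_zero hP hc hM b
  target' := bigon_one hP hc hM b

theorem pathLength_bigonPath_le (hc : ∀ i, 0 ≤ Real.cos (θ i)) (hP : P ∈ T.region) (hr : 0 < r)
    (hd : dist (T.R j P) (T.R k P) = 2 * r)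
    (hM : geo (T.R j P) (T.R k P) (1 / 2) ∈ T.region) (b : Bool) :
    pathLength (bigonPath hc hP hM b) ≤ ENNReal.ofReal (2 * r) :=
  pathLength_le _ (by linarith) fun s t => dist_bigon_le hc hP hd hM b s.2 t.2

/-- Away from the midpoint of the loop, the loop is the image under a chart of a segment. -/
theorem exists_bigon_eq_fold (hc : ∀ i, 0 ≤ Real.cos (θ i)) (hP : P ∈ T.region)
    (hd : dist (T.R j P) (T.R k P) = 2 * r) (hM : geo (T.R j P) (T.R k P) (1 / 2) ∈ T.region)
    (b : Bool) {t : ℝ} (ht : t ∈ Set.Icc (0 : ℝ) 1) :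
    ∃ z i, z ∈ T.wedge i ∧ bigon T b P j k t = fold T b z ∧ dist P z = 2 * r * min t (1 - t) ∧
      ((t ≤ 1 / 2 ∧ z = T.R j (geo (T.R j P) (T.R k P) t)) ∨
        1 / 2 ≤ t ∧ z = T.R k (geo (T.R j P) (T.R k P) t)) := by
  rcases le_total t (1 / 2) with h | h
  · refine ⟨_, j, R_mem_wedge (geo_R_mem_wedge hP hc hM ⟨ht.1, h⟩), bigon_eq hP hc hM ⟨ht.1, h⟩ b,
      ?_, Or.inl ⟨h, rfl⟩⟩
    rw [← dist_R_comm, dist_left_geo _ _ ht, hd, min_eq_left (by linarith)]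
    ring
  · have hM' : geo (T.R k P) (T.R j P) (1 / 2) ∈ T.region := by
      rw [geo_symm _ _ (by norm_num)]; norm_num; norm_num at hM; exact hM
    have ht' : 1 - t ∈ Set.Icc (0 : ℝ) (1 / 2) := ⟨by linarith [ht.2], by linarith⟩
    refine ⟨_, k, R_mem_wedge (geo_R_mem_wedge hP hc hM' ht'), ?_, ?_, Or.inr ⟨h, ?_⟩⟩
    · rw [bigon_symm _ _ _ _ ht, bigon_eq hP hc hM' ht' b]
    · rw [← dist_R_comm, dist_left_geo _ _ ⟨ht'.1, by linarith [ht'.2]⟩, dist_comm, hd,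
        min_eq_right (by linarith)]
      ring
    · rw [geo_symm _ _ ht]

/-- The vertex is fixed by two of the reflections, so it is as far from the two mirror images as
from `P`. -/
theorem le_dist_of_vertex (hsep : Separated T P r) {V : UpperHalfPlane} {v : Fin 3}
    (hv : ∀ i, i ≠ v → T.x i V = 0) : r ≤ dist P V := by
  obtain ⟨a, b, hab, ha, hb⟩ : ∃ a b : Fin 3, a ≠ b ∧ a ≠ v ∧ b ≠ v := by
    fin_cases v
    exacts [⟨1, 2, by decide⟩, ⟨0, 2, by decide⟩, ⟨0, 1, by decide⟩]
  have h1 := hsep a b hab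
  have h2 := dist_triangle_right (T.R a P) (T.R b P) V
  rw [T.dist_R_comm a P V, T.dist_R_comm b P V, T.R_eq_self (hv a ha), T.R_eq_self (hv b hb)] at h2
  linarith

theorem bigon_notMem_singularSet (hc : ∀ i, 0 ≤ Real.cos (θ i)) (hP : P ∈ T.region)
    (hsep : Separated T P r) (hr : 0 < r) (hd : dist (T.R j P) (T.R k P) = 2 * r)
    (hM : geo (T.R j P) (T.R k P) (1 / 2) ∈ T.region)
    (hpos : ∀ i, 0 < T.x i (geo (T.R j P) (T.R k P) (1 / 2))) (b : Bool) {t : ℝ}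
    (ht : t ∈ Set.Icc (0 : ℝ) 1) : bigon T b P j k t ∉ singularSet T := by
  rcases eq_or_ne t (1 / 2) with rfl | hne
  · rw [bigon, fold_of_mem hM, copy_mem_singularSet_iff hM]
    rintro ⟨v, hv⟩
    obtain ⟨i, hi⟩ := exists_ne v
    exact (hpos i).ne' (hv i hi)
  · obtain ⟨z, i, hz, h1, h2, -⟩ := exists_bigon_eq_fold hc hP hd hM b ht
    have hlt : dist P z < r := by
      rw [h2]
      have : min t (1 - t) < 1 / 2 := by
        rcases lt_or_gt_of_ne hne with h | h
        · exact (min_le_left _ _).trans_lt h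
        · exact (min_le_right _ _).trans_lt (by linarith)
      nlinarith
    have h3 := (dist_copy_fold_le hc hP hz b).trans_lt hlt
    rw [← h1] at h3
    intro hs
    obtain ⟨b', V, hV, hV'⟩ := exists_eq_copy (bigon T b P j k t)
    rw [hV', copy_mem_singularSet_iff hV] at hs
    obtain ⟨v, hv⟩ := hs
    obtain ⟨a, ha⟩ := exists_ne v
    rw [hV', copy_eq_of_boundary hV (hv a ha) b' b, dist_copy_self hP hV] at h3
    exact absurd (le_dist_of_vertex hsep hv) (not_le.2 h3)

/-- A coincidence has equal lifts, so the two times are symmetric about `1 / 2`. If they are not the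
end times, the two lifted radii share a point other than `P`, hence agree up to their ends, so `R j
M = R k M`. This is impossible for an interior point `M`. -/
theorem bigon_simple (hc : ∀ i, 0 ≤ Real.cos (θ i)) (hP : P ∈ T.region)
    (hsep : Separated T P r) (hr : 0 < r) (hjk : j ≠ k) (hd : dist (T.R j P) (T.R k P) = 2 * r)
    (hM : geo (T.R j P) (T.R k P) (1 / 2) ∈ T.region)
    (hpos : ∀ i, 0 < T.x i (geo (T.R j P) (T.R k P) (1 / 2))) (b : Bool) {s t : ℝ}
    (hs : s ∈ Set.Icc (0 : ℝ) 1) (ht : t ∈ Set.Icc (0 : ℝ) 1) (hst : s < t)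
    (h : bigon T b P j k s = bigon T b P j k t) : s = 0 ∧ t = 1 := by
  set M := geo (T.R j P) (T.R k P) (1 / 2) with hMdef
  obtain ⟨z, i, hz, hz1, hz2, hz3⟩ := exists_bigon_eq_fold hc hP hd hM b hs
  obtain ⟨w, i', hw, hw1, hw2, hw3⟩ := exists_bigon_eq_fold hc hP hd hM b ht
  rw [hz1, hw1] at h
  have hle : ∀ {t : ℝ}, 2 * r * min t (1 - t) ≤ r := fun {t} => by
    have : min t (1 - t) ≤ 1 / 2 := by
      rcases le_total t (1 / 2) with h | h
      · exact (min_le_left _ _).trans h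
      · exact (min_le_right _ _).trans (by linarith)
    nlinarith
  have hzw : z = w := by
    rcases lt_or_ge (dist P z) r with h1 | h1
    · exact hsep.fold_injOn hc hP h1 (by rw [hw2]; exact hle) hw h
    rcases lt_or_ge (dist P w) r with h2 | h2
    · exact (hsep.fold_injOn hc hP h2 (by rw [hz2]; exact hle) hz h.symm).symm
    · exfalso
      rw [hz2] at h1
      rw [hw2] at h2
      have e1 : 1 / 2 ≤ min s (1 - s) := by nlinarith
      have e2 : 1 / 2 ≤ min t (1 - t) := by nlinarith
      rw [le_min_iff] at e1 e2
      linarith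
  have hmin : min s (1 - s) = min t (1 - t) := by
    rw [← hzw, hz2] at hw2
    exact mul_left_cancel₀ (by linarith) hw2
  have hs2 : s < 1 / 2 ∧ t = 1 - s := by
    rcases min_choice s (1 - s) with e1 | e1 <;> rcases min_choice t (1 - t) with e2 | e2 <;>
      rw [e1, e2] at hmin
    · linarith
    · have := min_eq_left_iff.1 e1
      constructor <;> linarith
    · have := min_eq_right_iff.1 e1
      have := min_eq_left_iff.1 e2
      linarith
    · linarith
  obtain ⟨hs2, rfl⟩ := hs2
  rcases hs.1.eq_or_lt with rfl | hs0
  · simp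
  exfalso
  obtain ⟨-, e1⟩ := hz3.resolve_right (by rintro ⟨h, -⟩; linarith)
  obtain ⟨-, e2⟩ := hw3.resolve_left (by rintro ⟨h, -⟩; linarith)
  have hmid := dist_left_geo (T.R j P) (T.R k P) (t := 1 / 2) (by norm_num)
  have hmid' := dist_geo_right (T.R j P) (T.R k P) (t := 1 / 2) (by norm_num)
  rw [hd, ← hMdef] at hmid hmid'
  have key : T.R j M = T.R k M := by
    have hPz : dist P z = 2 * r * s := by rw [hz2, min_eq_left (by linarith)]
    refine eq_of_between (a := 2 * r * s) (b := 2 * r * (1 / 2 - s)) (by positivity) hPz ?_ ?_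
      ?_ ?_
    · rw [e1, dist_R_R, hMdef, dist_geo _ _ hs (by norm_num), hd, abs_sub_comm,
        abs_of_pos (by linarith)]
    · rw [hzw, e2, dist_R_R, hMdef, dist_geo _ _ ht (by norm_num), hd, abs_of_pos (by linarith)]
      ring
    · rw [← dist_R_comm, hmid]; ring
    · rw [← dist_R_comm, dist_comm, hmid']; ring
  obtain ⟨l, hlj, hlk, -⟩ := exists_third hjk
  have h1 := T.x_R hjk.symm hlj.symm hlk.symm M
  have h2 := T.x_R_self j M
  rw [key] at h2
  have h3 := mul_nonneg (hpos k).le (hc l)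
  linarith [hpos j]

/-- Three descriptions as the image of a segment under a local isometry are used: before, at and
after the midpoint. -/
theorem bigon_locallyGeodesic (hc : ∀ i, 0 ≤ Real.cos (θ i)) (hP : P ∈ T.region)
    (hsep : Separated T P r) (hd : dist (T.R j P) (T.R k P) = 2 * r)
    (hr : 0 < r) (hM : geo (T.R j P) (T.R k P) (1 / 2) ∈ T.region)
    (hpos : ∀ i, 0 < T.x i (geo (T.R j P) (T.R k P) (1 / 2))) (b : Bool) :
    LocallyGeodesic (bigon T b P j k) (2 * r) := by
  have key : ∀ j k (f : ℝ → UpperHalfPlane) (t : ℝ) (u : Set ℝ), u ∈ 𝓝 t →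
      (∀ s ∈ u, ∀ s' ∈ u, dist (f s) (f s') = 2 * r * |s - s'|) →
      (∃ b', IsometricAt (fold T b') (f t) ∧ ∀ s ∈ u, bigon T b P j k s = fold T b' (f s)) →
      ∃ ε > 0, ∀ s s' : ℝ, |s - t| < ε → |s' - t| < ε →
        dist (bigon T b P j k s) (bigon T b P j k s') = 2 * r * |s - s'| := by
    rintro j k f t u hu hf ⟨b', ⟨U, hU, hU'⟩, hb'⟩
    have hfc : ContinuousAt f t := by
      have : LipschitzOnWith (Real.toNNReal (2 * r)) f u :=
        LipschitzOnWith.of_dist_le_mul fun s hs s' hs' => by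
          rw [Real.coe_toNNReal _ (by linarith), Real.dist_eq, hf s hs s' hs']
      exact this.continuousOn.continuousAt hu
    obtain ⟨ε, hε, h⟩ := Metric.mem_nhds_iff.1 (Filter.inter_mem (hfc hU) hu)
    refine ⟨ε, hε, fun s s' hs hs' => ?_⟩
    rw [← Real.dist_eq] at hs hs'
    obtain ⟨h1, h2⟩ := h hs
    obtain ⟨h1', h2'⟩ := h hs'
    rw [hb' s h2, hb' s' h2', hU' _ h1 _ h1', hf s h2 s' h2']
  refine ⟨continuousOn_bigon hc hP hM b, fun t ht => ?_⟩
  rcases lt_trichotomy t (1 / 2) with h | rfl | h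
  · refine key j k (fun s => T.R j (geo (T.R j P) (T.R k P) s)) t (Set.Icc 0 (1 / 2))
      (Icc_mem_nhds ht.1 h) (fun s hs s' hs' => ?_) ⟨b, ?_, fun s hs => bigon_eq hP hc hM hs b⟩
    · rw [dist_R_R, dist_geo _ _ ⟨hs.1, by linarith [hs.2]⟩ ⟨hs'.1, by linarith [hs'.2]⟩, hd]
    · refine (hsep.isometricAt hc hP
        (R_mem_wedge (geo_R_mem_wedge hP hc hM ⟨ht.1.le, h.le⟩)) ?_ b).1
      rw [← dist_R_comm, dist_left_geo _ _ ⟨ht.1.le, ht.2.le⟩, hd]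
      nlinarith
  · refine key j k (geo (T.R j P) (T.R k P)) (1 / 2) (Set.Icc 0 1)
      (Icc_mem_nhds (by norm_num) (by norm_num)) (fun s hs s' hs' => ?_)
      ⟨!b, (isometricAt_fold_of_mem (j := j) hc hM fun i _ => hpos i).1, fun s _ => rfl⟩
    rw [dist_geo _ _ hs hs', hd]
  · have hM' : geo (T.R k P) (T.R j P) (1 / 2) ∈ T.region := by
      rw [geo_symm _ _ (by norm_num)]; norm_num; norm_num at hM; exact hM
    refine key j k (fun s => T.R k (geo (T.R k P) (T.R j P) (1 - s))) t (Set.Icc (1 / 2) 1)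
      (Icc_mem_nhds h ht.2) (fun s hs s' hs' => ?_) ⟨b, ?_, fun s hs => ?_⟩
    · rw [dist_R_R, dist_geo _ _ ⟨by linarith [hs.2], by linarith [hs.1]⟩
        ⟨by linarith [hs'.2], by linarith [hs'.1]⟩, dist_comm, hd, ← abs_neg]
      ring_nf
    · refine (hsep.isometricAt hc hP
        (R_mem_wedge (geo_R_mem_wedge hP hc hM' ⟨by linarith [ht.2], by linarith⟩)) ?_ b).1
      rw [← dist_R_comm, dist_left_geo _ _ ⟨by linarith [ht.2], by linarith⟩, dist_comm, hd]
      nlinarith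
    · rw [bigon_symm _ _ _ _ ⟨by linarith [hs.1], hs.2⟩,
        bigon_eq hP hc hM' ⟨by linarith [hs.2], by linarith [hs.1]⟩ b]

/-- The loop around a vertex is geodesic, and it is shortest, if it goes around the vertex. -/
theorem isGeodesicLoop_bigonPath (hc : ∀ i, 0 ≤ Real.cos (θ i)) (hP : P ∈ T.region)
    (hsep : Separated T P r) (hr : 0 < r) (hjk : j ≠ k) (hd : dist (T.R j P) (T.R k P) = 2 * r)
    (hM : geo (T.R j P) (T.R k P) (1 / 2) ∈ T.region)
    (hpos : ∀ i, 0 < T.x i (geo (T.R j P) (T.R k P) (1 / 2))) (b : Bool) {v : Fin 3}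
    (hlink : ∃ δ, IsLinkingCurve T v δ ∧ FreelyHomotopic T (bigonPath hc hP hM b) δ) :
    IsGeodesicLoop T v (bigonPath hc hP hM b) := by
  refine ⟨fun s t h => ?_, fun t => bigon_notMem_singularSet hc hP hsep hr hd hM hpos b t.2, hlink,
    2 * r, by linarith, fun t ht0 ht1 => ?_⟩
  · rcases lt_trichotomy s t with hst | hst | hst
    · obtain ⟨h1, h2⟩ := bigon_simple hc hP hsep hr hjk hd hM hpos b s.2 t.2 hst h
      exact Or.inr (Or.inl ⟨Subtype.ext h1, Subtype.ext h2⟩)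
    · exact Or.inl hst
    · obtain ⟨h1, h2⟩ := bigon_simple hc hP hsep hr hjk hd hM hpos b t.2 s.2 hst h.symm
      exact Or.inr (Or.inr ⟨Subtype.ext h2, Subtype.ext h1⟩)
  · obtain ⟨ε, hε, H⟩ := (bigon_locallyGeodesic hc hP hsep hd hr hM hpos b).2 t ⟨ht0, ht1⟩
    refine ⟨Metric.ball t ε, Metric.ball_mem_nhds _ hε, fun s hs s' hs' => ?_⟩
    exact H s s' (by rwa [← Real.dist_eq]) (by rwa [← Real.dist_eq])

end Bigon

end

section

variable {θ : Fin 3 → ℝ} {T : HypTriangle θ}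

open HypTriangle

/-! ### Winding numbers -/

section Winding

variable {α : Type*} [TopologicalSpace α] {S : Set α}

theorem eq_of_forall_int_mul (hS : IsPreconnected S) {f : α → ℝ} (hf : ContinuousOn f S)
    (h : ∀ x ∈ S, ∃ n : ℤ, f x = n * (2 * Real.pi)) {x y : α} (hx : x ∈ S) (hy : y ∈ S) :
    f x = f y := by
  wlog hxy : f x ≤ f y generalizing x y
  · exact (this hy hx (le_of_not_ge hxy)).symm
  by_contra hne
  obtain ⟨m, hm⟩ := h x hx
  obtain ⟨n, hn⟩ := h y hy
  have hpi := Real.pi_pos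
  have hlt : f x < f y := lt_of_le_of_ne hxy hne
  rw [hm, hn] at hlt
  have hmn : (m : ℝ) < n := lt_of_mul_lt_mul_right hlt (by linarith)
  have hmn' : (m : ℝ) + 1 ≤ n := by exact_mod_cast hmn
  have hoc := (hS.image f hf).ordConnected
  obtain ⟨z, hz, hz'⟩ := hoc.out ⟨x, hx, rfl⟩ ⟨y, hy, rfl⟩
    -- A value halfway between consecutive multiples of `2 π` would be attained.
    (show (m + 1 / 2) * (2 * Real.pi) ∈ Set.Icc (f x) (f y) by
      rw [hm, hn]
      constructor <;> nlinarith)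
  obtain ⟨l, hl⟩ := h z hz
  rw [hz'] at hl
  have h2 := mul_right_cancel₀ (by linarith) hl
  have h3 : ((2 * m + 1 : ℤ) : ℝ) = (2 * l : ℤ) := by push_cast; linarith
  have h4 : (2 * m + 1 : ℤ) = 2 * l := by exact_mod_cast h3
  omega

theorem continuousWithinAt_arg {z : ℂ} (hz : z ≠ 0) :
    ContinuousWithinAt Complex.arg {z | 0 ≤ z.im} z := by
  by_cases h : z ∈ Complex.slitPlane
  · exact (Complex.continuousAt_arg h).continuousWithinAt
  · rw [Complex.mem_slitPlane_iff, not_or, not_lt, not_not] at h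
    refine Complex.continuousWithinAt_arg_of_re_neg_of_im_zero (lt_of_le_of_ne h.1 fun e => ?_) h.2
    exact hz (Complex.ext e h.2)

theorem im_sub_eq_arg_sub (hS : IsPreconnected S) {L w : α → ℂ} (hL : ContinuousOn L S)
    (hw : ContinuousOn w S) (h : ∀ x ∈ S, Complex.exp (L x) = w x) (h0 : ∀ x ∈ S, 0 ≤ (w x).im)
    {x y : α} (hx : x ∈ S) (hy : y ∈ S) :
    (L x).im - (L y).im = (w x).arg - (w y).arg := by
  have hne : ∀ x ∈ S, w x ≠ 0 := fun x hx => h x hx ▸ Complex.exp_ne_zero _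
  have hc : ContinuousOn (fun x => (w x).arg) S := fun x hx =>
    (continuousWithinAt_arg (hne x hx)).comp (hw x hx) h0
  have := eq_of_forall_int_mul hS (f := fun x => (L x).im - (w x).arg)
    ((Complex.continuous_im.comp_continuousOn hL).sub hc) (fun x hx => ?_) hx hy
  · linarith
  · have e := h x hx
    rw [← Complex.exp_log (hne x hx), Complex.exp_eq_exp_iff_exists_int] at e
    obtain ⟨n, hn⟩ := e
    refine ⟨n, ?_⟩
    have := congrArg Complex.im hn
    simp [Complex.log_im] at this
    linarith

/-- The change of the argument along a closed curve that crosses the real axis twice. -/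
theorem im_sub_eq_of_crossing {L w : I → ℂ} (hL : Continuous L) (hw : Continuous w)
    (h : ∀ x, Complex.exp (L x) = w x) {s s' : I} (hs : s ≤ s') (h01 : w 0 = w 1)
    (h1 : ∀ t ≤ s, 0 ≤ (w t).im) (h2 : ∀ t, s ≤ t → t ≤ s' → (w t).im ≤ 0)
    (h3 : ∀ t, s' ≤ t → 0 ≤ (w t).im) (h4 : (w s).im = 0) (h5 : (w s').im = 0) :
    (L 1).im - (L 0).im = 2 * ((w s).arg - (w s').arg) := by
  have e1 := im_sub_eq_arg_sub (isPreconnected_Icc (a := (0 : I)) (b := s)) hL.continuousOn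
    hw.continuousOn (fun x _ => h x) (fun x hx => h1 x hx.2) ⟨s.2.1, le_rfl⟩ ⟨le_rfl, s.2.1⟩
  have e2 := im_sub_eq_arg_sub (isPreconnected_Icc (a := s') (b := (1 : I))) hL.continuousOn
    hw.continuousOn (fun x _ => h x) (fun x hx => h3 x hx.1) ⟨s'.2.2, le_rfl⟩ ⟨le_rfl, s'.2.2⟩
  -- The part in the lower half-plane is conjugated, so that only the upper half-plane is needed,
  -- where `arg` is continuous up to the negative axis. At the two crossings the values are real,
  -- hence unchanged.
  have e3 := im_sub_eq_arg_sub (isPreconnected_Icc (a := s) (b := s'))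
    (L := fun t => (starRingEnd ℂ) (L t)) (w := fun t => (starRingEnd ℂ) (w t))
    (Complex.continuous_conj.comp hL).continuousOn (Complex.continuous_conj.comp hw).continuousOn
    (fun x _ => by rw [← h x, Complex.exp_conj]) (fun x hx => by simpa using h2 x hx.1 hx.2)
    ⟨hs, le_rfl⟩ ⟨le_rfl, hs⟩
  rw [Complex.conj_eq_iff_im.2 h4, Complex.conj_eq_iff_im.2 h5, Complex.conj_im,
    Complex.conj_im] at e3
  rw [h01] at e1
  linarith

/-- Homotopy invariance of the winding number: extend the homotopy to the simply connected plane,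
lift it through `exp`, and note that the increment of the argument is a continuous multiple of `2
π`. -/
theorem exists_log_of_homotopy {H : I × I → ℂ} (hH : Continuous H) (h0 : ∀ x, H x ≠ 0)
    (hloop : ∀ s, H (s, 0) = H (s, 1)) :
    ∃ L : I × I → ℂ, Continuous L ∧ (∀ x, Complex.exp (L x) = H x) ∧
      (L (0, 1)).im - (L (0, 0)).im = (L (1, 1)).im - (L (1, 0)).im := by
  set pr : ℝ → I := Set.projIcc 0 1 zero_le_one with hpr
  have hprc : Continuous pr := continuous_projIcc
  obtain ⟨F, ⟨-, hF⟩, -⟩ := Complex.isCoveringMapOn_exp.existsUnique_continuousMap_lifts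
    (A := ℝ × ℝ) ⟨fun x => H (pr x.1, pr x.2), by fun_prop⟩ (a₀ := (0, 0))
    (e₀ := Complex.log (H (pr 0, pr 0))) (Complex.exp_log (h0 _)) (fun x => h0 _)
  have hL : ∀ x : I × I, Complex.exp (F (x.1, x.2)) = H x := fun x => by
    have := congrFun hF (x.1, x.2)
    simpa [hpr] using this
  refine ⟨fun x => F (x.1, x.2), by fun_prop, hL, ?_⟩
  refine eq_of_forall_int_mul (isPreconnected_univ (α := I))
    (f := fun s => (F ((s : ℝ), ((1 : I) : ℝ))).im - (F ((s : ℝ), ((0 : I) : ℝ))).im)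
    (by fun_prop) (fun s _ => ?_) (Set.mem_univ 0) (Set.mem_univ 1)
  have e := (hL (s, 1)).trans ((hloop s).symm.trans (hL (s, 0)).symm)
  rw [Complex.exp_eq_exp_iff_exists_int] at e
  obtain ⟨n, hn⟩ := e
  refine ⟨n, ?_⟩
  have := congrArg Complex.im hn
  simp at this ⊢
  linarith

end Winding

/-! ### A function on the surface whose zeros are the singular points -/

theorem dist_le_dist_copy {b b' : Bool} {z w : UpperHalfPlane} (hz : z ∈ T.region)
    (hw : w ∈ T.region) : dist z w ≤ dist (copy T b z) (copy T b' w) := by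
  rcases eq_or_ne b' b with rfl | hb
  · exact (dist_copy_self hz hw).ge
  · obtain rfl : b' = !b := by cases b <;> cases b' <;> simp at hb ⊢
    obtain ⟨j, hj⟩ := exists_dist_R_le b hz hw
    exact (T.dist_le_dist_R (mul_nonneg (T.mem_region_iff.1 hz j) (T.mem_region_iff.1 hw j))).trans
      hj

/-- The map that identifies the two copies of the triangle. -/
theorem exists_projection (T : HypTriangle θ) : ∃ π : Surface T → UpperHalfPlane, Continuous π ∧
    (∀ p, π p ∈ T.region) ∧ ∀ b, ∀ z ∈ T.region, π (copy T b z) = z := by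
  choose b z hz h using fun p : Surface T => exists_eq_copy p
  have hl : LipschitzWith 1 z := LipschitzWith.mk_one fun p q => by
    conv_rhs => rw [h p, h q]
    exact dist_le_dist_copy (hz p) (hz q)
  refine ⟨z, hl.continuous, hz, fun b' w hw => ?_⟩
  have h1 := h (copy T b' w)
  rw [← dist_le_zero]
  refine (dist_le_dist_copy (hz _) hw (b := b (copy T b' w)) (b' := b')).trans ?_
  rw [← h1, dist_self]

theorem continuous_copy_projection {π : Surface T → UpperHalfPlane} (hπ : Continuous π)
    (hπT : ∀ p, π p ∈ T.region) (b : Bool) : Continuous fun p => copy T b (π p) := by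
  have : ContinuousOn (copy T b) T.region := by
    have : LipschitzOnWith 1 (copy T b) T.region := LipschitzOnWith.of_dist_le_mul
      fun z hz w hw => by rw [dist_copy_self hz hw]; simp
    exact this.continuousOn
  exact this.comp_continuous hπ hπT

theorem eq_or_eq_add (i v : Fin 3) : i = v ∨ i = v + 1 ∨ i = v + 2 := by revert i v; decide

/-- The copies go to the closed upper and lower half-planes; the imaginary part vanishes on the
sides, so the definitions fit together. The real part is chosen nonnegative on the side `v` and
nonpositive on the other two, so that the zeros are the vertices. -/
theorem exists_complex_function (T : HypTriangle θ) (b : Bool) (v : Fin 3) :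
    ∃ W : Surface T → ℂ, Continuous W ∧
      (∀ z ∈ T.region, W (copy T b z) =
        ⟨T.x (v + 1) z * T.x (v + 2) z - T.x v z, T.x v z * T.x (v + 1) z * T.x (v + 2) z⟩) ∧
      ∀ z ∈ T.region, W (copy T (!b) z) =
        ⟨T.x (v + 1) z * T.x (v + 2) z - T.x v z, -(T.x v z * T.x (v + 1) z * T.x (v + 2) z)⟩ := by
  classical
  obtain ⟨π, hπ, hπT, hπc⟩ := exists_projection T
  set f : Surface T → ℝ := fun p => T.x (v + 1) (π p) * T.x (v + 2) (π p) - T.x v (π p)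
  set g : Surface T → ℝ := fun p => T.x v (π p) * T.x (v + 1) (π p) * T.x (v + 2) (π p)
  have hx : ∀ i, Continuous fun p => T.x i (π p) := fun i => (T.continuous_x i).comp hπ
  have hf : Continuous f := ((hx _).mul (hx _)).sub (hx _)
  have hg : Continuous g := ((hx _).mul (hx _)).mul (hx _)
  set W : Surface T → ℂ := fun p => if copy T b (π p) = p then ⟨f p, g p⟩ else ⟨f p, -g p⟩
    with hW
  have h1 : ∀ p, copy T b (π p) = p → W p = ⟨f p, g p⟩ := fun p hp => if_pos hp
  have h2 : ∀ p, copy T (!b) (π p) = p → W p = ⟨f p, -g p⟩ := fun p hp => by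
    by_cases hp' : copy T b (π p) = p
    · have e : g p = 0 := by
        obtain ⟨-, i, hi⟩ := copy_eq_copy_not (hπT p) (hπT p) (hp'.trans hp.symm)
        rcases eq_or_eq_add i v with rfl | rfl | rfl <;> simp [g, hi]
      rw [h1 p hp', e, neg_zero]
    · exact if_neg hp'
  have hmk : ∀ {f g : Surface T → ℝ}, Continuous f → Continuous g →
      Continuous fun p => (⟨f p, g p⟩ : ℂ) := fun hf hg =>
    Complex.equivRealProdCLM.symm.continuous.comp (hf.prodMk hg)
  refine ⟨W, ?_, fun z hz => ?_, fun z hz => ?_⟩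
  · have hcl : ∀ b, IsClosed {p : Surface T | copy T b (π p) = p} := fun b =>
      isClosed_eq (continuous_copy_projection hπ hπT b) continuous_id
    have hun : {p : Surface T | copy T b (π p) = p} ∪ {p : Surface T | copy T (!b) (π p) = p} =
        Set.univ := by
      refine Set.eq_univ_of_forall fun p => ?_
      obtain ⟨b', z, hz, rfl⟩ := exists_eq_copy p
      rcases eq_or_ne b' b with rfl | hb
      · left; simp [hπc _ z hz]
      · right
        obtain rfl : b' = !b := by cases b <;> cases b' <;> simp at hb ⊢
        simp [hπc _ z hz]
    rw [← continuousOn_univ, ← hun]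
    exact ((hmk hf hg).continuousOn.congr h1).union_of_isClosed
      ((hmk hf hg.neg).continuousOn.congr h2) (hcl _) (hcl _)
  · rw [h1 _ (by rw [hπc _ z hz])]
    simp [f, g, hπc _ z hz]
  · rw [h2 _ (by rw [hπc _ z hz])]
    simp [f, g, hπc _ z hz]

/-- The closed curve crosses the side number `i` from the first to the second copy of the triangle,
and the side number `j` on the way back. -/
def Crosses (T : HypTriangle θ) (b : Bool) (i j : Fin 3) (γ : I → Surface T) : Prop :=
  ∃ s s' : I, s ≤ s' ∧ (∀ t ≤ s, ∃ z ∈ T.region, γ t = copy T b z) ∧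
    (∀ t, s ≤ t → t ≤ s' → ∃ z ∈ T.region, γ t = copy T (!b) z) ∧
    (∀ t, s' ≤ t → ∃ z ∈ T.region, γ t = copy T b z) ∧
    (∃ z ∈ T.region, T.x i z = 0 ∧ γ s = copy T b z) ∧
    ∃ z ∈ T.region, T.x j z = 0 ∧ γ s' = copy T b z

theorem IsLinkingCurve.crosses {v : Fin 3} {δ : I → Surface T} (h : IsLinkingCurve T v δ)
    (b : Bool) : ∃ i j, i ≠ v ∧ j ≠ v ∧ Crosses T b i j δ := by
  obtain ⟨-, h01, -, ⟨i, j, hi, hj, -, h0, m, hm, hmj⟩, hf, hb⟩ := h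
  have hf' : ∀ t : I, t ≤ m → ∃ z ∈ T.region, δ t = copy T true z := fun t ht => by
    obtain ⟨z, hz⟩ := hf t (by rw [← hm]; exact ht)
    exact ⟨z, z.2, by rw [copy_true z.2, hz]⟩
  have hb' : ∀ t : I, m ≤ t → ∃ z ∈ T.region, δ t = copy T false z := fun t ht => by
    obtain ⟨z, hz⟩ := hb t (by rw [← hm]; exact ht)
    exact ⟨z, z.2, by rw [copy_false z.2, hz]⟩
  have key : ∀ {b i t}, (∃ z ∈ T.region, δ t = copy T b z) → δ t ∈ sideSet T i →
      ∃ z ∈ T.region, T.x i z = 0 ∧ δ t = copy T b z := by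
    rintro b i t ⟨z, hz, e⟩ ht
    rw [e, copy_mem_sideSet_iff hz] at ht
    exact ⟨z, hz, ht, e⟩
  -- A linking curve starts on a side, so one of the outer intervals of the crossing pattern shrinks
  -- to an end of the unit interval.
  cases b
  · refine ⟨i, j, hi, hj, 0, m, m.2.1, fun t ht => ?_, fun t _ ht => hf' t ht, hb',
      key ?_ h0, key (hb' m le_rfl) hmj⟩
    · obtain rfl : t = 0 := le_antisymm ht t.2.1
      rw [h01]
      exact hb' 1 m.2.2
    · rw [h01]
      exact hb' 1 m.2.2
  · refine ⟨j, i, hj, hi, m, 1, m.2.2, hf', fun t ht _ => hb' t ht, fun t ht => ?_,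
      key (hf' m le_rfl) hmj, key ?_ (h01 ▸ h0)⟩
    · obtain rfl : t = 1 := le_antisymm t.2.2 ht
      rw [← h01]
      exact hf' 0 m.2.1
    · rw [← h01]
      exact hf' 0 m.2.1

theorem arg_eq {b : Bool} {v : Fin 3} {W : Surface T → ℂ}
    (hW : ∀ z ∈ T.region, W (copy T b z) =
      ⟨T.x (v + 1) z * T.x (v + 2) z - T.x v z, T.x v z * T.x (v + 1) z * T.x (v + 2) z⟩)
    {i : Fin 3} {z : UpperHalfPlane} (hz : z ∈ T.region) (hi : T.x i z = 0)
    (hs : copy T b z ∉ singularSet T) :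
    (W (copy T b z)).im = 0 ∧ (W (copy T b z)).arg = if i = v then 0 else Real.pi := by
  have h := T.mem_region_iff.1 hz
  have h0 : T.x v z * T.x (v + 1) z * T.x (v + 2) z = 0 := by
    rcases eq_or_eq_add i v with rfl | rfl | rfl <;> simp [hi]
  refine ⟨by rw [hW z hz]; exact h0, ?_⟩
  split_ifs with hiv
  · subst hiv
    rw [Complex.arg_eq_zero_iff, hW z hz]
    exact ⟨by simp only [hi, sub_zero]; exact mul_nonneg (h _) (h _), h0⟩
  · rw [Complex.arg_eq_pi_iff, hW z hz]
    refine ⟨?_, h0⟩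
    have h1 : T.x (v + 1) z * T.x (v + 2) z = 0 := by
      rcases (eq_or_eq_add i v).resolve_left hiv with rfl | rfl <;> simp [hi]
    simp only [h1, zero_sub, neg_lt_zero]
    refine lt_of_le_of_ne (h v) fun e => hs ?_
    rw [copy_mem_singularSet_iff hz]
    obtain ⟨l, -, -, hl⟩ := exists_third hiv
    refine ⟨l, fun m hm => ?_⟩
    rcases hl m with rfl | rfl | rfl
    exacts [absurd rfl hm, hi, e.symm]

/-- The winding number of a closed curve around the vertices. -/
theorem Crosses.im_sub {b : Bool} {v : Fin 3} {W : Surface T → ℂ} (hWc : Continuous W)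
    (hW : ∀ z ∈ T.region, W (copy T b z) =
      ⟨T.x (v + 1) z * T.x (v + 2) z - T.x v z, T.x v z * T.x (v + 1) z * T.x (v + 2) z⟩)
    (hW' : ∀ z ∈ T.region, W (copy T (!b) z) =
      ⟨T.x (v + 1) z * T.x (v + 2) z - T.x v z, -(T.x v z * T.x (v + 1) z * T.x (v + 2) z)⟩)
    {i j : Fin 3} {γ : I → Surface T} (hγ : Continuous γ) (h : Crosses T b i j γ)
    (h01 : γ 0 = γ 1) (hs : ∀ t, γ t ∉ singularSet T) {L : I → ℂ} (hL : Continuous L)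
    (hexp : ∀ t, Complex.exp (L t) = W (γ t)) :
    (L 1).im - (L 0).im =
      2 * ((if i = v then 0 else Real.pi) - (if j = v then 0 else Real.pi)) := by
  obtain ⟨s, s', hss, h1, h2, h3, ⟨z, hz, hz0, hze⟩, ⟨w, hw, hw0, hwe⟩⟩ := h
  have hzs := hze ▸ hs s
  have hws := hwe ▸ hs s'
  obtain ⟨e1, e2⟩ := arg_eq hW hz hz0 hzs
  obtain ⟨e3, e4⟩ := arg_eq hW hw hw0 hws
  rw [← hze] at e1 e2
  rw [← hwe] at e3 e4
  have hnn : ∀ z ∈ T.region, 0 ≤ T.x v z * T.x (v + 1) z * T.x (v + 2) z := fun z hz => by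
    have h := T.mem_region_iff.1 hz
    exact mul_nonneg (mul_nonneg (h _) (h _)) (h _)
  rw [im_sub_eq_of_crossing hL (hWc.comp hγ) hexp hss (congrArg W h01) (fun t ht => ?_)
    (fun t ht ht' => ?_) (fun t ht => ?_) e1 e3]
  · simp only [Function.comp, e2, e4]
  · obtain ⟨z, hz, e⟩ := h1 t ht
    simp only [Function.comp, e, hW z hz]
    exact hnn z hz
  · obtain ⟨z, hz, e⟩ := h2 t ht ht'
    simp only [Function.comp, e, hW' z hz]
    linarith [hnn z hz]
  · obtain ⟨z, hz, e⟩ := h3 t ht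
    simp only [Function.comp, e, hW z hz]
    exact hnn z hz

/-- At a zero `x v = x (v + 1) * x (v + 2)`; substituting this into the product gives a vanishing
square, so two coordinates vanish. -/
theorem complex_function_ne_zero {b : Bool} {v : Fin 3} {z : UpperHalfPlane} (hz : z ∈ T.region)
    (hs : copy T b z ∉ singularSet T) {y : ℝ}
    (hy : y = 0 → T.x v z * T.x (v + 1) z * T.x (v + 2) z = 0) :
    (⟨T.x (v + 1) z * T.x (v + 2) z - T.x v z, y⟩ : ℂ) ≠ 0 := by
  intro e
  have e1 := congrArg Complex.re e
  have e2 := hy (congrArg Complex.im e)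
  simp only [Complex.zero_re] at e1
  rw [copy_mem_singularSet_iff hz] at hs
  refine hs ?_
  have e3 : T.x v z = T.x (v + 1) z * T.x (v + 2) z := by linarith
  have e4 : T.x (v + 1) z * T.x (v + 2) z = 0 := by
    rw [e3, mul_assoc] at e2
    exact mul_self_eq_zero.1 e2
  rw [e4] at e3
  have hv := fun i => eq_or_eq_add i v
  rcases mul_eq_zero.1 e4 with h | h
  · refine ⟨v + 2, fun i hi => ?_⟩
    rcases hv i with rfl | rfl | rfl
    exacts [e3, h, absurd rfl hi]
  · refine ⟨v + 1, fun i hi => ?_⟩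
    rcases hv i with rfl | rfl | rfl
    exacts [e3, absurd rfl hi, h]

/-- A loop around a vertex does not go around a different vertex. -/
theorem Crosses.ne_of_linking {b : Bool} {v i j : Fin 3} {γ δ : I → Surface T} (hγ : Continuous γ)
    (h : Crosses T b i j γ) (hij : i ≠ j) (h01 : γ 0 = γ 1) (hδ : IsLinkingCurve T v δ)
    (hom : FreelyHomotopic T γ δ) : i ≠ v ∧ j ≠ v := by
  obtain ⟨W, hWc, hW, hW'⟩ := exists_complex_function T b v
  obtain ⟨H, hH, hH0, hH1, hHl, hHs⟩ := hom
  have hne : ∀ p, p ∉ singularSet T → W p ≠ 0 := by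
    intro p hp
    obtain ⟨b', z, hz, rfl⟩ := exists_eq_copy p
    rcases eq_or_ne b' b with rfl | hb
    · rw [hW z hz]
      exact complex_function_ne_zero hz hp id
    · obtain rfl : b' = !b := by cases b <;> cases b' <;> simp at hb ⊢
      rw [hW' z hz]
      exact complex_function_ne_zero hz hp neg_eq_zero.1
  obtain ⟨L, hL, hexp, hLe⟩ := exists_log_of_homotopy (hWc.comp hH) (fun x => hne _ (hHs x))
    (fun s => congrArg W (hHl s))
  have hLs : ∀ s : I, Continuous fun t => L (s, t) := fun s => hL.comp (by fun_prop)
  obtain ⟨i', j', hi', hj', hcr⟩ := hδ.crosses b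
  have e1 := h.im_sub hWc hW hW' hγ h01 (fun t => hH0 t ▸ hHs _) (hLs 0)
    (fun t => by rw [hexp, Function.comp, hH0])
  have e2 := hcr.im_sub hWc hW hW' hδ.1 hδ.2.1 hδ.2.2.1 (hLs 1)
    (fun t => by rw [hexp, Function.comp, hH1])
  -- A linking curve at `v` crosses the negative axis both times and has winding number zero. A
  -- curve crossing the side `v` and one other side would have winding number `1` or `-1`.
  rw [hLe, e2, if_neg hi', if_neg hj', sub_self, mul_zero] at e1
  have hpi := Real.pi_pos
  constructor
  · rintro rfl
    rw [if_pos rfl, if_neg hij.symm] at e1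
    linarith
  · rintro rfl
    rw [if_pos rfl, if_neg hij] at e1
    linarith

end

section

variable {θ : Fin 3 → ℝ} {T : HypTriangle θ}

open HypTriangle

/-! ### Closed curves that cross two sides go around the common vertex -/

theorem bigon_crosses {P : UpperHalfPlane} {j k : Fin 3} (hP : P ∈ T.region)
    (hc : ∀ i, 0 ≤ Real.cos (θ i)) (hM : geo (T.R j P) (T.R k P) (1 / 2) ∈ T.region) (b : Bool) :
    Crosses T b j k (fun t : I => bigon T b P j k t) := by
  have hM' : geo (T.R k P) (T.R j P) (1 / 2) ∈ T.region := by
    rw [geo_symm _ _ (by norm_num)]; norm_num; norm_num at hM; exact hM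
  obtain ⟨s, hs, h1, h2, h3⟩ := bigon_crossing hP hc hM b
  obtain ⟨s', hs', h1', h2', h3'⟩ := bigon_crossing hP hc hM' b
  refine ⟨⟨s, hs.1, by linarith [hs.2]⟩, ⟨1 - s', by linarith [hs'.2], by linarith [hs'.1]⟩,
    Subtype.mk_le_mk.2 (by linarith [hs.2, hs'.2]), fun t ht => h1 t ⟨t.2.1, ht⟩,
    fun t ht ht' => ?_, fun t ht => ?_, h3, ?_⟩
  · rcases le_total (t : ℝ) (1 / 2) with h | h
    · exact h2 t ⟨ht, h⟩
    · have ht'' : (t : ℝ) ≤ 1 - s' := ht'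
      simp only [bigon_symm b P j k t.2]
      exact h2' (1 - t) ⟨by linarith, by linarith⟩
  · have ht'' : 1 - s' ≤ (t : ℝ) := ht
    simp only [bigon_symm b P j k t.2]
    exact h1' (1 - t) ⟨by linarith [t.2.2], by linarith⟩
  · simp only [bigon_symm b P j k (t := 1 - s') ⟨by linarith [hs'.2], by linarith [hs'.1]⟩,
      sub_sub_cancel]
    exact h3'

/-- A periodic curve is homotopic to each of its reparametrizations. -/
theorem exists_linkingCurve_of_periodic {γ : I → Surface T} {E : ℝ → Surface T}
    (hE : Continuous E) (hper : ∀ x, E (x + 1) = E x) (hs : ∀ x, E x ∉ singularSet T)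
    (hγ : ∀ t : I, E t = γ t) {v i j : Fin 3} (hi : i ≠ v) (hj : j ≠ v) (hij : i ≠ j) {u w : ℝ}
    (huw : u ≤ w) (hwu : w ≤ u + 1) (h1 : ∀ x ∈ Set.Icc u w, ∃ z ∈ T.region, E x = copy T true z)
    (h2 : ∀ x ∈ Set.Icc w (u + 1), ∃ z ∈ T.region, E x = copy T false z)
    (hui : E u ∈ sideSet T i) (hwj : E w ∈ sideSet T j) :
    ∃ δ, IsLinkingCurve T v δ ∧ FreelyHomotopic T γ δ := by
  -- Piecewise linear, sending `0, 1 / 2, 1` to `u, w, u + 1`. As it advances by one period, the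
  -- affine homotopy from the identity to it runs through closed curves.
  set ρ : ℝ → ℝ := fun t => u + (w - u) * min (2 * t) 1 + (u + 1 - w) * max (2 * t - 1) 0 with hρ
  have hρc : Continuous ρ := by fun_prop
  have hρ0 : ρ 0 = u := by simp [hρ]
  have hρ1 : ρ 1 = u + 1 := by norm_num [hρ]
  have hρl : ∀ {t : ℝ}, t ≤ 1 / 2 → ρ t = u + (w - u) * (2 * t) := fun {t} ht => by
    simp only [hρ, min_eq_left (by linarith : 2 * t ≤ 1), max_eq_right (by linarith : 2 * t - 1 ≤ 0)]
    ring
  have hρr : ∀ {t : ℝ}, 1 / 2 ≤ t → ρ t = w + (u + 1 - w) * (2 * t - 1) := fun {t} ht => by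
    simp only [hρ, min_eq_right (by linarith : 1 ≤ 2 * t), max_eq_left (by linarith : 0 ≤ 2 * t - 1)]
    ring
  refine ⟨fun t => E (ρ t), ⟨by fun_prop, ?_, fun t => hs _,
    ⟨i, j, hi, hj, hij, by simpa [hρ0] using hui, ⟨1 / 2, by norm_num, by norm_num⟩, rfl, ?_⟩,
    fun t ht => ?_, fun t ht => ?_⟩, fun x => E ((1 - x.1) * x.2 + x.1 * ρ x.2), by fun_prop,
    fun t => by simp [hγ], fun t => by simp, fun s => ?_, fun x => hs _⟩
  · simp [hρ0, hρ1, hper]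
  · simp only [hρl le_rfl]
    norm_num
    exact hwj
  · simp only [hρl ht]
    obtain ⟨z, hz, e⟩ := h1 (u + (w - u) * (2 * t))
      ⟨by nlinarith [t.2.1, mul_nonneg (sub_nonneg.2 huw) t.2.1], by nlinarith⟩
    rw [e, copy_true hz]
    exact ⟨_, rfl⟩
  · simp only [hρr ht]
    obtain ⟨z, hz, e⟩ := h2 (w + (u + 1 - w) * (2 * t - 1))
      ⟨by nlinarith, by nlinarith [t.2.2]⟩
    rw [e, copy_false hz]
    exact ⟨_, rfl⟩
  · simp only [Set.Icc.coe_zero, Set.Icc.coe_one, hρ0, hρ1]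
    rw [← hper]
    ring_nf

theorem Crosses.exists_linkingCurve {b : Bool} {i j v : Fin 3} {p : Surface T} {γ : Path p p}
    (h : Crosses T b i j γ) (hi : i ≠ v) (hj : j ≠ v) (hij : i ≠ j)
    (hs : ∀ t, γ t ∉ singularSet T) : ∃ δ, IsLinkingCurve T v δ ∧ FreelyHomotopic T γ δ := by
  obtain ⟨s, s', hss, h1, h2, h3, ⟨z, hz, hz0, hze⟩, ⟨w, hw, hw0, hwe⟩⟩ := h
  have hss' : (s : ℝ) ≤ s' := hss
  set E : ℝ → Surface T := γ.extend ∘ Int.fract with hE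
  have hEc : Continuous E :=
    ContinuousOn.comp_fract'' γ.continuous_extend.continuousOn (by simp)
  have hper : ∀ x, E (x + 1) = E x := fun x => by simp [hE]
  have hEs : ∀ x, E x ∉ singularSet T := fun x => by
    simp only [hE, Function.comp]
    rw [γ.extend_apply ⟨Int.fract_nonneg x, (Int.fract_lt_one x).le⟩]
    exact hs _
  have hEγ : ∀ t : I, E t = γ t := fun t => by
    rcases t.2.2.eq_or_lt with ht | ht
    · obtain rfl : t = 1 := Subtype.ext ht
      simp [hE]
    · simp only [hE, Function.comp, Int.fract_eq_self.2 ⟨t.2.1, ht⟩]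
      exact γ.extend_extends' t
  have hEγ' : ∀ x (hx : x ∈ Set.Icc (0 : ℝ) 1), E x = γ ⟨x, hx⟩ := fun x hx => hEγ ⟨x, hx⟩
  have hEs1 : E s ∈ sideSet T i := by rw [hEγ, hze]; exact (copy_mem_sideSet_iff hz).2 hz0
  have hEs2 : E s' ∈ sideSet T j := by rw [hEγ, hwe]; exact (copy_mem_sideSet_iff hw).2 hw0
  have hmid : ∀ x ∈ Set.Icc (s : ℝ) s', ∃ z ∈ T.region, E x = copy T (!b) z := fun x hx => by
    rw [hEγ' x ⟨s.2.1.trans hx.1, hx.2.trans s'.2.2⟩]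
    exact h2 _ hx.1 hx.2
  have hout : ∀ x ∈ Set.Icc (s' : ℝ) (s + 1), ∃ z ∈ T.region, E x = copy T b z := fun x hx => by
    rcases le_total x 1 with hx1 | hx1
    · rw [hEγ' x ⟨s'.2.1.trans hx.1, hx1⟩]
      exact h3 _ hx.1
    · have h4 : E x = E (x - 1) := by rw [← hper (x - 1), sub_add_cancel]
      rw [h4, hEγ' (x - 1) ⟨by linarith, by linarith [hx.2, s.2.2]⟩]
      exact h1 _ (Subtype.mk_le_mk.2 (by linarith [hx.2]))
  have hs0 := s.2.1
  have hs1 := s'.2.2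
  cases b
  · exact exists_linkingCurve_of_periodic hEc hper hEs hEγ hi hj hij hss' (by linarith) hmid hout
      hEs1 hEs2
  -- Here the base point is in the first copy, so the arc in that copy passes through time `0` and
  -- begins at `s' - 1`.
  · refine exists_linkingCurve_of_periodic hEc hper hEs hEγ hj hi hij.symm (u := s' - 1) (w := s)
      (by linarith) (by linarith) (fun x hx => ?_) (fun x hx => ?_) ?_ hEs1
    · rw [← hper]
      exact hout _ ⟨by linarith [hx.1], by linarith [hx.2]⟩
    · exact hmid x ⟨hx.1, by linarith [hx.2]⟩
    · rw [← hper, sub_add_cancel]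
      exact hEs2

/-! ### The loops at a point where the three functions agree -/

section Loops

variable {P : UpperHalfPlane}

theorem ne_add (v : Fin 3) : v ≠ v + 1 ∧ v + 1 ≠ v + 2 ∧ v ≠ v + 2 := by revert v; decide

/-- If `x i` vanished, `g i` would be at least the sum of the two other functions, that is, `m ≥ 2
m`. -/
theorem x_pos_of_g_eq (hc : ∀ i, 0 ≤ Real.cos (θ i)) (hP : P ∈ T.region) (hm : 0 < T.m P)
    (hg : ∀ i, T.g i P = T.m P) (i : Fin 3) : 0 < T.x i P := by
  refine lt_of_le_of_ne (T.mem_region_iff.1 hP i) fun e => ?_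
  obtain ⟨h1, h3, h2⟩ := ne_add i
  have e1 := g_of_x_eq_zero h1.symm h2 h3 e.symm
  have e2 := g_of_x_eq_zero h2.symm h1 h3.symm e.symm
  have e3 := T.g_eq h1 h3 h2 P
  rw [hg] at e1 e2 e3
  have e4 : 0 ≤ T.x (i + 1) P := T.mem_region_iff.1 hP _
  have e5 : 0 ≤ T.x (i + 2) P := T.mem_region_iff.1 hP _
  nlinarith [mul_nonneg (mul_nonneg e4 e5) (hc i)]

/-- Since `cos (θ v) = 0`, the midpoint of the two mirror images is the cone point itself, so the
distance from `P` to it is `r`. -/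
theorem isAssociatedLoop_of_right_angle (hc : ∀ i, 0 ≤ Real.cos (θ i)) (hP : P ∈ T.region)
    {v j k : Fin 3} (hvj : v ≠ j) (hjk : j ≠ k) (hvk : v ≠ k) (hg : T.g v P = T.m P)
    (hm : 0 < T.m P) (hv : θ v = Real.pi / 2) (b : Bool) :
    ∃ γ : Path (copy T b P) (copy T b P), IsAssociatedLoop T v γ ∧
      pathLength γ = ENNReal.ofReal (2 * T.rad P) := by
  have hd := dist_R_R_eq_of_g_eq hc hP hvj hjk hvk hg
  have hr := rad_pos_iff.2 hm
  set r := T.rad P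
  set M := geo (T.R j P) (T.R k P) (1 / 2) with hMdef
  have h1 : dist (T.R j P) M = r := by
    rw [hMdef, dist_left_geo _ _ (by norm_num), hd]; ring
  have h2 : dist M (T.R k P) = r := by
    rw [hMdef, dist_geo_right _ _ (by norm_num), hd]; ring
  obtain ⟨hM, hMx⟩ := (separated_rad hc hP).midpoint hc hP hjk hd hr h1 h2
  obtain ⟨-, h3, h4⟩ := hMx v hvj hvk
  rw [hv, Real.cos_pi_div_two, mul_zero, mul_eq_zero, or_iff_right (Real.cosh_pos _).ne'] at h3 h4
  have hMv : ∀ i, i ≠ v → T.x i M = 0 := by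
    intro i hi
    obtain ⟨l, hlj, hlk, hl⟩ := exists_third hjk
    obtain rfl : v = l := by
      rcases hl v with h | h | h
      exacts [h, absurd h hvj, absurd h hvk]
    rcases hl i with rfl | rfl | rfl
    exacts [absurd rfl hi, h3, h4]
  have hPM : dist P M = r := by
    rw [← h1, T.dist_R_comm, T.R_eq_self h3]
  set η : Path (copy T b P) (copy T b M) :=
    { toFun := fun t => copy T b (geo P M t)
      continuous_toFun := by
        have := (continuousOn_fold_geo hc (j := j) (Or.inl hP) (Or.inl hM) b).comp_continuous
          continuous_subtype_val (fun t : I => t.2)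
        exact this.congr fun t => fold_of_mem (T.geo_mem_region hP hM t.2)
      source' := by simp [geo_zero]
      target' := by simp [geo_one] } with hη
  have hηa : ∀ t : I, η t = copy T b (geo P M t) := fun t => rfl
  have hηd : ∀ s t : I, dist (η s) (η t) = r * |(s : ℝ) - t| := fun s t => by
    rw [hηa, hηa, dist_copy_self (T.geo_mem_region hP hM s.2) (T.geo_mem_region hP hM t.2),
      dist_geo _ _ s.2 t.2, hPM]
  have hpa : dist (copy T b P) (copy T b M) = r := by rw [dist_copy_self hP hM, hPM]
  refine ⟨η.trans η.symm, Or.inl ⟨hv, copy T b M, ?_, η, le_antisymm ?_ ?_, rfl⟩,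
    le_antisymm ?_ ?_⟩
  · refine ⟨⟨M, hM⟩, fun i hi => ((T.side i).eval_eq_zero_iff M).2 (hMv i hi), ?_⟩
    rw [← copy_true hM]
    exact copy_eq_of_boundary hM h3 _ _
  · rw [hpa]
    exact pathLength_le η hr.le fun s t => (hηd s t).le
  · have := ofReal_le_pathLength η (le_refl 0)
    simpa only [η.source, dist_self, zero_add] using this
  · refine pathLength_le _ (by linarith) fun s t => ?_
    -- The path there and back is `η` run along a tent function, which is 2-Lipschitz.
    have key : ∀ t : I, ∃ t' : I, (t' : ℝ) = 1 - |2 * (t : ℝ) - 1| ∧ (η.trans η.symm) t = η t' := by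
      intro t
      rw [Path.trans_apply]
      split_ifs with ht
      · exact ⟨⟨2 * t, _⟩, by rw [abs_of_nonpos (by linarith)]; ring_nf, rfl⟩
      · refine ⟨unitInterval.symm ⟨2 * t - 1, _⟩, ?_, rfl⟩
        rw [abs_of_nonneg (by linarith), unitInterval.coe_symm_eq]
    obtain ⟨s', hs', e1⟩ := key s
    obtain ⟨t', ht', e2⟩ := key t
    rw [e1, e2, hηd, hs', ht', mul_comm 2 r, mul_assoc]
    refine mul_le_mul_of_nonneg_left ?_ hr.le
    rw [show (1 - |2 * (s : ℝ) - 1| - (1 - |2 * (t : ℝ) - 1|)) =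
      |2 * (t : ℝ) - 1| - |2 * (s : ℝ) - 1| by ring]
    refine (abs_abs_sub_abs_le _ _).trans_eq ?_
    rw [show (2 * (t : ℝ) - 1 - (2 * s - 1)) = 2 * (t - s) by ring, abs_mul, abs_sub_comm]
    norm_num
  · have := ofReal_le_pathLength (η.trans η.symm) (le_refl ⟨1 / 2, by norm_num, by norm_num⟩)
    have e : (η.trans η.symm) ⟨1 / 2, by norm_num, by norm_num⟩ = copy T b M := by
      rw [Path.trans_apply, dif_pos (by norm_num), hηa]
      norm_num [geo_one]
    rw [e, dist_self, dist_comm (copy T b M), hpa] at this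
    rwa [add_zero, ← two_mul] at this

/-- Since `cos (θ v) > 0`, the midpoint of the two mirror images is interior, so the folded segment
is a geodesic loop. It is shortest because every geodesic loop at this point has length at least `2
r`. -/
theorem isAssociatedLoop_of_acute (hc : ∀ i, 0 ≤ Real.cos (θ i)) (hP : P ∈ T.region)
    {v j k : Fin 3} (hvj : v ≠ j) (hjk : j ≠ k) (hvk : v ≠ k) (hg : T.g v P = T.m P)
    (hx : ∀ i, 0 < T.x i P) (hm : 0 < T.m P) (hv : θ v ≠ Real.pi / 2) (hcv : 0 < Real.cos (θ v))
    (b : Bool) :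
    ∃ γ : Path (copy T b P) (copy T b P), IsAssociatedLoop T v γ ∧
      pathLength γ = ENNReal.ofReal (2 * T.rad P) := by
  have hd := dist_R_R_eq_of_g_eq hc hP hvj hjk hvk hg
  have hr := rad_pos_iff.2 hm
  have hsep := separated_rad hc hP
  have h1 : dist (T.R j P) (geo (T.R j P) (T.R k P) (1 / 2)) = T.rad P := by
    rw [dist_left_geo _ _ (by norm_num), hd]; ring
  have h2 : dist (geo (T.R j P) (T.R k P) (1 / 2)) (T.R k P) = T.rad P := by
    rw [dist_geo_right _ _ (by norm_num), hd]; ring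
  obtain ⟨hM, hMx⟩ := hsep.midpoint hc hP hjk hd hr h1 h2
  obtain ⟨h5, h3, h4⟩ := hMx v hvj hvk
  have hpos : ∀ i, 0 < T.x i (geo (T.R j P) (T.R k P) (1 / 2)) := by
    intro i
    obtain ⟨l, hlj, hlk, hl⟩ := exists_third hjk
    obtain rfl : v = l := by
      rcases hl v with h | h | h
      exacts [h, absurd h hvj, absurd h hvk]
    rcases hl i with rfl | rfl | rfl
    · exact h5
    · exact pos_of_mul_pos_right (h3 ▸ mul_pos (hx _) hcv) (Real.cosh_pos _).le
    · exact pos_of_mul_pos_right (h4 ▸ mul_pos (hx _) hcv) (Real.cosh_pos _).le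
  obtain ⟨Ψ, hch, hΨ⟩ := hsep.exists_isChart hc hP b
  have hloop := isGeodesicLoop_bigonPath hc hP hsep hr hjk hd hM hpos b (v := v) <|
    Crosses.exists_linkingCurve (b := b) (bigon_crosses hP hc hM b) hvj.symm hvk.symm hjk
      fun t => bigon_notMem_singularSet hc hP hsep hr hd hM hpos b t.2
  have hle := pathLength_bigonPath_le hc hP hr hd hM b
  exact ⟨bigonPath hc hP hM b, Or.inr ⟨hv, hloop, fun γ' hγ' =>
    hle.trans (hγ'.le_pathLength hch hΨ hr)⟩, le_antisymm hle (hloop.le_pathLength hch hΨ hr)⟩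

/-- The length bounds the distance of the mirror images in the two sides at `v` by `2 r`: at a right
angle through the cone point, which both reflections fix, otherwise by rigidity of the loop and the
winding number. -/
theorem g_eq_of_isAssociatedLoop (hc : ∀ i, 0 ≤ Real.cos (θ i)) (hP : P ∈ T.region)
    (hm : 0 < T.m P) {v : Fin 3} {b : Bool} {γ : Path (copy T b P) (copy T b P)}
    (h : IsAssociatedLoop T v γ) (hl : pathLength γ = ENNReal.ofReal (2 * T.rad P)) :
    T.g v P = T.m P := by
  have hr := rad_pos_iff.2 hm
  have key : ∀ {j k}, v ≠ j → j ≠ k → v ≠ k → dist (T.R j P) (T.R k P) ≤ 2 * T.rad P →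
      T.g v P = T.m P := fun hvj hjk hvk h => by
    refine le_antisymm ?_ (T.m_le P v)
    rw [← sinh_rad_sq hc hP]
    exact (dist_R_R_le_iff hvj hjk hvk hr.le).1.1 h
  rcases h with ⟨-, a, ⟨A, hA, rfl⟩, η, -, rfl⟩ | ⟨-, hγ, -⟩
  · obtain ⟨h1, h2, h3⟩ := ne_add v
    refine key h1 h2 h3 ?_
    have hA' : ∀ i, i ≠ v → T.x i A = 0 := fun i hi => ((T.side i).eval_eq_zero_iff A).1 (hA i hi)
    have h4 := ofReal_le_pathLength (η.trans η.symm) (le_refl ⟨1 / 2, by norm_num, by norm_num⟩)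
    have e : (η.trans η.symm) ⟨1 / 2, by norm_num, by norm_num⟩ = front T A := by
      rw [Path.trans_apply, dif_pos (by norm_num)]
      convert η.target
      norm_num
    rw [e, dist_self, dist_comm (front T A), hl, ENNReal.ofReal_le_ofReal_iff (by linarith),
      ← copy_true A.2, copy_eq_of_boundary A.2 (hA' _ h1.symm) true b,
      dist_copy_self hP A.2] at h4
    have h5 := dist_triangle_right (T.R (v + 1) P) (T.R (v + 2) P) A
    rw [T.dist_R_comm (v + 1) P A, T.dist_R_comm (v + 2) P A, T.R_eq_self (hA' _ h1.symm),
      T.R_eq_self (hA' _ h3.symm)] at h5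
    linarith
  · obtain ⟨j, k, hjk, hd, hM, he⟩ := hγ.exists_bigon hc (separated_rad hc hP) hP hr hl
    obtain ⟨δ, hδ, hom⟩ := hγ.2.2.1
    have hcr : Crosses T b j k γ := by
      have : (fun t : I => bigon T b P j k t) = γ := funext fun t => (he t).symm
      exact this ▸ bigon_crosses hP hc hM b
    obtain ⟨hj, hk⟩ := hcr.ne_of_linking γ.continuous hjk (by simp) hδ hom
    exact key hj.symm hjk hk.symm hd.le

end Loops

/-! ### The maximum points -/

theorem m_pos_of_notMem_singularSet (hc : ∀ i, 0 ≤ Real.cos (θ i)) {P : UpperHalfPlane}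
    (hP : P ∈ T.region) {b : Bool} (h : copy T b P ∉ singularSet T) : 0 < T.m P := by
  refine lt_of_le_of_ne (m_nonneg hc hP) fun e => h ?_
  obtain ⟨i, hi⟩ := T.exists_g_eq_m P
  rw [copy_mem_singularSet_iff hP]
  exact ⟨i, fun j hj => x_eq_zero_of_g hc hP hj.symm (hi.trans e.symm)⟩

theorem notMem_singularSet_of_x_pos {P : UpperHalfPlane} (hP : P ∈ T.region)
    (hx : ∀ i, 0 < T.x i P) (b : Bool) : copy T b P ∉ singularSet T := by
  rw [copy_mem_singularSet_iff hP]
  rintro ⟨v, hv⟩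
  obtain ⟨i, hi⟩ := exists_ne v
  exact (hx i).ne' (hv i hi)

theorem m_le_of_g_eq (hc : ∀ i, 0 ≤ Real.cos (θ i)) (hD : 0 < gramDet θ) {P Q : UpperHalfPlane}
    (hg : ∀ i, T.g i P = T.m P) (hQ : Q ∈ T.region) : T.m Q ≤ T.m P := by
  by_contra! hlt
  have := eq_of_g_le hc hD hQ fun i => (hg i).trans_le (hlt.le.trans (T.m_le Q i))
  exact hlt.ne (congrArg T.m this)

theorem forall_injRadius_le_iff (hc : ∀ i, 0 ≤ Real.cos (θ i)) (hD : 0 < gramDet θ)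
    {P : UpperHalfPlane} (hP : P ∈ T.region) (b : Bool) :
    (∀ q, injRadius T q ≤ injRadius T (copy T b P)) ↔ ∀ Q ∈ T.region, T.m Q ≤ T.m P := by
  constructor
  · intro h Q hQ
    have := h (copy T b Q)
    rwa [injRadius_copy hc hD hP, injRadius_copy hc hD hQ, rad_le_rad_iff hc hP] at this
  · intro h q
    obtain ⟨b', Q, hQ, rfl⟩ := exists_eq_copy q
    rw [injRadius_copy hc hD hP, injRadius_copy hc hD hQ, rad_le_rad_iff hc hP]
    exact h Q hQ

theorem g_eq_of_isLocalMax (hc : ∀ i, 0 ≤ Real.cos (θ i)) (hD : 0 < gramDet θ)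
    {P : UpperHalfPlane} (hP : P ∈ T.region) {b : Bool}
    (h : IsLocalMax (injRadius T) (copy T b P)) : 0 < T.m P ∧ ∀ i, T.g i P = T.m P := by
  obtain ⟨δ, hδ, hmax⟩ := Metric.eventually_nhds_iff.1 h
  refine g_eq_of_localMax hc hD hP hδ fun Q hQ hPQ => ?_
  have := hmax (y := copy T b Q) (by rwa [dist_copy_self hQ hP, dist_comm])
  rwa [injRadius_copy hc hD hP, injRadius_copy hc hD hQ, rad_le_rad_iff hc hP] at this

/-- The triangle has one maximum point of `m`; its coordinates are positive, so its two copies are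
different points of the surface. -/
theorem ncard_maxima (hθ : ∀ i, 0 ≤ θ i ∧ θ i ≤ Real.pi / 2)
    (hsum : θ 0 + θ 1 + θ 2 < Real.pi) (hc : ∀ i, 0 ≤ Real.cos (θ i)) (T : HypTriangle θ) :
    {p : Surface T | ∀ q, injRadius T q ≤ injRadius T p}.ncard = 2 := by
  have hD := gramDet_pos hθ hsum
  obtain ⟨P, hP, hmax⟩ := exists_m_max hθ hsum hc T
  obtain ⟨hm, hg⟩ := g_eq_of_localMax hc hD hP one_pos fun Q hQ _ => hmax Q hQ
  have hne : copy T true P ≠ copy T false P := fun h => by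
    obtain ⟨-, i, hi⟩ := copy_eq_copy_not hP hP h
    exact (x_pos_of_g_eq hc hP hm hg i).ne' hi
  rw [← Set.ncard_pair hne]
  congr 1
  ext p
  obtain ⟨b, Q, hQ, rfl⟩ := exists_eq_copy p
  rw [Set.mem_ofPred_eq, forall_injRadius_le_iff hc hD hQ]
  constructor
  · intro h
    obtain ⟨-, hg'⟩ := g_eq_of_localMax hc hD hQ one_pos fun Q hQ _ => h Q hQ
    have : Q = P := eq_of_g_le hc hD hP fun i => by
      rw [hg, hg']; exact hmax Q hQ
    subst this
    cases b <;> simp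
  · rintro (h | h)
    · have : Q = P := by
        cases b
        · exact (copy_eq_copy_not hP hQ h.symm).1.symm
        · exact copy_injective hQ hP h
      exact this ▸ hmax
    · have : Q = P := by
        cases b
        · exact copy_injective hQ hP h
        · exact (copy_eq_copy_not hQ hP h).1
      exact this ▸ hmax

end

end TriangularSurface

end

/-! ### The main theorem -/

theorem mainTheorem8 (θ : Fin 3 → ℝ) (hθ : ∀ i, 0 ≤ θ i ∧ θ i ≤ Real.pi / 2)
    (hsum : θ 0 + θ 1 + θ 2 < Real.pi) (T : TriangularSurface.HypTriangle θ) :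
    (∀ p : TriangularSurface.Surface T,
      List.TFAE [
        ∀ q, TriangularSurface.injRadius T q ≤ TriangularSurface.injRadius T p,
        IsLocalMax (TriangularSurface.injRadius T) p,
        p ∉ TriangularSurface.singularSet T ∧
          ∀ v : Fin 3, ∃ γ : Path p p, TriangularSurface.IsAssociatedLoop T v γ ∧
            TriangularSurface.pathLength γ =
              ENNReal.ofReal (2 * TriangularSurface.injRadius T p)]) ∧
    {p : TriangularSurface.Surface T |
      ∀ q, TriangularSurface.injRadius T q ≤ TriangularSurface.injRadius T p}.ncard = 2 := by
  open TriangularSurface in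
  have hpi := Real.pi_pos
  have hc : ∀ i, 0 ≤ Real.cos (θ i) := fun i =>
    Real.cos_nonneg_of_mem_Icc ⟨by linarith [(hθ i).1], (hθ i).2⟩
  have hD := gramDet_pos hθ hsum
  refine ⟨fun p => ?_, ncard_maxima hθ hsum hc T⟩
  obtain ⟨b, P, hP, rfl⟩ := exists_eq_copy p
  tfae_have 1 → 2 := fun h => Filter.Eventually.of_forall h
  tfae_have 2 → 3 := by
    intro h
    obtain ⟨hm, hg⟩ := g_eq_of_isLocalMax hc hD hP h
    have hx := x_pos_of_g_eq hc hP hm hg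
    rw [injRadius_copy hc hD hP]
    refine ⟨notMem_singularSet_of_x_pos hP hx b, fun v => ?_⟩
    obtain ⟨h1, h2, h3⟩ := ne_add v
    by_cases hv : θ v = Real.pi / 2
    · exact isAssociatedLoop_of_right_angle hc hP h1 h2 h3 (hg v) hm hv b
    · exact isAssociatedLoop_of_acute hc hP h1 h2 h3 (hg v) hx hm hv
        (Real.cos_pos_of_mem_Ioo ⟨by linarith [(hθ v).1], lt_of_le_of_ne (hθ v).2 hv⟩) b
  tfae_have 3 → 1 := by
    rintro ⟨hs, h⟩
    rw [injRadius_copy hc hD hP] at h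
    rw [forall_injRadius_le_iff hc hD hP]
    have hm := m_pos_of_notMem_singularSet hc hP hs
    intro Q hQ
    refine m_le_of_g_eq hc hD (fun v => ?_) hQ
    obtain ⟨γ, hγ, hl⟩ := h v
    exact g_eq_of_isAssociatedLoop hc hP hm hγ hl
  tfae_finish
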